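/- Work in intensional Martin-Löf type theory, presented by its rules of derivation, with a cumulative hierarchy of universes $\mathcal{U}_0 : \mathcal{U}_1 : \mathcal{U}_2 : \cdots$, dependent function types with judgmental $\eta$, dependent pair types, coproducts, $\mathbf{0}$, $\mathbf{1}$, $\mathbb{N}$, identity types, and the univalence axiom for every $\mathcal{U}_i$ (no truncations, quotients or other higher inductive types). Numbers $n$ and universe levels are external, and a type is said to be inhabited if some closed term of that type is derivable. For an integer $n \ge -2$ and a type $A$ let $$\mathsf{is}\text{-}(-2)\text{-}\mathsf{type}(A) :\equiv \sum_{a:A}\prod_{x:A} (a = x), \qquad \mathsf{is}\text{-}(n+1)\text{-}\mathsf{type}(A) :\equiv \prod_{x,y:A} \mathsf{is}\text{-}n\text{-}\mathsf{type}(x = y).$$ Let $\mathcal{U}_i^{\le n} :\equiv \sum_{A:\mathcal{U}_i} \mathsf{is}\text{-}n\text{-}\mathsf{type}(A)$. For a pointed type $(A,a)$ let $\Omega(A,a) :\equiv ((a =_A a), \mathsf{refl}_a)$, $\Omega^0(A,a) :\equiv (A,a)$ and $\Omega^{k+1}(A,a) :\equiv \Omega^k(\Omega(A,a))$. Let $\mathsf{Loop}_{-1}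 :\equiv \mathbf{2}$, where $\mathbf{2} :\equiv \mathbf{1} + \mathbf{1}$, and for $n \ge 0$ let $$\mathsf{Loop}_n :\equiv \sum_{X : \mathcal{U}_n^{\le n}} \pi_1\bigl(\Omega^{n+1}(\mathcal{U}_n^{\le n}, X)\bigr),$$ where $\pi_1$ takes the underlying type of a pointed type. Call a closed type $A$ a strict $(n+1)$-type if the types $\mathsf{is}\text{-}(n+1)\text{-}\mathsf{type}(A)$ and $\neg\,\mathsf{is}\text{-}n\text{-}\mathsf{type}(A)$ are both inhabited. Theorem. (1) For every integer $n \ge -2$ there is a closed type, in some universe $\mathcal{U}_i$, that is a strict $(n+1)$-type. (2) For every integer $n \ge -1$, the type $\mathsf{Loop}_n : \mathcal{U}_{n+1}$ is a strict $(n+1)$-type. (3) For every integer $n \ge 0$, the type $\mathcal{U}_n^{\le n} : \mathcal{U}_{n+1}$ is a strict $(n+1)$-type. -/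

import Mathlib

/-!
# Martin-Löf type theory with a cumulative hierarchy of univalent universes

Raw terms (de Bruijn indices), substitution, and the derivation rules for the three judgment forms
"`Γ` is a context", "`Γ ⊢ a : A`" and "`Γ ⊢ a ≡ b : A`".  The theory has universes
`U_0 : U_1 : U_2 : …`, dependent functions with judgmental eta, dependent pairs, coproducts, the
empty type, the unit type, natural numbers, intensional identity types, and the univalence axiom for
each universe.  There are no truncations, no quotients, no higher inductive types, and function
extensionality is not assumed.
-/

namespace MLTT

/-- Raw terms.  A type is a term of a universe.  The number of variables bound in each argument is
given in the comments; an argument without a comment binds nothing. -/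
inductive Tm : Type
  /-- The variable with de Bruijn index `k`; index `0` is the variable bound last. -/
  | var (k : ℕ)
  /-- The universe `U_i`. -/
  | univ (i : ℕ)
  /-- `Π (x : A), B`, where `B` binds `x`. -/
  | pi (A B : Tm)
  /-- `λ (x : A), b`, where `b` binds `x`. -/
  | lam (A b : Tm)
  /-- The application `f a`. -/
  | app (f a : Tm)
  /-- `Σ (x : A), B`, where `B` binds `x`. -/
  | sig (A B : Tm)
  /-- The pair `(a, b)`. -/
  | pair (a b : Tm)
  /-- The eliminator of `Σ (x : A), B`; here `B` binds `x`, `C` binds `z`, and `g` binds `x, y`. -/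
  | sigInd (A B C g p : Tm)
  /-- The coproduct `A + B`. -/
  | sum (A B : Tm)
  /-- The left injection. -/
  | inl (a : Tm)
  /-- The right injection. -/
  | inr (b : Tm)
  /-- The eliminator of `A + B`; each of `C`, `c`, `d` binds one variable. -/
  | sumInd (A B C c d e : Tm)
  /-- The empty type `𝟎`. -/
  | empty
  /-- The eliminator of `𝟎`; `C` binds one variable. -/
  | emptyInd (C a : Tm)
  /-- The unit type `𝟏`. -/
  | unit
  /-- The point `⋆` of `𝟏`. -/
  | star
  /-- The eliminator of `𝟏`; `C` binds one variable. -/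
  | unitInd (C c a : Tm)
  /-- The type of natural numbers. -/
  | nat
  /-- The natural number zero. -/
  | zero
  /-- The successor. -/
  | succ (n : Tm)
  /-- The eliminator of the natural numbers; `C` binds one variable, `s` binds `x, y`, where `y` is
  the value at `x`. -/
  | natInd (C z s n : Tm)
  /-- The identity type `a =_A b`. -/
  | id (A a b : Tm)
  /-- `refl_a`. -/
  | refl (a : Tm)
  /-- Path induction (`J`) for the identity types of `A`; `C` binds `x, y, p` with `p : x =_A y`, and
  `c` binds one variable. -/
  | idInd (A C c a b p : Tm)
  /-- The constant that inhabits the univalence axiom for `A, B : U_i`. -/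
  | ua (i : ℕ) (A B : Tm)

/-! ## Renaming and substitution -/

/-- The renaming `ξ` carried under one binder. -/
def upRen (ξ : ℕ → ℕ) : ℕ → ℕ
  | 0 => 0
  | k + 1 => ξ k + 1

namespace Tm

/-- Renaming of the free variables. -/
def rename : (ℕ → ℕ) → Tm → Tm
  | ξ, var k => var (ξ k)
  | _, univ i => univ i
  | ξ, pi A B => pi (rename ξ A) (rename (upRen ξ) B)
  | ξ, lam A b => lam (rename ξ A) (rename (upRen ξ) b)
  | ξ, app f a => app (rename ξ f) (rename ξ a)
  | ξ, sig A B => sig (rename ξ A) (rename (upRen ξ) B)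
  | ξ, pair a b => pair (rename ξ a) (rename ξ b)
  | ξ, sigInd A B C g p =>
      sigInd (rename ξ A) (rename (upRen ξ) B) (rename (upRen ξ) C) (rename (upRen (upRen ξ)) g)
        (rename ξ p)
  | ξ, sum A B => sum (rename ξ A) (rename ξ B)
  | ξ, inl a => inl (rename ξ a)
  | ξ, inr b => inr (rename ξ b)
  | ξ, sumInd A B C c d e =>
      sumInd (rename ξ A) (rename ξ B) (rename (upRen ξ) C) (rename (upRen ξ) c)
        (rename (upRen ξ) d) (rename ξ e)
  | _, empty => empty
  | ξ, emptyInd C a => emptyInd (rename (upRen ξ) C) (rename ξ a)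
  | _, unit => unit
  | _, star => star
  | ξ, unitInd C c a => unitInd (rename (upRen ξ) C) (rename ξ c) (rename ξ a)
  | _, nat => nat
  | _, zero => zero
  | ξ, succ n => succ (rename ξ n)
  | ξ, natInd C z s n =>
      natInd (rename (upRen ξ) C) (rename ξ z) (rename (upRen (upRen ξ)) s) (rename ξ n)
  | ξ, id A a b => id (rename ξ A) (rename ξ a) (rename ξ b)
  | ξ, refl a => refl (rename ξ a)
  | ξ, idInd A C c a b p =>
      idInd (rename ξ A) (rename (upRen (upRen (upRen ξ))) C) (rename (upRen ξ) c) (rename ξ a)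
        (rename ξ b) (rename ξ p)
  | ξ, ua i A B => ua i (rename ξ A) (rename ξ B)

/-- Weakening by one variable. -/
def wk (A : Tm) : Tm := rename Nat.succ A

end Tm

/-- The substitution that sends the last variable to `a` and the others according to `σ`. -/
def scons (a : Tm) (σ : ℕ → Tm) : ℕ → Tm
  | 0 => a
  | k + 1 => σ k

/-- The substitution `σ` carried under one binder. -/
def up (σ : ℕ → Tm) : ℕ → Tm :=
  scons (Tm.var 0) (fun k => (σ k).wk)

namespace Tm

/-- Simultaneous (capture-avoiding) substitution for the free variables. -/
def subst : (ℕ → Tm) → Tm → Tm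
  | σ, var k => σ k
  | _, univ i => univ i
  | σ, pi A B => pi (subst σ A) (subst (up σ) B)
  | σ, lam A b => lam (subst σ A) (subst (up σ) b)
  | σ, app f a => app (subst σ f) (subst σ a)
  | σ, sig A B => sig (subst σ A) (subst (up σ) B)
  | σ, pair a b => pair (subst σ a) (subst σ b)
  | σ, sigInd A B C g p =>
      sigInd (subst σ A) (subst (up σ) B) (subst (up σ) C) (subst (up (up σ)) g) (subst σ p)
  | σ, sum A B => sum (subst σ A) (subst σ B)
  | σ, inl a => inl (subst σ a)
  | σ, inr b => inr (subst σ b)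
  | σ, sumInd A B C c d e =>
      sumInd (subst σ A) (subst σ B) (subst (up σ) C) (subst (up σ) c) (subst (up σ) d) (subst σ e)
  | _, empty => empty
  | σ, emptyInd C a => emptyInd (subst (up σ) C) (subst σ a)
  | _, unit => unit
  | _, star => star
  | σ, unitInd C c a => unitInd (subst (up σ) C) (subst σ c) (subst σ a)
  | _, nat => nat
  | _, zero => zero
  | σ, succ n => succ (subst σ n)
  | σ, natInd C z s n =>
      natInd (subst (up σ) C) (subst σ z) (subst (up (up σ)) s) (subst σ n)
  | σ, id A a b => id (subst σ A) (subst σ a) (subst σ b)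
  | σ, refl a => refl (subst σ a)
  | σ, idInd A C c a b p =>
      idInd (subst σ A) (subst (up (up (up σ))) C) (subst (up σ) c) (subst σ a) (subst σ b)
        (subst σ p)
  | σ, ua i A B => ua i (subst σ A) (subst σ B)

/-- `b[a/x]`, where `x` is the last variable of `b`. -/
def inst (b a : Tm) : Tm := subst (scons a var) b

/-- `c[a/x, b/y]`, where `x, y` are the last two variables of `c` (`y` is the very last). -/
def inst2 (c a b : Tm) : Tm := subst (scons b (scons a var)) c

/-- `c[a/x, b/y, p/z]`, where `x, y, z` are the last three variables of `c` (`z` is the very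
last). -/
def inst3 (c a b p : Tm) : Tm := subst (scons p (scons b (scons a var))) c

/-- For `C` over `Γ, z`: the term `C[t/z]` over `Γ, x, y`, where `t` is a term over `Γ, x, y`. -/
def instUnder2 (C t : Tm) : Tm := subst (scons t (fun k => var (k + 2))) C

/-! ## Derived type formers -/

/-- The type `A → B` of non-dependent functions. -/
def arrow (A B : Tm) : Tm := pi A B.wk

/-- The type `A × B` of non-dependent pairs. -/
def prod (A B : Tm) : Tm := sig A B.wk

/-- The negation `A → 𝟎`. -/
def neg (A : Tm) : Tm := arrow A empty

/-- The two-element type `𝟐 := 𝟏 + 𝟏`. -/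
def two : Tm := sum unit unit

/-- `isequiv f` for `f : A → B`, in the form
`(Σ (g : B → A), Π (y : B), f (g y) = y) × (Σ (h : B → A), Π (x : A), h (f x) = x)`. -/
def isEquiv (A B f : Tm) : Tm :=
  prod
    (sig (arrow B A)
      (pi B.wk (id B.wk.wk (app f.wk.wk (app (var 1) (var 0))) (var 0))))
    (sig (arrow B A)
      (pi A.wk (id A.wk.wk (app (var 1) (app f.wk.wk (var 0))) (var 0))))

/-- The type of equivalences `A ≃ B`, that is, `Σ (f : A → B), isequiv f`. -/
def equiv (A B : Tm) : Tm :=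
  sig (arrow A B) (isEquiv A.wk B.wk (var 0))

/-- The identity function of `A`. -/
def idFun (A : Tm) : Tm := lam A (var 0)

/-- The identity equivalence of `A`, with the identity as inverse on both sides. -/
def idEquiv (A : Tm) : Tm :=
  pair (idFun A)
    (pair (pair (idFun A) (lam A (refl (var 0)))) (pair (idFun A) (lam A (refl (var 0)))))

/-- The canonical map `idtoeqv : (A =_{U_i} B) → (A ≃ B)`, defined by path induction: it sends `refl`
to the identity equivalence. -/
def idToEquiv (i : ℕ) (A B : Tm) : Tm :=
  lam (id (univ i) A B)
    (idInd (univ i) (equiv (var 2) (var 1)) (idEquiv (var 0)) A.wk B.wk (var 0))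

end Tm

/-! ## Judgments and derivations -/

/-- Contexts; the head of the list is the type of the last variable. -/
abbrev Ctx := List Tm

/-- The three forms of judgment. -/
inductive Judgment : Type
  /-- `Γ` is a well-formed context. -/
  | ctx (Γ : Ctx)
  /-- `Γ ⊢ a : A`. -/
  | typ (Γ : Ctx) (a A : Tm)
  /-- `Γ ⊢ a ≡ b : A`. -/
  | eq (Γ : Ctx) (a b A : Tm)

open Tm in
/-- The derivable judgments.  In rules that extend the context by a type, the premise that this is a
type of some universe is written out. -/
inductive Deriv : Judgment → Prop
  -- contexts and variables
  | ctx_nil : Deriv (.ctx [])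
  | ctx_cons {Γ A i} : Deriv (.ctx Γ) → Deriv (.typ Γ A (univ i)) → Deriv (.ctx (A :: Γ))
  | var {Γ k A} : Deriv (.ctx Γ) → Γ[k]? = some A →
      Deriv (.typ Γ (var k) (A.rename (fun j => j + (k + 1))))
  -- judgmental equality is an equivalence relation and is respected by typing
  | eq_refl {Γ a A} : Deriv (.typ Γ a A) → Deriv (.eq Γ a a A)
  | eq_symm {Γ a b A} : Deriv (.eq Γ a b A) → Deriv (.eq Γ b a A)
  | eq_trans {Γ a b c A} : Deriv (.eq Γ a b A) → Deriv (.eq Γ b c A) → Deriv (.eq Γ a c A)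
  | conv {Γ a A B i} : Deriv (.typ Γ a A) → Deriv (.eq Γ A B (univ i)) → Deriv (.typ Γ a B)
  | eq_conv {Γ a b A B i} : Deriv (.eq Γ a b A) → Deriv (.eq Γ A B (univ i)) →
      Deriv (.eq Γ a b B)
  -- universes
  | univ_intro {Γ i} : Deriv (.ctx Γ) → Deriv (.typ Γ (univ i) (univ (i + 1)))
  | univ_cumul {Γ A i} : Deriv (.typ Γ A (univ i)) → Deriv (.typ Γ A (univ (i + 1)))
  | univ_cumul_eq {Γ A B i} : Deriv (.eq Γ A B (univ i)) → Deriv (.eq Γ A B (univ (i + 1)))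
  -- dependent functions
  | pi_form {Γ A B i} : Deriv (.typ Γ A (univ i)) → Deriv (.typ (A :: Γ) B (univ i)) →
      Deriv (.typ Γ (pi A B) (univ i))
  | pi_intro {Γ A B b i} : Deriv (.typ Γ A (univ i)) → Deriv (.typ (A :: Γ) b B) →
      Deriv (.typ Γ (lam A b) (pi A B))
  | pi_elim {Γ A B f a} : Deriv (.typ Γ f (pi A B)) → Deriv (.typ Γ a A) →
      Deriv (.typ Γ (app f a) (B.inst a))
  | pi_comp {Γ A B b a i} : Deriv (.typ Γ A (univ i)) → Deriv (.typ (A :: Γ) b B) →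
      Deriv (.typ Γ a A) → Deriv (.eq Γ (app (lam A b) a) (b.inst a) (B.inst a))
  | pi_uniq {Γ A B f} : Deriv (.typ Γ f (pi A B)) →
      Deriv (.eq Γ f (lam A (app f.wk (var 0))) (pi A B))
  | pi_form_eq {Γ A A' B B' i} : Deriv (.typ Γ A (univ i)) → Deriv (.eq Γ A A' (univ i)) →
      Deriv (.eq (A :: Γ) B B' (univ i)) → Deriv (.eq Γ (pi A B) (pi A' B') (univ i))
  | pi_intro_eq {Γ A A' B b b' i} : Deriv (.typ Γ A (univ i)) → Deriv (.eq Γ A A' (univ i)) →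
      Deriv (.eq (A :: Γ) b b' B) → Deriv (.eq Γ (lam A b) (lam A' b') (pi A B))
  | pi_elim_eq {Γ A B f f' a a'} : Deriv (.eq Γ f f' (pi A B)) → Deriv (.eq Γ a a' A) →
      Deriv (.eq Γ (app f a) (app f' a') (B.inst a))
  -- dependent pairs
  | sig_form {Γ A B i} : Deriv (.typ Γ A (univ i)) → Deriv (.typ (A :: Γ) B (univ i)) →
      Deriv (.typ Γ (sig A B) (univ i))
  | sig_intro {Γ A B a b i} : Deriv (.typ Γ A (univ i)) → Deriv (.typ (A :: Γ) B (univ i)) →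
      Deriv (.typ Γ a A) → Deriv (.typ Γ b (B.inst a)) → Deriv (.typ Γ (pair a b) (sig A B))
  | sig_elim {Γ A B C g p i j} : Deriv (.typ Γ A (univ i)) → Deriv (.typ (A :: Γ) B (univ i)) →
      Deriv (.typ (sig A B :: Γ) C (univ j)) →
      Deriv (.typ (B :: A :: Γ) g (C.instUnder2 (pair (var 1) (var 0)))) →
      Deriv (.typ Γ p (sig A B)) →
      Deriv (.typ Γ (sigInd A B C g p) (C.inst p))
  | sig_comp {Γ A B C g a b i j} : Deriv (.typ Γ A (univ i)) →
      Deriv (.typ (A :: Γ) B (univ i)) → Deriv (.typ (sig A B :: Γ) C (univ j)) →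
      Deriv (.typ (B :: A :: Γ) g (C.instUnder2 (pair (var 1) (var 0)))) →
      Deriv (.typ Γ a A) → Deriv (.typ Γ b (B.inst a)) →
      Deriv (.eq Γ (sigInd A B C g (pair a b)) (g.inst2 a b) (C.inst (pair a b)))
  | sig_form_eq {Γ A A' B B' i} : Deriv (.typ Γ A (univ i)) → Deriv (.eq Γ A A' (univ i)) →
      Deriv (.eq (A :: Γ) B B' (univ i)) → Deriv (.eq Γ (sig A B) (sig A' B') (univ i))
  | sig_intro_eq {Γ A B a a' b b' i} : Deriv (.typ Γ A (univ i)) →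
      Deriv (.typ (A :: Γ) B (univ i)) → Deriv (.eq Γ a a' A) → Deriv (.eq Γ b b' (B.inst a)) →
      Deriv (.eq Γ (pair a b) (pair a' b') (sig A B))
  | sig_elim_eq {Γ A A' B B' C C' g g' p p' i j} : Deriv (.typ Γ A (univ i)) →
      Deriv (.typ (A :: Γ) B (univ i)) →
      Deriv (.eq Γ A A' (univ i)) → Deriv (.eq (A :: Γ) B B' (univ i)) →
      Deriv (.eq (sig A B :: Γ) C C' (univ j)) →
      Deriv (.eq (B :: A :: Γ) g g' (C.instUnder2 (pair (var 1) (var 0)))) →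
      Deriv (.eq Γ p p' (sig A B)) →
      Deriv (.eq Γ (sigInd A B C g p) (sigInd A' B' C' g' p') (C.inst p))
  -- coproducts
  | sum_form {Γ A B i} : Deriv (.typ Γ A (univ i)) → Deriv (.typ Γ B (univ i)) →
      Deriv (.typ Γ (sum A B) (univ i))
  | sum_inl {Γ A B a i} : Deriv (.typ Γ A (univ i)) → Deriv (.typ Γ B (univ i)) →
      Deriv (.typ Γ a A) → Deriv (.typ Γ (inl a) (sum A B))
  | sum_inr {Γ A B b i} : Deriv (.typ Γ A (univ i)) → Deriv (.typ Γ B (univ i)) →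
      Deriv (.typ Γ b B) → Deriv (.typ Γ (inr b) (sum A B))
  | sum_elim {Γ A B C c d e i j} : Deriv (.typ Γ A (univ i)) → Deriv (.typ Γ B (univ i)) →
      Deriv (.typ (sum A B :: Γ) C (univ j)) →
      Deriv (.typ (A :: Γ) c (C.subst (scons (inl (var 0)) (fun k => var (k + 1))))) →
      Deriv (.typ (B :: Γ) d (C.subst (scons (inr (var 0)) (fun k => var (k + 1))))) →
      Deriv (.typ Γ e (sum A B)) →
      Deriv (.typ Γ (sumInd A B C c d e) (C.inst e))
  | sum_comp_inl {Γ A B C c d a i j} : Deriv (.typ Γ A (univ i)) → Deriv (.typ Γ B (univ i)) →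
      Deriv (.typ (sum A B :: Γ) C (univ j)) →
      Deriv (.typ (A :: Γ) c (C.subst (scons (inl (var 0)) (fun k => var (k + 1))))) →
      Deriv (.typ (B :: Γ) d (C.subst (scons (inr (var 0)) (fun k => var (k + 1))))) →
      Deriv (.typ Γ a A) →
      Deriv (.eq Γ (sumInd A B C c d (inl a)) (c.inst a) (C.inst (inl a)))
  | sum_comp_inr {Γ A B C c d b i j} : Deriv (.typ Γ A (univ i)) → Deriv (.typ Γ B (univ i)) →
      Deriv (.typ (sum A B :: Γ) C (univ j)) →
      Deriv (.typ (A :: Γ) c (C.subst (scons (inl (var 0)) (fun k => var (k + 1))))) →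
      Deriv (.typ (B :: Γ) d (C.subst (scons (inr (var 0)) (fun k => var (k + 1))))) →
      Deriv (.typ Γ b B) →
      Deriv (.eq Γ (sumInd A B C c d (inr b)) (d.inst b) (C.inst (inr b)))
  | sum_form_eq {Γ A A' B B' i} : Deriv (.eq Γ A A' (univ i)) → Deriv (.eq Γ B B' (univ i)) →
      Deriv (.eq Γ (sum A B) (sum A' B') (univ i))
  | sum_inl_eq {Γ A B a a' i} : Deriv (.typ Γ A (univ i)) → Deriv (.typ Γ B (univ i)) →
      Deriv (.eq Γ a a' A) → Deriv (.eq Γ (inl a) (inl a') (sum A B))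
  | sum_inr_eq {Γ A B b b' i} : Deriv (.typ Γ A (univ i)) → Deriv (.typ Γ B (univ i)) →
      Deriv (.eq Γ b b' B) → Deriv (.eq Γ (inr b) (inr b') (sum A B))
  | sum_elim_eq {Γ A A' B B' C C' c c' d d' e e' i j} : Deriv (.typ Γ A (univ i)) →
      Deriv (.typ Γ B (univ i)) →
      Deriv (.eq Γ A A' (univ i)) → Deriv (.eq Γ B B' (univ i)) →
      Deriv (.eq (sum A B :: Γ) C C' (univ j)) →
      Deriv (.eq (A :: Γ) c c' (C.subst (scons (inl (var 0)) (fun k => var (k + 1))))) →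
      Deriv (.eq (B :: Γ) d d' (C.subst (scons (inr (var 0)) (fun k => var (k + 1))))) →
      Deriv (.eq Γ e e' (sum A B)) →
      Deriv (.eq Γ (sumInd A B C c d e) (sumInd A' B' C' c' d' e') (C.inst e))
  -- the empty type
  | empty_form {Γ i} : Deriv (.ctx Γ) → Deriv (.typ Γ empty (univ i))
  | empty_elim {Γ C a j} : Deriv (.typ (empty :: Γ) C (univ j)) → Deriv (.typ Γ a empty) →
      Deriv (.typ Γ (emptyInd C a) (C.inst a))
  | empty_elim_eq {Γ C C' a a' j} : Deriv (.eq (empty :: Γ) C C' (univ j)) →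
      Deriv (.eq Γ a a' empty) → Deriv (.eq Γ (emptyInd C a) (emptyInd C' a') (C.inst a))
  -- the unit type
  | unit_form {Γ i} : Deriv (.ctx Γ) → Deriv (.typ Γ unit (univ i))
  | unit_intro {Γ} : Deriv (.ctx Γ) → Deriv (.typ Γ star unit)
  | unit_elim {Γ C c a j} : Deriv (.typ (unit :: Γ) C (univ j)) →
      Deriv (.typ Γ c (C.inst star)) → Deriv (.typ Γ a unit) →
      Deriv (.typ Γ (unitInd C c a) (C.inst a))
  | unit_comp {Γ C c j} : Deriv (.typ (unit :: Γ) C (univ j)) → Deriv (.typ Γ c (C.inst star)) →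
      Deriv (.eq Γ (unitInd C c star) c (C.inst star))
  | unit_elim_eq {Γ C C' c c' a a' j} : Deriv (.eq (unit :: Γ) C C' (univ j)) →
      Deriv (.eq Γ c c' (C.inst star)) → Deriv (.eq Γ a a' unit) →
      Deriv (.eq Γ (unitInd C c a) (unitInd C' c' a') (C.inst a))
  -- natural numbers
  | nat_form {Γ i} : Deriv (.ctx Γ) → Deriv (.typ Γ nat (univ i))
  | nat_zero {Γ} : Deriv (.ctx Γ) → Deriv (.typ Γ zero nat)
  | nat_succ {Γ n} : Deriv (.typ Γ n nat) → Deriv (.typ Γ (succ n) nat)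
  | nat_elim {Γ C z s n j} : Deriv (.typ (nat :: Γ) C (univ j)) →
      Deriv (.typ Γ z (C.inst zero)) →
      Deriv (.typ (C :: nat :: Γ) s (C.instUnder2 (succ (var 1)))) →
      Deriv (.typ Γ n nat) → Deriv (.typ Γ (natInd C z s n) (C.inst n))
  | nat_comp_zero {Γ C z s j} : Deriv (.typ (nat :: Γ) C (univ j)) →
      Deriv (.typ Γ z (C.inst zero)) →
      Deriv (.typ (C :: nat :: Γ) s (C.instUnder2 (succ (var 1)))) →
      Deriv (.eq Γ (natInd C z s zero) z (C.inst zero))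
  | nat_comp_succ {Γ C z s n j} : Deriv (.typ (nat :: Γ) C (univ j)) →
      Deriv (.typ Γ z (C.inst zero)) →
      Deriv (.typ (C :: nat :: Γ) s (C.instUnder2 (succ (var 1)))) →
      Deriv (.typ Γ n nat) →
      Deriv (.eq Γ (natInd C z s (succ n)) (s.inst2 n (natInd C z s n)) (C.inst (succ n)))
  | nat_succ_eq {Γ n n'} : Deriv (.eq Γ n n' nat) → Deriv (.eq Γ (succ n) (succ n') nat)
  | nat_elim_eq {Γ C C' z z' s s' n n' j} : Deriv (.typ (nat :: Γ) C (univ j)) →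
      Deriv (.eq (nat :: Γ) C C' (univ j)) →
      Deriv (.eq Γ z z' (C.inst zero)) →
      Deriv (.eq (C :: nat :: Γ) s s' (C.instUnder2 (succ (var 1)))) →
      Deriv (.eq Γ n n' nat) → Deriv (.eq Γ (natInd C z s n) (natInd C' z' s' n') (C.inst n))
  -- identity types
  | id_form {Γ A a b i} : Deriv (.typ Γ A (univ i)) → Deriv (.typ Γ a A) → Deriv (.typ Γ b A) →
      Deriv (.typ Γ (id A a b) (univ i))
  | id_intro {Γ A a i} : Deriv (.typ Γ A (univ i)) → Deriv (.typ Γ a A) →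
      Deriv (.typ Γ (refl a) (id A a a))
  | id_elim {Γ A C c a b p i j} : Deriv (.typ Γ A (univ i)) →
      Deriv (.typ (id A.wk.wk (var 1) (var 0) :: A.wk :: A :: Γ) C (univ j)) →
      Deriv (.typ (A :: Γ) c
        (C.subst (scons (refl (var 0)) (scons (var 0) (scons (var 0) (fun k => var (k + 1))))))) →
      Deriv (.typ Γ a A) → Deriv (.typ Γ b A) → Deriv (.typ Γ p (id A a b)) →
      Deriv (.typ Γ (idInd A C c a b p) (C.inst3 a b p))
  | id_comp {Γ A C c a i j} : Deriv (.typ Γ A (univ i)) →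
      Deriv (.typ (id A.wk.wk (var 1) (var 0) :: A.wk :: A :: Γ) C (univ j)) →
      Deriv (.typ (A :: Γ) c
        (C.subst (scons (refl (var 0)) (scons (var 0) (scons (var 0) (fun k => var (k + 1))))))) →
      Deriv (.typ Γ a A) →
      Deriv (.eq Γ (idInd A C c a a (refl a)) (c.inst a) (C.inst3 a a (refl a)))
  | id_form_eq {Γ A A' a a' b b' i} : Deriv (.eq Γ A A' (univ i)) → Deriv (.eq Γ a a' A) →
      Deriv (.eq Γ b b' A) → Deriv (.eq Γ (id A a b) (id A' a' b') (univ i))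
  | id_intro_eq {Γ A a a' i} : Deriv (.typ Γ A (univ i)) → Deriv (.eq Γ a a' A) →
      Deriv (.eq Γ (refl a) (refl a') (id A a a))
  | id_elim_eq {Γ A A' C C' c c' a a' b b' p p' i j} : Deriv (.typ Γ A (univ i)) →
      Deriv (.eq Γ A A' (univ i)) →
      Deriv (.eq (id A.wk.wk (var 1) (var 0) :: A.wk :: A :: Γ) C C' (univ j)) →
      Deriv (.eq (A :: Γ) c c'
        (C.subst (scons (refl (var 0)) (scons (var 0) (scons (var 0) (fun k => var (k + 1))))))) →
      Deriv (.eq Γ a a' A) → Deriv (.eq Γ b b' A) → Deriv (.eq Γ p p' (id A a b)) →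
      Deriv (.eq Γ (idInd A C c a b p) (idInd A' C' c' a' b' p') (C.inst3 a b p))
  -- the univalence axiom for the universe `U_i`
  | univalence {Γ i A B} : Deriv (.typ Γ A (univ i)) → Deriv (.typ Γ B (univ i)) →
      Deriv (.typ Γ (ua i A B) (isEquiv (id (univ i) A B) (equiv A B) (idToEquiv i A B)))
  | univalence_eq {Γ i A A' B B'} : Deriv (.eq Γ A A' (univ i)) → Deriv (.eq Γ B B' (univ i)) →
      Deriv (.eq Γ (ua i A B) (ua i A' B')
        (isEquiv (id (univ i) A B) (equiv A B) (idToEquiv i A B)))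

/-- `a : A` is derivable in the empty context. -/
def HasType (a A : Tm) : Prop := Deriv (.typ [] a A)

/-- The type `A` is inhabited: some closed term of type `A` is derivable. -/
def Inhab (A : Tm) : Prop := ∃ t : Tm, HasType t A

/-! ## Truncation levels -/

namespace Tm

/-- The type expressing that `A` is of h-level `k`, that is, a `(k - 2)`-type: contractible for
`k = 0`, and all identity types of `A` are of h-level `k` for `k + 1`. -/
def hLevel : ℕ → Tm → Tm
  | 0, A => sig A (pi A.wk (id A.wk.wk (var 1) (var 0)))
  | k + 1, A => pi A (pi A.wk (hLevel k (id A.wk.wk (var 1) (var 0))))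

/-- The type `is-n-type(A)`, for an integer `n ≥ -2`. -/
def isNType (n : ℤ) (A : Tm) : Tm := hLevel (n + 2).toNat A

/-- The subuniverse `U_i^{≤ n} := Σ (A : U_i), is-n-type(A)`, a closed term. -/
def subUniv (i : ℕ) (n : ℤ) : Tm := sig (univ i) (isNType n (var 0))

/-- The loop space `Ω(A, a) := ((a =_A a), refl_a)` of a pointed type, given as a pair of terms. -/
def loopSpace (X : Tm × Tm) : Tm × Tm := (id X.1 X.2 X.2, refl X.2)

/-- The iterated loop space: `Ω^0(A, a) := (A, a)` and `Ω^(k+1)(A, a) := Ω^k(Ω(A, a))`. -/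
def iterLoopSpace : ℕ → Tm × Tm → Tm × Tm
  | 0, X => X
  | k + 1, X => iterLoopSpace k (loopSpace X)

/-- The closed type `Loop_n`, for an integer `n ≥ -1`.  For `n ≥ 0` it is the type
`Σ (X : U_n^{≤ n}), Ω^(n+1)(U_n^{≤ n}, X)` of `(n+1)`-loops (the underlying type of the pointed type is
meant), and `Loop_{-1} := 𝟐`. -/
def loopTy : ℤ → Tm
  | Int.ofNat n => sig (subUniv n n) (iterLoopSpace (n + 1) (subUniv n n, var 0)).1
  | Int.negSucc _ => two

end Tm

/-- `A` is a closed type of the universe `U_i` that is strictly of truncation level `n + 1`: the types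
`is-(n+1)-type(A)` and `¬ is-n-type(A)` are both inhabited. -/
structure IsStrictSucc (i : ℕ) (n : ℤ) (A : Tm) : Prop where
  /-- `A : U_i`. -/
  isType : HasType A (Tm.univ i)
  /-- `A` is an `(n+1)`-type. -/
  trunc : Inhab (Tm.isNType (n + 1) A)
  /-- `A` is not an `n`-type. -/
  notTrunc : Inhab (Tm.neg (Tm.isNType n A))

end MLTT

/-!
# The universe of `n`-types in `U_n` is not an `n`-type

The type theory is shown to be closed under substitution, and a procedure `MLTT.run` that normalizes
and checks raw terms is proved sound for derivability.  The arguments of homotopy type theory are then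
given as raw terms, written with functions for binders, and checked by evaluating this procedure in
the kernel.  They treat truncation levels and loop spaces as functions of an internal natural number;
the last section passes to numerals.
-/

/-! ### The calculus of renamings and substitutions on raw terms. -/

namespace MLTT
namespace Tm

/-! Say that a type has h-level `k` if it is a `(k - 2)`-type. Let `T_n` be the type of types of
h-level `n + 2` in `U_n`, and let `L_n` be `Σ (X : T_n), Ω^(n+1)(T_n, X)`. By univalence `X = Y` is
a retract of `X ≃ Y`, so `T_n` has h-level `n + 3` (`hlTrunc`), and then so has `L_n` (`hlLoopTy`).
Pairing `X` with the constant loop makes `T_n` a retract of `L_n` (`loopTyNot`). It remains to show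
that `T_n` does not have h-level `n + 2`, and this goes by induction on `n`.

For `n = 0`: if the sets formed a set, then `𝟐 ≃ 𝟐` would be a proposition, but the identity and the
exchange of the two points differ (`truncSet`).

For the step (`truncStep`), suppose that `T_(n+1)` has h-level `n + 3`. Since `L_n` is a point of
`T_(n+1)`, the type `L_n = L_n` has h-level `n + 2`. By univalence so has `L_n ≃ L_n`, hence `id =
id` has h-level `n + 1`. By function extensionality the latter is the product of the types `u = u`
over `u : L_n`. Iterated loops in a product are computed pointwise, so the product of all
`Ω^(n+1)(L_n, u)` is a proposition (`propPiLoops`). This product contains the constant loops. It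
also contains a tautological section: at `u = (X, q)`, the loop `q` itself lifted to `L_n`
(`loopLoops`). The two sections must agree, so each `q` is trivial (`trivialLoops`), and `T_n` has
h-level `n + 2` (`hlOfTrivialLoops`), against the induction hypothesis.

The lift exists for two different reasons. If `n = 0`, the fibre over `X` is `X = X`, transport in
it is conjugation, and `q` is fixed by conjugation with itself (`trLoop`). If `n ≥ 1`, the fibres
are sets, because `T_n` has h-level `n + 3`; being of h-level `n + 1`, they do not obstruct the
lifting of `(n + 1)`-fold loops (`loopsSig`).

All this has to be derived inside the object theory, where function extensionality first has to be
obtained from univalence (`funext`). Each argument is a raw term that `MLTT.run` accepts, and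
`run_sound` turns acceptance into derivability. Soundness rests on stability under substitution
(`Deriv.stable`), on congruence for equal substitutions (`Deriv.functional`) and on the
presuppositions of judgments (`Deriv.wellTyped`). No normalization or confluence theorem enters:
where one would invoke injectivity of `Π`, the procedure checks the parts of a redex again. To
evaluate finitely many terms for all `n`, h-levels and loop spaces are defined by recursion on an
internal natural number and compared with the external ones at numerals (`hLevelAt_numeral`,
`loopsAt_numeral`). Other universe levels are reached by raising all levels in a derivation
(`Deriv.lift`). -/

theorem upRen_comp (ξ ζ : ℕ → ℕ) : upRen ξ ∘ upRen ζ = upRen (ξ ∘ ζ) := by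
  funext k; cases k <;> rfl

theorem up_var : up var = var := by
  funext k; cases k <;> rfl

/-- Carrying a substitution under a binder weakens its values. For this reason `rename_comp_up`
rests on this law, and `subst_comp_up` on the two mixed laws for renamings and substitutions. -/
theorem rename_rename (t : Tm) : ∀ ξ ζ : ℕ → ℕ, rename ξ (rename ζ t) = rename (ξ ∘ ζ) t := by
  induction t <;> intro ξ ζ <;> simp_all [rename, upRen_comp]

theorem up_comp_upRen (σ : ℕ → Tm) (ξ : ℕ → ℕ) : up σ ∘ upRen ξ = up (σ ∘ ξ) := by
  funext k; cases k <;> rfl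

theorem subst_rename (t : Tm) :
    ∀ (σ : ℕ → Tm) (ξ : ℕ → ℕ), subst σ (rename ξ t) = subst (σ ∘ ξ) t := by
  induction t <;> intro σ ξ <;> simp_all [rename, subst, up_comp_upRen]

theorem rename_comp_up (σ : ℕ → Tm) (ξ : ℕ → ℕ) :
    rename (upRen ξ) ∘ up σ = up (rename ξ ∘ σ) := by
  funext k
  cases k with
  | zero => rfl
  | succ k => simp [up, scons, wk, rename_rename]; rfl

theorem rename_subst (t : Tm) :
    ∀ (ξ : ℕ → ℕ) (σ : ℕ → Tm), rename ξ (subst σ t) = subst (rename ξ ∘ σ) t := by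
  induction t <;> intro ξ σ <;> simp_all [rename, subst, rename_comp_up]

theorem subst_comp_up (τ σ : ℕ → Tm) : subst (up τ) ∘ up σ = up (subst τ ∘ σ) := by
  funext k
  cases k with
  | zero => rfl
  | succ k => simp [up, scons, wk, rename_subst, subst_rename]; rfl

theorem subst_subst (t : Tm) :
    ∀ τ σ : ℕ → Tm, subst τ (subst σ t) = subst (subst τ ∘ σ) t := by
  induction t <;> intro τ σ <;> simp_all [subst, subst_comp_up]

@[simp] theorem subst_var (t : Tm) : subst var t = t := by
  induction t <;> simp_all [subst, up_var]

theorem rename_eq_subst (ξ : ℕ → ℕ) (t : Tm) : rename ξ t = subst (var ∘ ξ) t := by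
  have := subst_rename t var ξ
  rwa [subst_var] at this

theorem wk_eq_subst (t : Tm) : t.wk = t.subst (fun k => var (k + 1)) := rename_eq_subst _ _

theorem subst_congr {σ τ : ℕ → Tm} (t : Tm) (h : ∀ k, σ k = τ k) : subst σ t = subst τ t := by
  rw [funext h]

/-! ### Commutation with substitution -/

theorem subst_wk (σ : ℕ → Tm) (t : Tm) : (t.wk).subst (up σ) = (t.subst σ).wk := by
  simp only [wk, subst_rename, rename_subst]; rfl

theorem subst_wk_scons (a : Tm) (σ : ℕ → Tm) (t : Tm) : (t.wk).subst (scons a σ) = t.subst σ := by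
  simp only [wk, subst_rename]; rfl

theorem inst_wk (t a : Tm) : (t.wk).inst a = t := by
  rw [inst, subst_wk_scons, subst_var]

theorem subst_inst (σ : ℕ → Tm) (b a : Tm) :
    (b.inst a).subst σ = (b.subst (up σ)).inst (a.subst σ) := by
  simp only [inst, subst_subst]
  refine subst_congr _ fun k => ?_
  cases k with
  | zero => rfl
  | succ k => simp [scons, up, subst_wk_scons, subst]

theorem subst_inst2 (σ : ℕ → Tm) (c a b : Tm) :
    (c.inst2 a b).subst σ = (c.subst (up (up σ))).inst2 (a.subst σ) (b.subst σ) := by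
  simp only [inst2, subst_subst]
  refine subst_congr _ fun k => ?_
  rcases k with _ | _ | k
  · rfl
  · rfl
  · simp [scons, up, subst_wk_scons, subst]

theorem subst_inst3 (σ : ℕ → Tm) (c a b p : Tm) :
    (c.inst3 a b p).subst σ =
      (c.subst (up (up (up σ)))).inst3 (a.subst σ) (b.subst σ) (p.subst σ) := by
  simp only [inst3, subst_subst]
  refine subst_congr _ fun k => ?_
  rcases k with _ | _ | _ | k
  · rfl
  · rfl
  · rfl
  · simp [scons, up, subst_wk_scons, subst]

/-- This and the next two lemmas treat the instances of the motive in the premises of the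
eliminators: two new variables for `Σ` and `ℕ`, one for coproducts, and the diagonal for path
induction. -/
theorem subst_instUnder2 (σ : ℕ → Tm) (c t : Tm) :
    (c.instUnder2 t).subst (up (up σ)) =
      (c.subst (up σ)).instUnder2 (t.subst (up (up σ))) := by
  simp only [instUnder2, subst_subst]
  refine subst_congr _ fun k => ?_
  cases k with
  | zero => rfl
  | succ k =>
    simp only [Function.comp, scons, up, subst, wk_eq_subst, subst_subst]
    rfl

theorem subst_instUnder1 (σ : ℕ → Tm) (c t : Tm) :
    (c.subst (scons t (fun k => var (k + 1)))).subst (up σ) =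
      (c.subst (up σ)).subst (scons (t.subst (up σ)) (fun k => var (k + 1))) := by
  simp only [subst_subst]
  refine subst_congr _ fun k => ?_
  cases k with
  | zero => rfl
  | succ k =>
    simp only [Function.comp, scons, up, subst, wk_eq_subst, subst_subst]
    rfl

theorem subst_instDiag (σ : ℕ → Tm) (c : Tm) :
    (c.subst (scons (refl (var 0)) (scons (var 0) (scons (var 0) (fun k => var (k + 1)))))).subst
        (up σ) =
      (c.subst (up (up (up σ)))).subst
        (scons (refl (var 0)) (scons (var 0) (scons (var 0) (fun k => var (k + 1))))) := by
  simp only [subst_subst]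
  refine subst_congr _ fun k => ?_
  rcases k with _ | _ | _ | k
  · rfl
  · rfl
  · rfl
  · simp only [Function.comp, scons, up, subst, wk_eq_subst, subst_subst]
    rfl

theorem subst_arrow (σ : ℕ → Tm) (A B : Tm) :
    (arrow A B).subst σ = arrow (A.subst σ) (B.subst σ) := by
  simp [arrow, subst, subst_wk]

theorem subst_prod (σ : ℕ → Tm) (A B : Tm) :
    (prod A B).subst σ = prod (A.subst σ) (B.subst σ) := by
  simp [prod, subst, subst_wk]

theorem up_zero (σ : ℕ → Tm) : up σ 0 = var 0 := rfl

theorem up_up_one (σ : ℕ → Tm) : up (up σ) 1 = var 1 := rfl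

theorem up_up_up_two (σ : ℕ → Tm) : up (up (up σ)) 2 = var 2 := rfl

theorem subst_isEquiv (σ : ℕ → Tm) (A B f : Tm) :
    (isEquiv A B f).subst σ = isEquiv (A.subst σ) (B.subst σ) (f.subst σ) := by
  simp only [isEquiv, subst_prod, subst, subst_arrow, subst_wk, up_zero, up_up_one]

theorem subst_equiv (σ : ℕ → Tm) (A B : Tm) :
    (equiv A B).subst σ = equiv (A.subst σ) (B.subst σ) := by
  simp only [equiv, subst, subst_arrow, subst_isEquiv, subst_wk, up_zero]

theorem subst_idEquiv (σ : ℕ → Tm) (A : Tm) : (idEquiv A).subst σ = idEquiv (A.subst σ) := rfl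

theorem subst_idToEquiv (σ : ℕ → Tm) (i : ℕ) (A B : Tm) :
    (idToEquiv i A B).subst σ = idToEquiv i (A.subst σ) (B.subst σ) := by
  simp only [idToEquiv, subst, subst_equiv, subst_idEquiv, subst_wk, up_zero, up_up_one,
      up_up_up_two]

end Tm
end MLTT

namespace MLTT
open Tm

/-! ### Substitution preserves derivability -/

namespace Judgment

/-- The context of a judgment. -/
def context : Judgment → Ctx
  | ctx Γ => Γ
  | typ Γ _ _ => Γ
  | eq Γ _ _ _ => Γ

end Judgment

/-- Apart from the two context rules, every rule has a premise over the context of its conclusion,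
so an induction hypothesis is the claim. -/
theorem Deriv.context {J : Judgment} (h : Deriv J) : Deriv (.ctx J.context) := by
  induction h with
  | ctx_nil => exact .ctx_nil
  | ctx_cons h₁ h₂ => exact .ctx_cons h₁ h₂
  | _ => assumption

theorem Deriv.wf {Γ : Ctx} {a A : Tm} (h : Deriv (.typ Γ a A)) : Deriv (.ctx Γ) := h.context

theorem Deriv.wf_eq {Γ : Ctx} {a b A : Tm} (h : Deriv (.eq Γ a b A)) : Deriv (.ctx Γ) := h.context

theorem Deriv.ctx_tail {Γ : Ctx} {A : Tm} (h : Deriv (.ctx (A :: Γ))) : Deriv (.ctx Γ) := by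
  cases h; assumption

/-- A class of substitutions that is closed under weakening and under extension by a variable, and
whose members send variables to terms of the right types. -/
structure SubstClass (S : Ctx → (ℕ → Tm) → Ctx → Prop) : Prop where
  var : ∀ {Δ σ Γ k A}, Deriv (.ctx Δ) → S Δ σ Γ → Γ[k]? = some A →
    Deriv (.typ Δ (σ k) ((A.rename (fun j => j + (k + 1))).subst σ))
  wk : ∀ {Δ σ Γ B i}, S Δ σ Γ → Deriv (.typ Δ B (univ i)) → S (B :: Δ) (fun k => (σ k).wk) Γ
  up : ∀ {Δ σ Γ A i}, S Δ σ Γ → Deriv (.typ Δ (A.subst σ) (univ i)) →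
    S (A.subst σ :: Δ) (MLTT.up σ) (A :: Γ)

/-- A substitution of the class `S` into a well-formed context. -/
structure SubstInto (S : Ctx → (ℕ → Tm) → Ctx → Prop) (Δ : Ctx) (σ : ℕ → Tm) (Γ : Ctx) :
    Prop where
  isClass : SubstClass S
  wf : Deriv (.ctx Δ)
  mem : S Δ σ Γ

namespace SubstInto
variable {S : Ctx → (ℕ → Tm) → Ctx → Prop} {Δ Γ : Ctx} {σ : ℕ → Tm} {A B : Tm} {i : ℕ}

theorem up (h : SubstInto S Δ σ Γ) (hA : Deriv (.typ Δ (A.subst σ) (univ i))) :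
    SubstInto S (A.subst σ :: Δ) (MLTT.up σ) (A :: Γ) :=
  ⟨h.isClass, .ctx_cons h.wf hA, h.isClass.up h.mem hA⟩

theorem wk (h : SubstInto S Δ σ Γ) (hB : Deriv (.typ Δ B (univ i))) :
    SubstInto S (B :: Δ) (fun k => (σ k).wk) Γ :=
  ⟨h.isClass, .ctx_cons h.wf hB, h.isClass.wk h.mem hB⟩

theorem upSig (h : SubstInto S Δ σ Γ) (hA : Deriv (.typ Δ (A.subst σ) (univ i)))
    (hB : Deriv (.typ (A.subst σ :: Δ) (B.subst (MLTT.up σ)) (univ i))) :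
    SubstInto S (sig (A.subst σ) (B.subst (MLTT.up σ)) :: Δ) (MLTT.up σ) (sig A B :: Γ) :=
  h.up (A := sig A B) (.sig_form hA hB)

theorem upSum (h : SubstInto S Δ σ Γ) (hA : Deriv (.typ Δ (A.subst σ) (univ i)))
    (hB : Deriv (.typ Δ (B.subst σ) (univ i))) :
    SubstInto S (sum (A.subst σ) (B.subst σ) :: Δ) (MLTT.up σ) (sum A B :: Γ) :=
  h.up (A := sum A B) (.sum_form hA hB)

end SubstInto

/-- The judgment remains derivable under the substitutions of the class `S`. -/
def Judgment.Stable (S : Ctx → (ℕ → Tm) → Ctx → Prop) : Judgment → Prop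
  | .ctx _ => True
  | .typ Γ a A => ∀ {Δ σ}, SubstInto S Δ σ Γ → Deriv (.typ Δ (a.subst σ) (A.subst σ))
  | .eq Γ a b A => ∀ {Δ σ}, SubstInto S Δ σ Γ →
      Deriv (.eq Δ (a.subst σ) (b.subst σ) (A.subst σ))

namespace Tm

theorem subst_wk' (σ : ℕ → Tm) (t : Tm) : t.subst (fun k => (σ k).wk) = (t.subst σ).wk := by
  rw [wk, rename_subst]; rfl

end Tm

theorem Deriv.var_zero {Γ : Ctx} {A : Tm} (h : Deriv (.ctx (A :: Γ))) :
    Deriv (.typ (A :: Γ) (.var 0) A.wk) := .var h rfl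

theorem Deriv.var_one {Γ : Ctx} {A B : Tm} (h : Deriv (.ctx (B :: A :: Γ))) :
    Deriv (.typ (B :: A :: Γ) (.var 1) A.wk.wk) := by
  have := Deriv.var (k := 1) (A := A) h rfl
  rwa [wk, wk, rename_rename]

/-- The motive of path induction lives over three variables whose types involve weakenings of `A`.
Weakening of derivations is not yet available, so these types are obtained by applying `ihA` to
weakened substitutions. -/
theorem SubstInto.upId {S : Ctx → (ℕ → Tm) → Ctx → Prop} {Δ Γ : Ctx} {σ : ℕ → Tm} {A : Tm} {i : ℕ}
    (h : SubstInto S Δ σ Γ)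
    (ihA : ∀ {Δ σ}, SubstInto S Δ σ Γ → Deriv (.typ Δ (A.subst σ) (univ i))) :
    SubstInto S (id (A.subst σ).wk.wk (var 1) (var 0) :: (A.subst σ).wk :: A.subst σ :: Δ)
      (MLTT.up (MLTT.up (MLTT.up σ))) (id A.wk.wk (var 1) (var 0) :: A.wk :: A :: Γ) := by
  have h₁ := h.up (ihA h)
  have hw := h.wk (ihA h)
  have hA₁ := ihA hw
  have h₂ := h₁.up (A := A.wk) (i := i) (by rw [subst_wk, ← subst_wk']; exact hA₁)
  have hA₂ := ihA (hw.wk hA₁)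
  simp only [subst_wk'] at hA₁ hA₂
  rw [subst_wk] at h₂
  have h₃ := h₂.up (A := id A.wk.wk (var 1) (var 0)) (i := i) (by
    simp only [Tm.subst, subst_wk, up_zero, up_up_one]
    exact .id_form hA₂ (.var_one h₂.wf) (.var_zero h₂.wf))
  simpa only [Tm.subst, subst_wk, up_zero, up_up_one] using h₃

-- The class `S` is arbitrary because the induction is used twice. For renamings it gives weakening
-- of derivations; weakening is what makes typed substitutions closed under `up`, and then the same
-- result applies to these.
open Deriv in
theorem Deriv.stable {S : Ctx → (ℕ → Tm) → Ctx → Prop} {J : Judgment} (h : Deriv J) :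
    J.Stable S := by
  induction h with
  | ctx_nil => trivial
  | ctx_cons => trivial
  | var h₁ h₂ => intro Δ σ h; exact h.isClass.var h.wf h.mem h₂
  | eq_refl _ ih => intro Δ σ h; exact eq_refl (ih h)
  | eq_symm _ ih => intro Δ σ h; exact eq_symm (ih h)
  | eq_trans _ _ ih₁ ih₂ => intro Δ σ h; exact eq_trans (ih₁ h) (ih₂ h)
  | conv _ _ ih₁ ih₂ => intro Δ σ h; exact conv (ih₁ h) (ih₂ h)
  | eq_conv _ _ ih₁ ih₂ => intro Δ σ h; exact eq_conv (ih₁ h) (ih₂ h)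
  | univ_intro => intro Δ σ h; exact univ_intro h.wf
  | univ_cumul _ ih => intro Δ σ h; exact univ_cumul (ih h)
  | univ_cumul_eq _ ih => intro Δ σ h; exact univ_cumul_eq (ih h)
  | pi_form _ _ ihA ihB => intro Δ σ h; exact pi_form (ihA h) (ihB (h.up (ihA h)))
  | pi_intro _ _ ihA ihb => intro Δ σ h; exact pi_intro (ihA h) (ihb (h.up (ihA h)))
  | pi_elim _ _ ihf iha => intro Δ σ h; rw [subst_inst]; exact pi_elim (ihf h) (iha h)
  | pi_comp _ _ _ ihA ihb iha =>
    intro Δ σ h; rw [subst_inst, subst_inst]; exact pi_comp (ihA h) (ihb (h.up (ihA h))) (iha h)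
  | pi_uniq _ ihf =>
    intro Δ σ h
    simp only [Tm.subst, subst_wk, up_zero]
    exact pi_uniq (ihf h)
  | pi_form_eq _ _ _ ihA ihe ihB =>
    intro Δ σ h; exact pi_form_eq (ihA h) (ihe h) (ihB (h.up (ihA h)))
  | pi_intro_eq _ _ _ ihA ihe ihb =>
    intro Δ σ h; exact pi_intro_eq (ihA h) (ihe h) (ihb (h.up (ihA h)))
  | pi_elim_eq _ _ ihf iha => intro Δ σ h; rw [subst_inst]; exact pi_elim_eq (ihf h) (iha h)
  | sig_form _ _ ihA ihB => intro Δ σ h; exact sig_form (ihA h) (ihB (h.up (ihA h)))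
  | sig_intro _ _ _ _ ihA ihB iha ihb =>
    intro Δ σ h
    exact sig_intro (ihA h) (ihB (h.up (ihA h))) (iha h) (subst_inst σ _ _ ▸ ihb h)
  | sig_elim _ _ _ _ _ ihA ihB ihC ihg ihp =>
    intro Δ σ h
    have hA := ihA h
    have hB := ihB (h.up hA)
    have hg := ihg ((h.up hA).up hB)
    rw [subst_instUnder2] at hg
    rw [subst_inst]
    exact sig_elim hA hB (ihC (h.upSig hA hB)) hg (ihp h)
  | sig_comp _ _ _ _ _ _ ihA ihB ihC ihg iha ihb =>
    intro Δ σ h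
    have hA := ihA h
    have hB := ihB (h.up hA)
    have hg := ihg ((h.up hA).up hB)
    rw [subst_instUnder2] at hg
    rw [subst_inst, subst_inst2]
    exact sig_comp hA hB (ihC (h.upSig hA hB)) hg (iha h) (subst_inst σ _ _ ▸ ihb h)
  | sig_form_eq _ _ _ ihA ihe ihB =>
    intro Δ σ h; exact sig_form_eq (ihA h) (ihe h) (ihB (h.up (ihA h)))
  | sig_intro_eq _ _ _ _ ihA ihB iha ihb =>
    intro Δ σ h
    exact sig_intro_eq (ihA h) (ihB (h.up (ihA h))) (iha h) (subst_inst σ _ _ ▸ ihb h)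
  | sig_elim_eq _ _ _ _ _ _ _ ihA ihB iheA iheB ihC ihg ihp =>
    intro Δ σ h
    have hA := ihA h
    have hB := ihB (h.up hA)
    have hg := ihg ((h.up hA).up hB)
    rw [subst_instUnder2] at hg
    rw [subst_inst]
    exact sig_elim_eq hA hB (iheA h) (iheB (h.up hA)) (ihC (h.upSig hA hB)) hg (ihp h)
  | sum_form _ _ ihA ihB => intro Δ σ h; exact sum_form (ihA h) (ihB h)
  | sum_inl _ _ _ ihA ihB iha => intro Δ σ h; exact sum_inl (ihA h) (ihB h) (iha h)
  | sum_inr _ _ _ ihA ihB iha => intro Δ σ h; exact sum_inr (ihA h) (ihB h) (iha h)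
  | sum_elim _ _ _ _ _ _ ihA ihB ihC ihc ihd ihe =>
    intro Δ σ h
    have hc := ihc (h.up (ihA h))
    have hd := ihd (h.up (ihB h))
    rw [subst_instUnder1] at hc hd
    rw [subst_inst]
    exact sum_elim (ihA h) (ihB h) (ihC (h.upSum (ihA h) (ihB h))) hc hd (ihe h)
  | sum_comp_inl _ _ _ _ _ _ ihA ihB ihC ihc ihd ihe =>
    intro Δ σ h
    have hc := ihc (h.up (ihA h))
    have hd := ihd (h.up (ihB h))
    rw [subst_instUnder1] at hc hd
    rw [subst_inst, subst_inst]
    exact sum_comp_inl (ihA h) (ihB h) (ihC (h.upSum (ihA h) (ihB h))) hc hd (ihe h)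
  | sum_comp_inr _ _ _ _ _ _ ihA ihB ihC ihc ihd ihe =>
    intro Δ σ h
    have hc := ihc (h.up (ihA h))
    have hd := ihd (h.up (ihB h))
    rw [subst_instUnder1] at hc hd
    rw [subst_inst, subst_inst]
    exact sum_comp_inr (ihA h) (ihB h) (ihC (h.upSum (ihA h) (ihB h))) hc hd (ihe h)
  | sum_form_eq _ _ ihA ihB => intro Δ σ h; exact sum_form_eq (ihA h) (ihB h)
  | sum_inl_eq _ _ _ ihA ihB iha => intro Δ σ h; exact sum_inl_eq (ihA h) (ihB h) (iha h)
  | sum_inr_eq _ _ _ ihA ihB iha => intro Δ σ h; exact sum_inr_eq (ihA h) (ihB h) (iha h)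
  | sum_elim_eq _ _ _ _ _ _ _ _ ihA ihB iheA iheB ihC ihc ihd ihe =>
    intro Δ σ h
    have hc := ihc (h.up (ihA h))
    have hd := ihd (h.up (ihB h))
    rw [subst_instUnder1] at hc hd
    rw [subst_inst]
    exact sum_elim_eq (ihA h) (ihB h) (iheA h) (iheB h) (ihC (h.upSum (ihA h) (ihB h))) hc hd
      (ihe h)
  | empty_form => intro Δ σ h; exact empty_form h.wf
  | empty_elim _ _ ihC iha =>
    intro Δ σ h
    rw [subst_inst]
    exact empty_elim (ihC (h.up (A := empty) (empty_form (i := 0) h.wf))) (iha h)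
  | empty_elim_eq _ _ ihC iha =>
    intro Δ σ h
    rw [subst_inst]
    exact empty_elim_eq (ihC (h.up (A := empty) (empty_form (i := 0) h.wf))) (iha h)
  | unit_form => intro Δ σ h; exact unit_form h.wf
  | unit_intro => intro Δ σ h; exact unit_intro h.wf
  | unit_elim _ _ _ ihC ihc iha =>
    intro Δ σ h
    have hc := ihc h
    rw [subst_inst] at hc ⊢
    exact unit_elim (ihC (h.up (A := unit) (unit_form (i := 0) h.wf))) hc (iha h)
  | unit_comp _ _ ihC ihc =>
    intro Δ σ h
    have hc := ihc h
    rw [subst_inst] at hc ⊢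
    exact unit_comp (ihC (h.up (A := unit) (unit_form (i := 0) h.wf))) hc
  | unit_elim_eq _ _ _ ihC ihc iha =>
    intro Δ σ h
    have hc := ihc h
    rw [subst_inst] at hc ⊢
    exact unit_elim_eq (ihC (h.up (A := unit) (unit_form (i := 0) h.wf))) hc (iha h)
  | nat_form => intro Δ σ h; exact nat_form h.wf
  | nat_zero => intro Δ σ h; exact nat_zero h.wf
  | nat_succ _ ih => intro Δ σ h; exact nat_succ (ih h)
  | nat_elim _ _ _ _ ihC ihz ihs ihn =>
    intro Δ σ h
    have h' := h.up (A := nat) (nat_form (i := 0) h.wf)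
    have hz := ihz h
    have hs := ihs (h'.up (ihC h'))
    rw [subst_instUnder2] at hs
    rw [subst_inst] at hz ⊢
    exact nat_elim (ihC h') hz hs (ihn h)
  | nat_comp_zero _ _ _ ihC ihz ihs =>
    intro Δ σ h
    have h' := h.up (A := nat) (nat_form (i := 0) h.wf)
    have hz := ihz h
    have hs := ihs (h'.up (ihC h'))
    rw [subst_instUnder2] at hs
    rw [subst_inst] at hz ⊢
    exact nat_comp_zero (ihC h') hz hs
  | nat_comp_succ _ _ _ _ ihC ihz ihs ihn =>
    intro Δ σ h
    have h' := h.up (A := nat) (nat_form (i := 0) h.wf)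
    have hz := ihz h
    have hs := ihs (h'.up (ihC h'))
    rw [subst_instUnder2] at hs
    rw [subst_inst] at hz
    rw [subst_inst, subst_inst2]
    exact nat_comp_succ (ihC h') hz hs (ihn h)
  | nat_succ_eq _ ih => intro Δ σ h; exact nat_succ_eq (ih h)
  | nat_elim_eq _ _ _ _ _ ihC ihe ihz ihs ihn =>
    intro Δ σ h
    have h' := h.up (A := nat) (nat_form (i := 0) h.wf)
    have hz := ihz h
    have hs := ihs (h'.up (ihC h'))
    rw [subst_instUnder2] at hs
    rw [subst_inst] at hz ⊢
    exact nat_elim_eq (ihC h') (ihe h') hz hs (ihn h)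
  | id_form _ _ _ ihA iha ihb => intro Δ σ h; exact id_form (ihA h) (iha h) (ihb h)
  | id_intro _ _ ihA iha => intro Δ σ h; exact id_intro (ihA h) (iha h)
  | id_elim _ _ _ _ _ _ ihA ihC ihc iha ihb ihp =>
    intro Δ σ h
    have hc := ihc (h.up (ihA h))
    rw [subst_instDiag] at hc
    rw [subst_inst3]
    exact id_elim (ihA h) (ihC (h.upId ihA)) hc (iha h) (ihb h) (ihp h)
  | id_comp _ _ _ _ ihA ihC ihc iha =>
    intro Δ σ h
    have hc := ihc (h.up (ihA h))
    rw [subst_instDiag] at hc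
    rw [subst_inst, subst_inst3]
    exact id_comp (ihA h) (ihC (h.upId ihA)) hc (iha h)
  | id_form_eq _ _ _ ihA iha ihb => intro Δ σ h; exact id_form_eq (ihA h) (iha h) (ihb h)
  | id_intro_eq _ _ ihA iha => intro Δ σ h; exact id_intro_eq (ihA h) (iha h)
  | id_elim_eq _ _ _ _ _ _ _ ihA ihe ihC ihc iha ihb ihp =>
    intro Δ σ h
    have hc := ihc (h.up (ihA h))
    rw [subst_instDiag] at hc
    rw [subst_inst3]
    exact id_elim_eq (ihA h) (ihe h) (ihC (h.upId ihA)) hc (iha h) (ihb h) (ihp h)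
  | univalence _ _ ihA ihB =>
    intro Δ σ h
    simp only [subst_isEquiv, subst_equiv, subst_idToEquiv]
    exact univalence (ihA h) (ihB h)
  | univalence_eq _ _ ihA ihB =>
    intro Δ σ h
    simp only [subst_isEquiv, subst_equiv, subst_idToEquiv]
    exact univalence_eq (ihA h) (ihB h)

/-! ### Renamings -/

/-- `σ` is a renaming that sends the variables of `Γ` to variables of `Δ` of the same type. -/
def IsRenaming (Δ : Ctx) (σ : ℕ → Tm) (Γ : Ctx) : Prop :=
  ∃ ξ : ℕ → ℕ, σ = Tm.var ∘ ξ ∧ ∀ k A, Γ[k]? = some A → ∃ A', Δ[ξ k]? = some A' ∧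
    A'.rename (fun j => j + (ξ k + 1)) = (A.rename (fun j => j + (k + 1))).rename ξ

theorem isRenaming_class : SubstClass IsRenaming where
  var := by
    rintro Δ _ Γ k A hΔ ⟨ξ, rfl, h⟩ hk
    obtain ⟨A', h₁, h₂⟩ := h k A hk
    rw [← rename_eq_subst, ← h₂]
    exact .var hΔ h₁
  wk := by
    rintro Δ _ Γ B i ⟨ξ, rfl, h⟩ -
    refine ⟨fun k => ξ k + 1, rfl, fun k A hk => ?_⟩
    obtain ⟨A', h₁, h₂⟩ := h k A hk
    refine ⟨A', by simpa using h₁, ?_⟩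
    have := congrArg (rename Nat.succ) h₂
    simp only [rename_rename] at this ⊢
    exact this
  up := by
    rintro Δ _ Γ A i ⟨ξ, rfl, h⟩ -
    refine ⟨upRen ξ, by funext k; cases k <;> rfl, fun k B hk => ?_⟩
    cases k with
    | zero =>
      simp only [List.getElem?_cons_zero, Option.some.injEq] at hk
      subst hk
      refine ⟨_, rfl, ?_⟩
      rw [← rename_eq_subst, rename_rename, rename_rename]
      rfl
    | succ k =>
      obtain ⟨A', h₁, h₂⟩ := h k B (by simpa using hk)
      refine ⟨A', by simpa [upRen] using h₁, ?_⟩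
      have := congrArg (rename Nat.succ) h₂
      simp only [rename_rename] at this ⊢
      exact this

theorem isRenaming_succ (Γ : Ctx) (B : Tm) : IsRenaming (B :: Γ) (fun k => Tm.var (k + 1)) Γ :=
  ⟨Nat.succ, rfl, fun k A hk => ⟨A, by simpa using hk, by rw [rename_rename]; rfl⟩⟩

theorem Deriv.weaken {Γ : Ctx} {a A B : Tm} {i : ℕ} (h : Deriv (.typ Γ a A))
    (hB : Deriv (.typ Γ B (univ i))) : Deriv (.typ (B :: Γ) a.wk A.wk) := by
  rw [wk_eq_subst, wk_eq_subst]
  exact h.stable (S := IsRenaming) ⟨isRenaming_class, .ctx_cons h.context hB, isRenaming_succ Γ B⟩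

theorem Deriv.weaken_eq {Γ : Ctx} {a b A B : Tm} {i : ℕ} (h : Deriv (.eq Γ a b A))
    (hB : Deriv (.typ Γ B (univ i))) : Deriv (.eq (B :: Γ) a.wk b.wk A.wk) := by
  rw [wk_eq_subst, wk_eq_subst, wk_eq_subst]
  exact h.stable (S := IsRenaming) ⟨isRenaming_class, .ctx_cons h.context hB, isRenaming_succ Γ B⟩

/-! ### Substitutions -/

/-- `σ` sends the variables of `Γ` to terms over `Δ` of the right types. -/
def IsSubst (Δ : Ctx) (σ : ℕ → Tm) (Γ : Ctx) : Prop :=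
  ∀ k A, Γ[k]? = some A → Deriv (.typ Δ (σ k) ((A.rename (fun j => j + (k + 1))).subst σ))

theorem Tm.rename_add_succ (k : ℕ) (A : Tm) :
    A.rename (fun j => j + (k + 1 + 1)) = (A.rename (fun j => j + (k + 1))).wk := by
  rw [wk, rename_rename]; rfl

theorem isSubst_class : SubstClass IsSubst where
  var := fun _ h hk => h _ _ hk
  wk := by
    intro Δ σ Γ B i h hB k A hk
    have := (h k A hk).weaken hB
    rwa [← subst_wk'] at this
  up := by
    intro Δ σ Γ A i h hA k B hk
    cases k with
    | zero =>
      simp only [List.getElem?_cons_zero, Option.some.injEq] at hk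
      subst hk
      change Deriv (.typ _ _ (subst (MLTT.up σ) A.wk))
      rw [subst_wk]
      exact .var_zero (.ctx_cons hA.context hA)
    | succ k =>
      rw [rename_add_succ, subst_wk]
      exact (h k B (by simpa using hk)).weaken hA

theorem Deriv.subst_typ {Γ Δ : Ctx} {a A : Tm} {σ : ℕ → Tm} (h : Deriv (.typ Γ a A))
    (hΔ : Deriv (.ctx Δ)) (hσ : IsSubst Δ σ Γ) : Deriv (.typ Δ (a.subst σ) (A.subst σ)) :=
  h.stable (S := IsSubst) ⟨isSubst_class, hΔ, hσ⟩

theorem Deriv.subst_eq {Γ Δ : Ctx} {a b A : Tm} {σ : ℕ → Tm} (h : Deriv (.eq Γ a b A))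
    (hΔ : Deriv (.ctx Δ)) (hσ : IsSubst Δ σ Γ) :
    Deriv (.eq Δ (a.subst σ) (b.subst σ) (A.subst σ)) :=
  h.stable (S := IsSubst) ⟨isSubst_class, hΔ, hσ⟩

theorem IsSubst.var {Γ : Ctx} (h : Deriv (.ctx Γ)) : IsSubst Γ Tm.var Γ := fun k A hk => by
  rw [subst_var]; exact .var h hk

theorem IsSubst.cons {Δ Γ : Ctx} {σ : ℕ → Tm} {a A : Tm} (hσ : IsSubst Δ σ Γ)
    (ha : Deriv (.typ Δ a (A.subst σ))) : IsSubst Δ (scons a σ) (A :: Γ) := by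
  intro k B hk
  cases k with
  | zero =>
    simp only [List.getElem?_cons_zero, Option.some.injEq] at hk
    subst hk
    change Deriv (.typ _ _ (subst (scons a σ) A.wk))
    rwa [subst_wk_scons]
  | succ k =>
    rw [rename_add_succ, subst_wk_scons]
    exact hσ k B (by simpa using hk)

theorem IsSubst.wk {Δ Γ : Ctx} {σ : ℕ → Tm} {B : Tm} {i : ℕ} (hσ : IsSubst Δ σ Γ)
    (hB : Deriv (.typ Δ B (univ i))) : IsSubst (B :: Δ) (fun k => (σ k).wk) Γ :=
  isSubst_class.wk hσ hB

theorem IsSubst.up {Δ Γ : Ctx} {σ : ℕ → Tm} {A : Tm} {i : ℕ} (hσ : IsSubst Δ σ Γ)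
    (hA : Deriv (.typ Δ (A.subst σ) (univ i))) :
    IsSubst (A.subst σ :: Δ) (MLTT.up σ) (A :: Γ) :=
  isSubst_class.up hσ hA

end MLTT

namespace MLTT
open Tm

/-! ### Equal substitutions -/

/-- `σ` and `τ` are substitutions for the variables of `Γ` that are equal over `Δ`. -/
structure EqSubst (Δ : Ctx) (σ τ : ℕ → Tm) (Γ : Ctx) : Prop where
  wf : Deriv (.ctx Δ)
  left : IsSubst Δ σ Γ
  eq : ∀ k A, Γ[k]? = some A →
    Deriv (.eq Δ (σ k) (τ k) ((A.rename (fun j => j + (k + 1))).subst σ))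

namespace EqSubst
variable {Δ Γ : Ctx} {σ τ : ℕ → Tm} {A B : Tm} {i : ℕ}

theorem typ (h : EqSubst Δ σ τ Γ) {a A : Tm} (ha : Deriv (.typ Γ a A)) :
    Deriv (.typ Δ (a.subst σ) (A.subst σ)) :=
  ha.subst_typ h.wf h.left

theorem eq_left (h : EqSubst Δ σ τ Γ) {a b A : Tm} (ha : Deriv (.eq Γ a b A)) :
    Deriv (.eq Δ (a.subst σ) (b.subst σ) (A.subst σ)) :=
  ha.subst_eq h.wf h.left

theorem refl (hΔ : Deriv (.ctx Δ)) (h : IsSubst Δ σ Γ) : EqSubst Δ σ σ Γ :=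
  ⟨hΔ, h, fun k A hk => .eq_refl (h k A hk)⟩

theorem cons {a a' : Tm} (h : EqSubst Δ σ τ Γ) (ha : Deriv (.typ Δ a (A.subst σ)))
    (hae : Deriv (.eq Δ a a' (A.subst σ))) : EqSubst Δ (scons a σ) (scons a' τ) (A :: Γ) := by
  refine ⟨h.wf, h.left.cons ha, fun k B hk => ?_⟩
  cases k with
  | zero =>
    simp only [List.getElem?_cons_zero, Option.some.injEq] at hk
    subst hk
    change Deriv (.eq _ _ _ (subst (scons a σ) A.wk))
    rwa [subst_wk_scons]
  | succ k =>
    rw [rename_add_succ, subst_wk_scons]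
    exact h.eq k B (by simpa using hk)

theorem wk (h : EqSubst Δ σ τ Γ) (hB : Deriv (.typ Δ B (univ i))) :
    EqSubst (B :: Δ) (fun k => (σ k).wk) (fun k => (τ k).wk) Γ := by
  refine ⟨.ctx_cons h.wf hB, h.left.wk hB, fun k A hk => ?_⟩
  rw [subst_wk']
  exact (h.eq k A hk).weaken_eq hB

theorem up (h : EqSubst Δ σ τ Γ) (hA : Deriv (.typ Γ A (univ i))) :
    EqSubst (A.subst σ :: Δ) (MLTT.up σ) (MLTT.up τ) (A :: Γ) := by
  have hA' := h.typ hA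
  have h0 : Deriv (.typ (A.subst σ :: Δ) (Tm.var 0) (A.subst fun k => (σ k).wk)) := by
    rw [subst_wk']; exact .var_zero (.ctx_cons h.wf hA')
  exact (h.wk hA').cons h0 (.eq_refl h0)

end EqSubst

theorem Deriv.idCtx {Γ : Ctx} {A : Tm} {i : ℕ} (hA : Deriv (.typ Γ A (univ i))) :
    Deriv (.typ (A :: Γ) A.wk (univ i)) ∧
      Deriv (.typ (A.wk :: A :: Γ) (id A.wk.wk (.var 1) (.var 0)) (univ i)) := by
  have h₁ := hA.weaken hA
  have h₂ := Deriv.ctx_cons h₁.wf h₁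
  exact ⟨h₁, .id_form (h₁.weaken h₁) (.var_one h₂) (.var_zero h₂)⟩

theorem EqSubst.upId {Δ Γ : Ctx} {σ τ : ℕ → Tm} {A : Tm} {i : ℕ} (h : EqSubst Δ σ τ Γ)
    (hA : Deriv (.typ Γ A (univ i))) :
    EqSubst (id (A.subst σ).wk.wk (.var 1) (.var 0) :: (A.subst σ).wk :: A.subst σ :: Δ)
      (MLTT.up (MLTT.up (MLTT.up σ))) (MLTT.up (MLTT.up (MLTT.up τ)))
      (id A.wk.wk (.var 1) (.var 0) :: A.wk :: A :: Γ) := by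
  have := ((h.up hA).up hA.idCtx.1).up hA.idCtx.2
  simpa only [Tm.subst, subst_wk, up_zero, up_up_one] using this

/-- Terms respect equal substitutions. -/
def Judgment.Functional : Judgment → Prop
  | .typ Γ a A => ∀ {Δ σ τ}, EqSubst Δ σ τ Γ →
      Deriv (.eq Δ (a.subst σ) (a.subst τ) (A.subst σ))
  | _ => True

-- Each typing rule has a matching congruence rule that turns the induction hypotheses into the
-- claim. `EqSubst` demands typing of the left substitution only, so no presuppositions of equality
-- judgments are needed yet.
open Deriv in
theorem Deriv.functional {J : Judgment} (h : Deriv J) : J.Functional := by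
  induction h with
  | var _ h₂ => intro Δ σ τ h; exact h.eq _ _ h₂
  | conv _ h₂ ih₁ _ => intro Δ σ τ h; exact eq_conv (ih₁ h) (h.eq_left h₂)
  | univ_intro => intro Δ σ τ h; exact eq_refl (univ_intro h.wf)
  | univ_cumul _ ih => intro Δ σ τ h; exact univ_cumul_eq (ih h)
  | pi_form hA _ ihA ihB => intro Δ σ τ h; exact pi_form_eq (h.typ hA) (ihA h) (ihB (h.up hA))
  | pi_intro hA _ ihA ihb => intro Δ σ τ h; exact pi_intro_eq (h.typ hA) (ihA h) (ihb (h.up hA))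
  | pi_elim _ _ ihf iha => intro Δ σ τ h; rw [subst_inst]; exact pi_elim_eq (ihf h) (iha h)
  | sig_form hA _ ihA ihB => intro Δ σ τ h; exact sig_form_eq (h.typ hA) (ihA h) (ihB (h.up hA))
  | sig_intro hA hB _ _ _ _ iha ihb =>
    intro Δ σ τ h
    exact sig_intro_eq (h.typ hA) ((h.up hA).typ hB) (iha h) (subst_inst σ _ _ ▸ ihb h)
  | sig_elim hA hB _ _ _ ihA ihB ihC ihg ihp =>
    intro Δ σ τ h
    have hg := ihg ((h.up hA).up hB)
    rw [subst_instUnder2] at hg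
    rw [subst_inst]
    exact sig_elim_eq (h.typ hA) ((h.up hA).typ hB) (ihA h) (ihB (h.up hA))
      (ihC (h.up (sig_form hA hB))) hg (ihp h)
  | sum_form _ _ ihA ihB => intro Δ σ τ h; exact sum_form_eq (ihA h) (ihB h)
  | sum_inl hA hB _ _ _ iha => intro Δ σ τ h; exact sum_inl_eq (h.typ hA) (h.typ hB) (iha h)
  | sum_inr hA hB _ _ _ iha => intro Δ σ τ h; exact sum_inr_eq (h.typ hA) (h.typ hB) (iha h)
  | sum_elim hA hB _ _ _ _ ihA ihB ihC ihc ihd ihe =>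
    intro Δ σ τ h
    have hc := ihc (h.up hA)
    have hd := ihd (h.up hB)
    rw [subst_instUnder1] at hc hd
    rw [subst_inst]
    exact sum_elim_eq (h.typ hA) (h.typ hB) (ihA h) (ihB h) (ihC (h.up (sum_form hA hB))) hc hd
      (ihe h)
  | empty_form => intro Δ σ τ h; exact eq_refl (empty_form h.wf)
  | @empty_elim Γ C a j _ h₂ ihC iha =>
    intro Δ σ τ h
    rw [subst_inst]
    exact empty_elim_eq (ihC (h.up (empty_form (i := 0) h₂.wf))) (iha h)
  | unit_form => intro Δ σ τ h; exact eq_refl (unit_form h.wf)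
  | unit_intro => intro Δ σ τ h; exact eq_refl (unit_intro h.wf)
  | unit_elim _ _ h₂ ihC ihc iha =>
    intro Δ σ τ h
    have hc := ihc h
    rw [subst_inst] at hc ⊢
    exact unit_elim_eq (ihC (h.up (unit_form (i := 0) h₂.wf))) hc (iha h)
  | nat_form => intro Δ σ τ h; exact eq_refl (nat_form h.wf)
  | nat_zero => intro Δ σ τ h; exact eq_refl (nat_zero h.wf)
  | nat_succ _ ih => intro Δ σ τ h; exact nat_succ_eq (ih h)
  | nat_elim hC _ _ hn ihC ihz ihs ihn =>
    intro Δ σ τ h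
    have h' := h.up (nat_form (i := 0) hn.wf)
    have hz := ihz h
    have hs := ihs (h'.up hC)
    rw [subst_instUnder2] at hs
    rw [subst_inst] at hz ⊢
    exact nat_elim_eq (h'.typ hC) (ihC h') hz hs (ihn h)
  | id_form _ _ _ ihA iha ihb => intro Δ σ τ h; exact id_form_eq (ihA h) (iha h) (ihb h)
  | id_intro hA _ _ iha => intro Δ σ τ h; exact id_intro_eq (h.typ hA) (iha h)
  | id_elim hA _ _ _ _ _ ihA ihC ihc iha ihb ihp =>
    intro Δ σ τ h
    have hc := ihc (h.up hA)
    rw [subst_instDiag] at hc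
    rw [subst_inst3]
    exact id_elim_eq (h.typ hA) (ihA h) (ihC (h.upId hA)) hc (iha h) (ihb h) (ihp h)
  | univalence _ _ ihA ihB =>
    intro Δ σ τ h
    simp only [subst_isEquiv, subst_equiv, subst_idToEquiv]
    exact univalence_eq (ihA h) (ihB h)
  | _ => trivial

/-! ### Consequences for one, two and three variables -/

namespace Deriv
variable {Γ : Ctx} {A A' B B' T a a' b b' c p p' : Tm} {i j : ℕ}

theorem inst (ht : Deriv (.typ (A :: Γ) b B)) (ha : Deriv (.typ Γ a A)) :
    Deriv (.typ Γ (b.inst a) (B.inst a)) :=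
  ht.subst_typ ha.wf ((IsSubst.var ha.wf).cons (by rwa [subst_var]))

theorem inst_eq (ht : Deriv (.eq (A :: Γ) b b' B)) (ha : Deriv (.typ Γ a A)) :
    Deriv (.eq Γ (b.inst a) (b'.inst a) (B.inst a)) :=
  ht.subst_eq ha.wf ((IsSubst.var ha.wf).cons (by rwa [subst_var]))

theorem inst_congr (ht : Deriv (.typ (A :: Γ) b B)) (ha : Deriv (.typ Γ a A))
    (hae : Deriv (.eq Γ a a' A)) : Deriv (.eq Γ (b.inst a) (b.inst a') (B.inst a)) :=
  ht.functional (τ := scons a' Tm.var)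
    ((EqSubst.refl ha.wf (.var ha.wf)).cons (by rwa [subst_var]) (by rwa [subst_var]))

theorem isSubst2 (ha : Deriv (.typ Γ a A)) (hb : Deriv (.typ Γ b (B.inst a))) :
    IsSubst Γ (scons b (scons a Tm.var)) (B :: A :: Γ) :=
  ((IsSubst.var ha.wf).cons (by rwa [subst_var])).cons hb

theorem inst2 (ht : Deriv (.typ (B :: A :: Γ) c T)) (ha : Deriv (.typ Γ a A))
    (hb : Deriv (.typ Γ b (B.inst a))) : Deriv (.typ Γ (c.inst2 a b) (T.inst2 a b)) :=
  ht.subst_typ ha.wf (isSubst2 ha hb)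

theorem inst3_subst (ha : Deriv (.typ Γ a A))
    (ha' : Deriv (.eq Γ a a' A)) (hb : Deriv (.typ Γ b A)) (hb' : Deriv (.eq Γ b b' A))
    (hp : Deriv (.typ Γ p (id A a b))) (hp' : Deriv (.eq Γ p p' (id A a b))) :
    EqSubst Γ (scons p (scons b (scons a Tm.var))) (scons p' (scons b' (scons a' Tm.var)))
      (id A.wk.wk (.var 1) (.var 0) :: A.wk :: A :: Γ) := by
  refine (((EqSubst.refl ha.wf (.var ha.wf)).cons ?_ ?_).cons ?_ ?_).cons ?_ ?_ <;>
    simp only [Tm.subst, subst_wk_scons, subst_var, scons] <;> assumption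

end Deriv

/-! ### Change of context -/

/-- Each variable of `Γ` also has the type given by `Γ` over `Δ`. -/
def CtxLe (Δ Γ : Ctx) : Prop := IsSubst Δ Tm.var Γ

theorem CtxLe.refl {Γ : Ctx} (h : Deriv (.ctx Γ)) : CtxLe Γ Γ := IsSubst.var h

theorem CtxLe.cons {Δ Γ : Ctx} {A A' : Tm} {i j : ℕ} (h : CtxLe Δ Γ)
    (hA' : Deriv (.typ Δ A' (univ j))) (he : Deriv (.eq Δ A A' (univ i))) :
    CtxLe (A' :: Δ) (A :: Γ) := by
  intro k B hk
  rw [subst_var]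
  cases k with
  | zero =>
    simp only [List.getElem?_cons_zero, Option.some.injEq] at hk
    subst hk
    exact .conv (.var_zero (.ctx_cons hA'.wf hA')) (.eq_symm (he.weaken_eq hA'))
  | succ k =>
    rw [rename_add_succ]
    have := h k B (by simpa using hk)
    rw [subst_var] at this
    exact this.weaken hA'

theorem CtxLe.typ {Δ Γ : Ctx} {a A : Tm} (h : CtxLe Δ Γ) (hΔ : Deriv (.ctx Δ))
    (ha : Deriv (.typ Γ a A)) : Deriv (.typ Δ a A) := by
  have := ha.subst_typ hΔ h
  rwa [subst_var, subst_var] at this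

theorem CtxLe.eq {Δ Γ : Ctx} {a b A : Tm} (h : CtxLe Δ Γ) (hΔ : Deriv (.ctx Δ))
    (ha : Deriv (.eq Γ a b A)) : Deriv (.eq Δ a b A) := by
  have := ha.subst_eq hΔ h
  rwa [subst_var, subst_var, subst_var] at this

/-! ### Universe levels -/

namespace Deriv

theorem cumul_le {Γ : Ctx} {A : Tm} {i j : ℕ} (hij : i ≤ j) (h : Deriv (.typ Γ A (univ i))) :
    Deriv (.typ Γ A (univ j)) := by
  induction hij with
  | refl => exact h
  | step _ ih => exact univ_cumul ih

theorem cumul_eq_le {Γ : Ctx} {A B : Tm} {i j : ℕ} (hij : i ≤ j)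
    (h : Deriv (.eq Γ A B (univ i))) : Deriv (.eq Γ A B (univ j)) := by
  induction hij with
  | refl => exact h
  | step _ ih => exact univ_cumul_eq ih

/-! ### Generation -/

/-- After the formation rule, a derivation of this typing can only apply conversion and
cumulativity, and these keep the subject. Unlike injectivity of `pi` up to judgmental equality, this
needs nothing about normal forms. -/
theorem pi_gen {Γ : Ctx} {A B T : Tm} (h : Deriv (.typ Γ (pi A B) T)) :
    ∃ i, Deriv (.typ Γ A (univ i)) ∧ Deriv (.typ (A :: Γ) B (univ i)) := by
  generalize hJ : Judgment.typ Γ (pi A B) T = J at h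
  induction h generalizing T <;> cases hJ
  case conv _ ih => exact ih rfl
  case univ_cumul ih => exact ih rfl
  case pi_form h₁ _ h₂ _ => exact ⟨_, h₁, h₂⟩

theorem sig_gen {Γ : Ctx} {A B T : Tm} (h : Deriv (.typ Γ (sig A B) T)) :
    ∃ i, Deriv (.typ Γ A (univ i)) ∧ Deriv (.typ (A :: Γ) B (univ i)) := by
  generalize hJ : Judgment.typ Γ (sig A B) T = J at h
  induction h generalizing T <;> cases hJ
  case conv _ ih => exact ih rfl
  case univ_cumul ih => exact ih rfl
  case sig_form h₁ _ h₂ _ => exact ⟨_, h₁, h₂⟩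

theorem sum_gen {Γ : Ctx} {A B T : Tm} (h : Deriv (.typ Γ (sum A B) T)) :
    ∃ i, Deriv (.typ Γ A (univ i)) ∧ Deriv (.typ Γ B (univ i)) := by
  generalize hJ : Judgment.typ Γ (sum A B) T = J at h
  induction h generalizing T <;> cases hJ
  case conv _ ih => exact ih rfl
  case univ_cumul ih => exact ih rfl
  case sum_form h₁ _ h₂ _ => exact ⟨_, h₁, h₂⟩

theorem id_gen {Γ : Ctx} {A a b T : Tm} (h : Deriv (.typ Γ (id A a b) T)) :
    ∃ i, Deriv (.typ Γ A (univ i)) ∧ Deriv (.typ Γ a A) ∧ Deriv (.typ Γ b A) := by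
  generalize hJ : Judgment.typ Γ (id A a b) T = J at h
  induction h generalizing T <;> cases hJ
  case conv _ ih => exact ih rfl
  case univ_cumul ih => exact ih rfl
  case id_form h₁ _ h₂ _ h₃ _ => exact ⟨_, h₁, h₂, h₃⟩

end Deriv
end MLTT

namespace MLTT
open Tm

/-! ### The statement of univalence is a type -/

namespace Tm

theorem wk_arrow (A B : Tm) : (arrow A B).wk = arrow A.wk B.wk := by
  simp only [wk_eq_subst, subst_arrow]

theorem wk_equiv (A B : Tm) : (equiv A B).wk = equiv A.wk B.wk := by
  simp only [wk_eq_subst, subst_equiv]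

theorem instUnder2_inst2 (C t a b : Tm) :
    (C.instUnder2 t).inst2 a b = C.inst (t.inst2 a b) := by
  simp only [instUnder2, inst2, inst, subst_subst]
  refine subst_congr _ fun k => ?_
  cases k <;> rfl

theorem instUnder1_inst (C t a : Tm) :
    (C.subst (scons t (fun k => var (k + 1)))).inst a = C.inst (t.inst a) := by
  simp only [inst, subst_subst]
  refine subst_congr _ fun k => ?_
  cases k <;> rfl

theorem instDiag_inst (C a : Tm) :
    (C.subst (scons (refl (var 0)) (scons (var 0) (scons (var 0) (fun k => var (k + 1)))))).inst a =
      C.inst3 a a (refl a) := by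
  simp only [inst, inst3, subst_subst]
  refine subst_congr _ fun k => ?_
  rcases k with _ | _ | _ | k <;> rfl

end Tm

namespace Deriv
variable {Γ : Ctx} {A A' B B' C T a a' b b' c f p p' t : Tm} {i j : ℕ}

theorem arrow_form (hA : Deriv (.typ Γ A (univ i))) (hB : Deriv (.typ Γ B (univ i))) :
    Deriv (.typ Γ (arrow A B) (univ i)) :=
  pi_form hA (hB.weaken hA)

theorem prod_form (hA : Deriv (.typ Γ A (univ i))) (hB : Deriv (.typ Γ B (univ i))) :
    Deriv (.typ Γ (prod A B) (univ i)) :=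
  sig_form hA (hB.weaken hA)

theorem arrow_elim (hf : Deriv (.typ Γ f (arrow A B))) (ha : Deriv (.typ Γ a A)) :
    Deriv (.typ Γ (app f a) B) := by
  have := pi_elim hf ha
  rwa [inst_wk] at this

theorem isEquiv_form (hA : Deriv (.typ Γ A (univ i))) (hB : Deriv (.typ Γ B (univ i)))
    (hf : Deriv (.typ Γ f (arrow A B))) : Deriv (.typ Γ (isEquiv A B f) (univ i)) := by
  have hBA := arrow_form hB hA
  have hA₁ := hA.weaken hBA
  have hB₁ := hB.weaken hBA
  have hf₁ := hf.weaken hBA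
  refine prod_form (sig_form hBA (pi_form hB₁ (id_form (hB₁.weaken hB₁) ?_ ?_)))
    (sig_form hBA (pi_form hA₁ (id_form (hA₁.weaken hA₁) ?_ ?_)))
  · have hf₂ := hf₁.weaken hB₁
    have hg := var_one (hB₁.weaken hB₁).wf
    rw [wk_arrow, wk_arrow] at hf₂ hg
    exact arrow_elim hf₂ (arrow_elim hg (var_zero hf₂.wf))
  · exact var_zero (hB₁.weaken hB₁).wf
  · have hf₂ := hf₁.weaken hA₁
    have hg := var_one (hA₁.weaken hA₁).wf
    rw [wk_arrow, wk_arrow] at hf₂ hg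
    exact arrow_elim hg (arrow_elim hf₂ (var_zero hf₂.wf))
  · exact var_zero (hA₁.weaken hA₁).wf

theorem equiv_form (hA : Deriv (.typ Γ A (univ i))) (hB : Deriv (.typ Γ B (univ i))) :
    Deriv (.typ Γ (equiv A B) (univ i)) := by
  have hAB := arrow_form hA hB
  refine sig_form hAB (isEquiv_form (hA.weaken hAB) (hB.weaken hAB) ?_)
  rw [← wk_arrow]
  exact var_zero (.ctx_cons hA.wf hAB)

theorem idFun_intro (hA : Deriv (.typ Γ A (univ i))) : Deriv (.typ Γ (idFun A) (arrow A A)) :=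
  pi_intro hA (var_zero (.ctx_cons hA.wf hA))

theorem idFun_comp (hA : Deriv (.typ Γ A (univ i))) (ha : Deriv (.typ Γ a A)) :
    Deriv (.eq Γ (app (idFun A) a) a A) := by
  have := pi_comp hA (var_zero (.ctx_cons hA.wf hA)) ha
  rwa [inst_wk] at this

theorem refl_of_eq (hA : Deriv (.typ Γ A (univ i))) (hb : Deriv (.typ Γ b A))
    (h : Deriv (.eq Γ a b A)) : Deriv (.typ Γ (refl b) (id A a b)) :=
  conv (id_intro hA hb) (id_form_eq (.eq_refl hA) (eq_symm h) (eq_refl hb))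

/-- The term `t` stands for either composite in `isEquiv`, of the function with its right or left
inverse. Both reduce to the variable once the inverse is the identity. -/
theorem idHalf_intro {t : Tm} (hA : Deriv (.typ Γ A (univ i)))
    (hP : Deriv (.typ Γ (sig (arrow A A) (pi A.wk (id A.wk.wk t (Tm.var 0)))) T))
    (ht : Deriv (.eq (A :: Γ) (t.subst (up (scons (idFun A) Tm.var))) (Tm.var 0) A.wk)) :
    Deriv (.typ Γ (pair (idFun A) (lam A (refl (Tm.var 0))))
      (sig (arrow A A) (pi A.wk (id A.wk.wk t (Tm.var 0))))) := by
  obtain ⟨j, h₁, h₂⟩ := sig_gen hP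
  refine sig_intro h₁ h₂ (idFun_intro hA) ?_
  simp only [Tm.inst, Tm.subst, subst_wk, subst_wk_scons, subst_var, up_zero]
  exact pi_intro hA (refl_of_eq (hA.weaken hA) (var_zero (.ctx_cons hA.wf hA)) ht)

theorem idEquiv_intro (hA : Deriv (.typ Γ A (univ i))) :
    Deriv (.typ Γ (idEquiv A) (equiv A A)) := by
  have hI := idFun_intro hA
  have h0 := var_zero (.ctx_cons hA.wf hA)
  have hA' : Deriv (.typ (A :: Γ) A.wk (univ i)) := hA.weaken hA
  have hb : Deriv (.eq (A :: Γ) (app (idFun A.wk) (app (idFun A.wk) (Tm.var 0))) (Tm.var 0) A.wk) :=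
    eq_trans (idFun_comp hA' (arrow_elim (idFun_intro hA') h0)) (idFun_comp hA' h0)
  obtain ⟨_, h₁, h₂⟩ := sig_gen (equiv_form hA hA)
  refine sig_intro h₁ h₂ hI ?_
  rw [Tm.inst, subst_isEquiv, subst_wk_scons, subst_var]
  obtain ⟨j, hP, hQ⟩ := sig_gen (isEquiv_form hA hA hI)
  refine sig_intro hP hQ (idHalf_intro hA hP ?_) ?_
  · simp only [Tm.subst, subst_wk, subst_wk_scons, subst_var, up_zero]; exact hb
  · have hQ' := hQ.inst (idHalf_intro hA hP
      (by simp only [Tm.subst, subst_wk, subst_wk_scons, subst_var, up_zero]; exact hb))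
    rw [inst_wk] at hQ' ⊢
    refine idHalf_intro hA hQ' ?_
    simp only [Tm.subst, subst_wk, subst_wk_scons, subst_var, up_zero]; exact hb

theorem idToEquiv_intro (hA : Deriv (.typ Γ A (univ i))) (hB : Deriv (.typ Γ B (univ i))) :
    Deriv (.typ Γ (idToEquiv i A B) (arrow (id (univ i) A B) (equiv A B))) := by
  have hU := univ_intro (i := i) hA.wf
  have hI := id_form hU hA hB
  have hΓ := Deriv.ctx_cons hI.wf hI
  have hU' := univ_intro (i := i) hΓ
  have hC := hU'.idCtx.2
  have hΔ := Deriv.ctx_cons hC.wf hC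
  refine pi_intro hI ?_
  rw [wk_equiv]
  have := id_elim (C := equiv (Tm.var 2) (Tm.var 1)) (c := idEquiv (Tm.var 0)) (p := Tm.var 0) hU'
    (equiv_form (.var (k := 2) (A := univ i) hΔ rfl) (.var (k := 1) (A := univ i) hΔ rfl)) ?_
    (hA.weaken hI) (hB.weaken hI) (var_zero hΓ)
  · rwa [Tm.inst3, subst_equiv] at this
  · rw [subst_equiv]
    exact idEquiv_intro (.var (k := 0) (A := univ i) (.ctx_cons hU'.wf hU') rfl)

theorem univalence_form (hA : Deriv (.typ Γ A (univ i))) (hB : Deriv (.typ Γ B (univ i))) :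
    Deriv (.typ Γ (isEquiv (id (univ i) A B) (equiv A B) (idToEquiv i A B)) (univ (i + 1))) :=
  isEquiv_form (id_form (univ_intro hA.wf) hA hB) (univ_cumul (equiv_form hA hB))
    (idToEquiv_intro hA hB)

/-- Rather than passing through `isEquiv` by congruence rules, the statement is read as a family
over two variables of `univ i`, to which functionality applies. -/
theorem univalence_form_eq (hA : Deriv (.typ Γ A (univ i))) (hB : Deriv (.typ Γ B (univ i)))
    (hAe : Deriv (.eq Γ A A' (univ i))) (hBe : Deriv (.eq Γ B B' (univ i))) :
    Deriv (.eq Γ (isEquiv (id (univ i) A B) (equiv A B) (idToEquiv i A B))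
      (isEquiv (id (univ i) A' B') (equiv A' B') (idToEquiv i A' B')) (univ (i + 1))) := by
  have hU := univ_intro (i := i) hA.wf
  have hU' := univ_intro (i := i) (.ctx_cons hA.wf hU)
  have hΔ := Deriv.ctx_cons hU'.wf hU'
  have h := univalence_form (i := i) (.var (k := 1) (A := univ i) hΔ rfl)
    (.var (k := 0) (A := univ i) hΔ rfl)
  have := h.functional (((EqSubst.refl hA.wf (.var hA.wf)).cons hA hAe).cons hB hBe)
  simpa only [subst_isEquiv, Tm.subst, subst_equiv, subst_idToEquiv, scons] using this

/-! ### Presuppositions -/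

theorem lookup_form {k : ℕ} (h : Deriv (.ctx Γ)) (hk : Γ[k]? = some A) :
    ∃ i, Deriv (.typ Γ (A.rename (fun j => j + (k + 1))) (univ i)) := by
  induction Γ generalizing k with
  | nil => simp at hk
  | cons B Γ ih =>
    cases h with
    | ctx_cons h₁ h₂ =>
    cases k with
    | zero =>
      simp only [List.getElem?_cons_zero, Option.some.injEq] at hk
      subst hk
      exact ⟨_, h₂.weaken h₂⟩
    | succ k =>
      obtain ⟨j, hj⟩ := ih h₁ (by simpa using hk)
      rw [rename_add_succ]
      exact ⟨j, hj.weaken h₂⟩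

theorem isSubst_under (hA : Deriv (.typ Γ A (univ i))) (ht : Deriv (.typ (A :: Γ) t B.wk)) :
    IsSubst (A :: Γ) (scons t (fun k => Tm.var (k + 1))) (B :: Γ) :=
  ((IsSubst.var hA.wf).wk hA).cons (by rwa [wk_eq_subst] at ht)

theorem inst_eq_congr (hC : Deriv (.eq (A :: Γ) b b' B)) (hb' : Deriv (.typ (A :: Γ) b' B))
    (ha : Deriv (.typ Γ a A)) (hae : Deriv (.eq Γ a a' A)) :
    Deriv (.eq Γ (b.inst a) (b'.inst a') (B.inst a)) :=
  eq_trans (inst_eq hC ha) (inst_congr hb' ha hae)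

theorem isSubst_pair (hA : Deriv (.typ Γ A (univ i))) (hB : Deriv (.typ (A :: Γ) B (univ i))) :
    IsSubst (B :: A :: Γ) (scons (pair (Tm.var 1) (Tm.var 0)) (fun k => Tm.var (k + 2)))
      (sig A B :: Γ) := by
  have hw := ((IsSubst.var hA.wf).wk hA).wk hB
  refine hw.cons ?_
  have hΔ := Deriv.ctx_cons hB.wf hB
  have hA₂ := hA.subst_typ hΔ hw
  have hB₂ := hB.subst_typ (.ctx_cons hΔ hA₂) (hw.up hA₂)
  refine sig_intro hA₂ hB₂ ?_ ?_
  · have e : A.wk.wk = A.subst (fun k => Tm.var (k + 2)) := by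
      simp only [wk_eq_subst, subst_subst]; rfl
    exact e ▸ var_one hΔ
  · have e : B.wk = (B.subst (up (fun k => Tm.var (k + 2)))).inst (Tm.var 1) := by
      rw [wk_eq_subst, Tm.inst, subst_subst]
      refine subst_congr _ fun k => ?_
      cases k <;> rfl
    exact e ▸ var_zero hΔ

theorem isSubst_diag (hA : Deriv (.typ Γ A (univ i))) :
    IsSubst (A :: Γ) (scons (refl (Tm.var 0)) (scons (Tm.var 0) (scons (Tm.var 0)
      (fun k => Tm.var (k + 1))))) (id A.wk.wk (Tm.var 1) (Tm.var 0) :: A.wk :: A :: Γ) := by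
  have h0 := var_zero (.ctx_cons hA.wf hA)
  rw [wk_eq_subst] at h0
  have hw : IsSubst (A :: Γ) (fun k => Tm.var (k + 1)) Γ := (IsSubst.var hA.wf).wk hA
  refine ((hw.cons h0).cons (by rwa [subst_wk_scons])).cons ?_
  simp only [Tm.subst, subst_wk_scons, scons]
  have := hA.weaken hA
  rw [wk_eq_subst] at this
  exact id_intro this h0

end Deriv
end MLTT

namespace MLTT
open Tm

/-- The presuppositions of a judgment. -/
def Judgment.WellTyped : Judgment → Prop
  | .ctx _ => True
  | .typ Γ _ A => ∃ i, Deriv (.typ Γ A (univ i))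
  | .eq Γ a b A => Deriv (.typ Γ a A) ∧ Deriv (.typ Γ b A) ∧ ∃ i, Deriv (.typ Γ A (univ i))

namespace Deriv
variable {Γ : Ctx} {A A' B B' C C' T a a' b b' c f p p' t : Tm} {i j : ℕ}

theorem change_typ (hA' : Deriv (.typ Γ A' (univ j))) (he : Deriv (.eq Γ A A' (univ i)))
    (h : Deriv (.typ (A :: Γ) t T)) : Deriv (.typ (A' :: Γ) t T) :=
  ((CtxLe.refl hA'.wf).cons hA' he).typ (.ctx_cons hA'.wf hA') h

theorem change_eq (hA' : Deriv (.typ Γ A' (univ j))) (he : Deriv (.eq Γ A A' (univ i)))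
    (h : Deriv (.eq (A :: Γ) a b T)) : Deriv (.eq (A' :: Γ) a b T) :=
  ((CtxLe.refl hA'.wf).cons hA' he).eq (.ctx_cons hA'.wf hA') h

theorem pi_form_max (hA : Deriv (.typ Γ A (univ i))) (hB : Deriv (.typ (A :: Γ) B (univ j))) :
    Deriv (.typ Γ (pi A B) (univ (max i j))) :=
  pi_form (cumul_le (le_max_left _ _) hA) (cumul_le (le_max_right _ _) hB)

theorem app_wk_var (hf : Deriv (.typ Γ f (pi A B))) (hA : Deriv (.typ Γ A (univ i))) :
    Deriv (.typ (A :: Γ) (app f.wk (Tm.var 0)) B) := by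
  have := pi_elim (A := A.wk) (B := B.rename (upRen Nat.succ)) (hf.weaken hA)
    (var_zero (.ctx_cons hA.wf hA))
  convert this using 2
  rw [Tm.inst, subst_rename]
  conv_lhs => rw [← subst_var B]
  refine subst_congr _ fun k => ?_
  cases k <;> rfl

/-- The work is in the congruence rules for eliminators. The right-hand side is typed by the
elimination rule for the primed data, after the premises have been moved to the primed contexts; its
type is then converted back, since the motives and the arguments are equal. -/
theorem wellTyped {J : Judgment} (h : Deriv J) : J.WellTyped := by
  induction h with
  | ctx_nil => trivial
  | ctx_cons => trivial
  | var h₁ h₂ => exact lookup_form h₁ h₂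
  | eq_refl h ih => exact ⟨h, h, ih⟩
  | eq_symm h ih => exact ⟨ih.2.1, ih.1, ih.2.2⟩
  | eq_trans _ _ ih₁ ih₂ => exact ⟨ih₁.1, ih₂.2.1, ih₁.2.2⟩
  | conv _ _ _ ih => exact ⟨_, ih.2.1⟩
  | eq_conv _ h ih₁ ih₂ => exact ⟨conv ih₁.1 h, conv ih₁.2.1 h, _, ih₂.2.1⟩
  | univ_intro h => exact ⟨_, univ_intro h⟩
  | univ_cumul h => exact ⟨_, univ_intro h.wf⟩
  | univ_cumul_eq h ih => exact ⟨univ_cumul ih.1, univ_cumul ih.2.1, _, univ_intro h.wf_eq⟩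
  | pi_form h => exact ⟨_, univ_intro h.wf⟩
  | pi_intro hA _ _ ih => obtain ⟨j, hj⟩ := ih; exact ⟨_, pi_form_max hA hj⟩
  | pi_elim _ ha ihf _ =>
    obtain ⟨_, hP⟩ := ihf
    obtain ⟨_, _, hB⟩ := pi_gen hP
    exact ⟨_, hB.inst ha⟩
  | pi_comp hA hb ha _ ihb _ =>
    obtain ⟨_, hB⟩ := ihb
    exact ⟨pi_elim (pi_intro hA hb) ha, hb.inst ha, _, hB.inst ha⟩
  | pi_uniq hf ih =>
    obtain ⟨j, hP⟩ := ih
    obtain ⟨_, hA, _⟩ := pi_gen hP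
    exact ⟨hf, pi_intro hA (app_wk_var hf hA), j, hP⟩
  | pi_form_eq hA he _ _ ihA ihB =>
    exact ⟨pi_form hA ihB.1, pi_form ihA.2.1 (change_typ ihA.2.1 he ihB.2.1), _,
      univ_intro hA.wf⟩
  | pi_intro_eq hA he hb _ ihA ihb =>
    obtain ⟨hb₁, hb₂, j, hB⟩ := ihb
    have hP := pi_form_max hA hB
    refine ⟨pi_intro hA hb₁, conv (pi_intro ihA.2.1 (change_typ ihA.2.1 he hb₂))
      (eq_symm (pi_form_eq (cumul_le (le_max_left _ _) hA) (cumul_eq_le (le_max_left _ _) he)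
        (eq_refl (cumul_le (le_max_right _ _) hB)))), _, hP⟩
  | pi_elim_eq hf ha ihf iha =>
    obtain ⟨hf₁, hf₂, _, hP⟩ := ihf
    obtain ⟨_, _, hB⟩ := pi_gen hP
    exact ⟨pi_elim hf₁ iha.1, conv (pi_elim hf₂ iha.2.1) (eq_symm (inst_congr hB iha.1 ha)), _,
      hB.inst iha.1⟩
  | sig_form h => exact ⟨_, univ_intro h.wf⟩
  | sig_intro hA hB => exact ⟨_, sig_form hA hB⟩
  | sig_elim _ _ hC _ hp => exact ⟨_, hC.inst hp⟩
  | sig_comp hA hB hC hg ha hb =>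
    have hp := sig_intro hA hB ha hb
    have hr := inst2 hg ha hb
    rw [instUnder2_inst2] at hr
    exact ⟨sig_elim hA hB hC hg hp, hr, _, hC.inst hp⟩
  | sig_form_eq hA he _ _ ihA ihB =>
    exact ⟨sig_form hA ihB.1, sig_form ihA.2.1 (change_typ ihA.2.1 he ihB.2.1), _,
      univ_intro hA.wf⟩
  | sig_intro_eq hA hB ha _ _ _ iha ihb =>
    exact ⟨sig_intro hA hB iha.1 ihb.1,
      sig_intro hA hB iha.2.1 (conv ihb.2.1 (inst_congr hB iha.1 ha)), _, sig_form hA hB⟩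
  | sig_elim_eq hA hB heA heB heC _ hp _ _ ihA ihB ihC ihg ihp =>
    have hS := sig_form hA hB
    have hA' := ihA.2.1
    have hB' := change_typ hA' heA ihB.2.1
    have hSe := sig_form_eq hA heA heB
    have hS' := sig_form hA' hB'
    -- The branch is first retyped with the motive `C'` over the old context; only then is the
    -- context changed.
    have hg' := conv ihg.2.1 (heC.subst_eq (.ctx_cons hB.wf hB) (isSubst_pair hA hB))
    have hle := (((CtxLe.refl hA.wf).cons hA' heA).cons hB'
      (change_eq hA' heA heB))
    exact ⟨sig_elim hA hB ihC.1 ihg.1 ihp.1,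
      conv (sig_elim hA' hB' (change_typ hS' hSe ihC.2.1) (hle.typ (.ctx_cons hB'.wf hB') hg')
        (conv ihp.2.1 hSe)) (eq_symm (inst_eq_congr heC ihC.2.1 ihp.1 hp)), _, ihC.1.inst ihp.1⟩
  | sum_form h => exact ⟨_, univ_intro h.wf⟩
  | sum_inl hA hB => exact ⟨_, sum_form hA hB⟩
  | sum_inr hA hB => exact ⟨_, sum_form hA hB⟩
  | sum_elim _ _ hC _ _ he => exact ⟨_, hC.inst he⟩
  | sum_comp_inl hA hB hC hc hd ha =>
    have he := sum_inl hA hB ha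
    have hr := hc.inst ha
    rw [instUnder1_inst] at hr
    exact ⟨sum_elim hA hB hC hc hd he, hr, _, hC.inst he⟩
  | sum_comp_inr hA hB hC hc hd hb =>
    have he := sum_inr hA hB hb
    have hr := hd.inst hb
    rw [instUnder1_inst] at hr
    exact ⟨sum_elim hA hB hC hc hd he, hr, _, hC.inst he⟩
  | sum_form_eq hA _ ihA ihB =>
    exact ⟨sum_form ihA.1 ihB.1, sum_form ihA.2.1 ihB.2.1, _, univ_intro hA.wf_eq⟩
  | sum_inl_eq hA hB _ _ _ ih =>
    exact ⟨sum_inl hA hB ih.1, sum_inl hA hB ih.2.1, _, sum_form hA hB⟩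
  | sum_inr_eq hA hB _ _ _ ih =>
    exact ⟨sum_inr hA hB ih.1, sum_inr hA hB ih.2.1, _, sum_form hA hB⟩
  | sum_elim_eq hA hB heA heB heC _ _ he _ _ ihA ihB ihC ihc ihd ihe =>
    have hSe := sum_form_eq heA heB
    have hA' := ihA.2.1
    have hB' := ihB.2.1
    have hl := sum_inl (hA.weaken hA) (hB.weaken hA) (var_zero (.ctx_cons hA.wf hA))
    have hr := sum_inr (hA.weaken hB) (hB.weaken hB) (var_zero (.ctx_cons hB.wf hB))
    have hc' := conv ihc.2.1 (heC.subst_eq (.ctx_cons hA.wf hA)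
      (isSubst_under (B := sum _ _) hA hl))
    have hd' := conv ihd.2.1 (heC.subst_eq (.ctx_cons hB.wf hB)
      (isSubst_under (B := sum _ _) hB hr))
    exact ⟨sum_elim hA hB ihC.1 ihc.1 ihd.1 ihe.1,
      conv (sum_elim hA' hB' (change_typ (sum_form hA' hB') hSe ihC.2.1) (change_typ hA' heA hc')
        (change_typ hB' heB hd') (conv ihe.2.1 hSe))
        (eq_symm (inst_eq_congr heC ihC.2.1 ihe.1 he)), _, ihC.1.inst ihe.1⟩
  | empty_form h => exact ⟨_, univ_intro h⟩
  | empty_elim hC ha => exact ⟨_, hC.inst ha⟩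
  | empty_elim_eq hC ha ihC iha =>
    exact ⟨empty_elim ihC.1 iha.1, conv (empty_elim ihC.2.1 iha.2.1)
      (eq_symm (inst_eq_congr hC ihC.2.1 iha.1 ha)), _, ihC.1.inst iha.1⟩
  | unit_form h => exact ⟨_, univ_intro h⟩
  | unit_intro h => exact ⟨0, unit_form h⟩
  | unit_elim hC _ ha => exact ⟨_, hC.inst ha⟩
  | unit_comp hC hc =>
    have hs := unit_intro hc.wf
    exact ⟨unit_elim hC hc hs, hc, _, hC.inst hs⟩
  | unit_elim_eq hC _ ha ihC ihc iha =>
    exact ⟨unit_elim ihC.1 ihc.1 iha.1,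
      conv (unit_elim ihC.2.1 (conv ihc.2.1 (inst_eq hC (unit_intro ha.wf_eq))) iha.2.1)
      (eq_symm (inst_eq_congr hC ihC.2.1 iha.1 ha)), _, ihC.1.inst iha.1⟩
  | nat_form h => exact ⟨_, univ_intro h⟩
  | nat_zero h => exact ⟨0, nat_form h⟩
  | nat_succ h => exact ⟨0, nat_form h.wf⟩
  | nat_elim hC _ _ hn => exact ⟨_, hC.inst hn⟩
  | nat_comp_zero hC hz hs =>
    have hn := nat_zero hz.wf
    exact ⟨nat_elim hC hz hs hn, hz, _, hC.inst hn⟩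
  | nat_comp_succ hC hz hs hn =>
    have hr := nat_elim hC hz hs hn
    have := inst2 hs hn hr
    rw [instUnder2_inst2] at this
    exact ⟨nat_elim hC hz hs (nat_succ hn), this, _, hC.inst (nat_succ hn)⟩
  | nat_succ_eq h ih => exact ⟨nat_succ ih.1, nat_succ ih.2.1, 0, nat_form h.wf_eq⟩
  | nat_elim_eq hC heC hz hs hn _ ihC ihz ihs ihn =>
    have hN := nat_form (i := 0) hz.wf_eq
    have h2 := (IsSubst.var hz.wf_eq).wk hN |>.wk hC
    have hsb := h2.cons (A := nat) (nat_succ (var_one (.ctx_cons hC.wf hC)))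
    have hs' := conv ihs.2.1 (heC.subst_eq (.ctx_cons hC.wf hC) hsb)
    exact ⟨nat_elim hC ihz.1 ihs.1 ihn.1,
      conv (nat_elim ihC.2.1 (conv ihz.2.1 (inst_eq heC (nat_zero hz.wf_eq)))
        (change_typ ihC.2.1 heC hs') ihn.2.1) (eq_symm (inst_eq_congr heC ihC.2.1 ihn.1 hn)), _,
      hC.inst ihn.1⟩
  | id_form h => exact ⟨_, univ_intro h.wf⟩
  | id_intro hA ha => exact ⟨_, id_form hA ha ha⟩
  | id_elim hA hC _ ha hb hp =>
    exact ⟨_, (inst3_subst ha (eq_refl ha) hb (eq_refl hb) hp (eq_refl hp)).typ hC⟩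
  | id_comp hA hC hc ha =>
    have hp := id_intro hA ha
    have hr := hc.inst ha
    rw [instDiag_inst] at hr
    exact ⟨id_elim hA hC hc ha ha hp, hr, _,
      (inst3_subst ha (eq_refl ha) ha (eq_refl ha) hp (eq_refl hp)).typ hC⟩
  | id_form_eq hA ha hb ihA iha ihb =>
    exact ⟨id_form ihA.1 iha.1 ihb.1, id_form ihA.2.1 (conv iha.2.1 hA) (conv ihb.2.1 hA), _,
      univ_intro hA.wf_eq⟩
  | id_intro_eq hA ha _ iha =>
    exact ⟨id_intro hA iha.1, conv (id_intro hA iha.2.1)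
      (id_form_eq (eq_refl hA) (eq_symm ha) (eq_symm ha)), _, id_form hA iha.1 iha.1⟩
  | id_elim_eq hA heA heC hc ha hb hp _ ihA ihC ihc iha ihb ihp =>
    have hA' := ihA.2.1
    have hs := inst3_subst iha.1 ha ihb.1 hb ihp.1 hp
    have hc' := conv ihc.2.1 (heC.subst_eq (.ctx_cons hA.wf hA) (isSubst_diag hA))
    have heA₁ := change_eq hA' heA (heA.weaken_eq hA)
    have hle₁ := ((CtxLe.refl hA.wf).cons hA' heA).cons hA'.idCtx.1 heA₁
    have hI := (hA.weaken hA).weaken (hA.weaken hA)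
    have hv := ctx_cons hA.idCtx.1.wf hA.idCtx.1
    have hle := hle₁.cons hA'.idCtx.2 (hle₁.eq hA'.idCtx.2.wf (id_form_eq
      ((heA.weaken_eq hA).weaken_eq hA.idCtx.1) (eq_refl (var_one hv)) (eq_refl (var_zero hv))))
    exact ⟨id_elim hA ihC.1 ihc.1 iha.1 ihb.1 ihp.1,
      conv (id_elim hA' (hle.typ (.ctx_cons hA'.idCtx.2.wf hA'.idCtx.2) ihC.2.1)
        (change_typ hA' heA hc') (conv iha.2.1 heA) (conv ihb.2.1 heA)
        (conv ihp.2.1 (id_form_eq heA ha hb)))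
        (eq_symm (eq_trans (hs.eq_left heC) (ihC.2.1.functional hs))), _, hs.typ ihC.1⟩
  | univalence hA hB => exact ⟨_, univalence_form hA hB⟩
  | univalence_eq hA hB ihA ihB =>
    exact ⟨univalence ihA.1 ihB.1, conv (univalence ihA.2.1 ihB.2.1)
      (eq_symm (univalence_form_eq ihA.1 ihB.1 hA hB)), _, univalence_form ihA.1 ihB.1⟩

theorem typ_left (h : Deriv (.eq Γ a b A)) : Deriv (.typ Γ a A) := h.wellTyped.1

theorem typ_right (h : Deriv (.eq Γ a b A)) : Deriv (.typ Γ b A) := h.wellTyped.2.1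

theorem type_form (h : Deriv (.typ Γ a A)) : ∃ i, Deriv (.typ Γ A (univ i)) := h.wellTyped

end Deriv

/-! ### Closed terms -/

theorem up_eq_var {σ : ℕ → Tm} {n : ℕ} (h : ∀ k < n, σ k = Tm.var k) :
    ∀ k < n + 1, up σ k = Tm.var k := by
  rintro (_ | k) hk
  · rfl
  · simp [up, scons, h k (by omega), wk, rename]

/-- The subject of a judgment has no variables other than those of the context. -/
def Judgment.Scoped : Judgment → Prop
  | .typ Γ a _ => ∀ σ : ℕ → Tm, (∀ k < Γ.length, σ k = Tm.var k) → a.subst σ = a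
  | _ => True

theorem Deriv.scoped {J : Judgment} (h : Deriv J) : J.Scoped := by
  induction h with
  | var _ h₂ =>
    intro σ h
    exact h _ (by by_contra hk; rw [List.getElem?_eq_none (by omega)] at h₂; cases h₂)
  | conv _ _ ih _ => exact ih
  | univ_cumul _ ih => exact ih
  | univ_intro => intro σ _; rfl
  | ctx_nil => trivial
  | ctx_cons => trivial
  | _ =>
    first
    | trivial
    | (intro σ h
       have h₁ := up_eq_var h
       have h₂ := up_eq_var h₁
       have h₃ := up_eq_var h₂
       simp_all [Tm.subst, Judgment.Scoped])

theorem Deriv.closed {a A : Tm} (h : Deriv (.typ [] a A)) (σ : ℕ → Tm) : a.subst σ = a :=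
  h.scoped σ (by simp)

theorem Deriv.of_closed {a A : Tm} (h : Deriv (.typ [] a A)) {Γ : Ctx} (hΓ : Deriv (.ctx Γ)) :
    Deriv (.typ Γ a A) := by
  have := h.subst_typ (σ := Tm.var) hΓ (fun k A hk => by simp at hk)
  rwa [subst_var, subst_var] at this

/-- Lemmas may be used as variables. -/
theorem inhab_of_lemmas {Δ : Ctx} (hΔ : ∀ A ∈ Δ, Inhab A) {t T : Tm} {i : ℕ}
    (hT : Deriv (.typ [] T (univ i))) (ht : Deriv (.ctx Δ) → Deriv (.typ Δ t T)) : Inhab T := by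
  -- The entries of `Δ` are closed, so none depends on the others. Well-formedness of `Δ` and a
  -- substitution by the given inhabitants are built together.
  have key : ∀ Δ : Ctx, (∀ A ∈ Δ, Inhab A) → Deriv (.ctx Δ) ∧ ∃ σ, IsSubst [] σ Δ := by
    intro Δ
    induction Δ with
    | nil => exact fun _ => ⟨.ctx_nil, Tm.var, fun k A hk => by simp at hk⟩
    | cons A Δ ih =>
      intro h
      obtain ⟨h₁, σ, h₂⟩ := ih fun B hB => h B (List.mem_cons_of_mem _ hB)
      obtain ⟨a, ha⟩ := h A List.mem_cons_self
      obtain ⟨j, hA⟩ := Deriv.type_form ha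
      refine ⟨.ctx_cons h₁ (hA.of_closed h₁), scons a σ, h₂.cons ?_⟩
      rwa [hA.closed]
  obtain ⟨h₁, σ, h₂⟩ := key Δ hΔ
  have := (ht h₁).subst_typ .ctx_nil h₂
  rw [hT.closed] at this
  exact ⟨_, this⟩

end MLTT

namespace MLTT

/-! ### Universe polymorphism -/

namespace Tm

/-- Adds `n` to all universe levels. -/
def lift (n : ℕ) : Tm → Tm
  | var k => var k
  | univ i => univ (n + i)
  | pi A B => pi (lift n A) (lift n B)
  | lam A b => lam (lift n A) (lift n b)
  | app f a => app (lift n f) (lift n a)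
  | sig A B => sig (lift n A) (lift n B)
  | pair a b => pair (lift n a) (lift n b)
  | sigInd A B C g p => sigInd (lift n A) (lift n B) (lift n C) (lift n g) (lift n p)
  | sum A B => sum (lift n A) (lift n B)
  | inl a => inl (lift n a)
  | inr b => inr (lift n b)
  | sumInd A B C c d e =>
      sumInd (lift n A) (lift n B) (lift n C) (lift n c) (lift n d) (lift n e)
  | empty => empty
  | emptyInd C a => emptyInd (lift n C) (lift n a)
  | unit => unit
  | star => star
  | unitInd C c a => unitInd (lift n C) (lift n c) (lift n a)
  | nat => nat
  | zero => zero
  | succ a => succ (lift n a)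
  | natInd C z s a => natInd (lift n C) (lift n z) (lift n s) (lift n a)
  | id A a b => id (lift n A) (lift n a) (lift n b)
  | refl a => refl (lift n a)
  | idInd A C c a b p =>
      idInd (lift n A) (lift n C) (lift n c) (lift n a) (lift n b) (lift n p)
  | ua i A B => ua (n + i) (lift n A) (lift n B)

theorem lift_rename (n : ℕ) (t : Tm) :
    ∀ ξ : ℕ → ℕ, (t.rename ξ).lift n = (t.lift n).rename ξ := by
  induction t <;> intro ξ <;> simp_all [lift, rename]

theorem lift_wk (n : ℕ) (t : Tm) : t.wk.lift n = (t.lift n).wk := lift_rename n t _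

theorem lift_comp_scons (n : ℕ) (a : Tm) (σ : ℕ → Tm) :
    lift n ∘ scons a σ = scons (a.lift n) (lift n ∘ σ) := by
  funext k; cases k <;> rfl

theorem lift_comp_up (n : ℕ) (σ : ℕ → Tm) : lift n ∘ up σ = up (lift n ∘ σ) := by
  funext k
  cases k with
  | zero => rfl
  | succ k => exact lift_wk n _

theorem lift_subst (n : ℕ) (t : Tm) :
    ∀ σ : ℕ → Tm, (t.subst σ).lift n = (t.lift n).subst (lift n ∘ σ) := by
  induction t <;> intro σ <;> simp_all [lift, subst, lift_comp_up]

theorem lift_comp_var (n : ℕ) (f : ℕ → ℕ) : (lift n ∘ fun k => var (f k)) = fun k => var (f k) :=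
  rfl

theorem lift_inst (n : ℕ) (b a : Tm) : (b.inst a).lift n = (b.lift n).inst (a.lift n) := by
  rw [inst, lift_subst, lift_comp_scons]; rfl

theorem lift_inst2 (n : ℕ) (c a b : Tm) :
    (c.inst2 a b).lift n = (c.lift n).inst2 (a.lift n) (b.lift n) := by
  rw [inst2, lift_subst, lift_comp_scons, lift_comp_scons]; rfl

theorem lift_inst3 (n : ℕ) (c a b p : Tm) :
    (c.inst3 a b p).lift n = (c.lift n).inst3 (a.lift n) (b.lift n) (p.lift n) := by
  rw [inst3, lift_subst, lift_comp_scons, lift_comp_scons, lift_comp_scons]; rfl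

theorem lift_instUnder2 (n : ℕ) (C t : Tm) :
    (C.instUnder2 t).lift n = (C.lift n).instUnder2 (t.lift n) := by
  rw [instUnder2, lift_subst, lift_comp_scons]; rfl

theorem lift_isEquiv (n : ℕ) (A B f : Tm) :
    (isEquiv A B f).lift n = isEquiv (A.lift n) (B.lift n) (f.lift n) := by
  simp only [isEquiv, prod, arrow, lift, lift_wk]

theorem lift_equiv (n : ℕ) (A B : Tm) :
    (equiv A B).lift n = equiv (A.lift n) (B.lift n) := by
  simp only [equiv, arrow, lift, lift_wk, lift_isEquiv]

theorem lift_idToEquiv (n i : ℕ) (A B : Tm) :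
    (idToEquiv i A B).lift n = idToEquiv (n + i) (A.lift n) (B.lift n) := by
  simp only [idToEquiv, lift, lift_wk, lift_equiv]; rfl

end Tm

open Tm

/-- All universe levels in the judgment raised by `n`. -/
def Judgment.lift (n : ℕ) : Judgment → Judgment
  | .ctx Γ => .ctx (Γ.map (Tm.lift n))
  | .typ Γ a A => .typ (Γ.map (Tm.lift n)) (a.lift n) (A.lift n)
  | .eq Γ a b A => .eq (Γ.map (Tm.lift n)) (a.lift n) (b.lift n) (A.lift n)

/-- The rules involve universe levels only through `i` and `i + 1` for arbitrary `i`, so raising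
every level by the same amount maps instances of rules to instances. A statement uniform in the
level thus has to be checked at level `0` only. -/
theorem Deriv.lift (n : ℕ) {J : Judgment} (h : Deriv J) : Deriv (J.lift n) := by
  induction h <;>
    simp only [Judgment.lift, List.map, Tm.lift, lift_rename, lift_inst, lift_inst2, lift_inst3,
      lift_instUnder2, lift_subst, lift_comp_scons, lift_comp_var, lift_wk, lift_isEquiv,
      lift_equiv, lift_idToEquiv] at *
  case ctx_nil => exact .ctx_nil
  case ctx_cons h0 h1 => exact .ctx_cons h0 h1
  case var h₁ h₂ => exact .var h₂ (by simp [h₁])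
  case eq_refl h0 => exact .eq_refl h0
  case eq_symm h0 => exact .eq_symm h0
  case eq_trans h0 h1 => exact .eq_trans h0 h1
  case conv h0 h1 => exact .conv h0 h1
  case eq_conv h0 h1 => exact .eq_conv h0 h1
  case univ_intro h0 => exact .univ_intro h0
  case univ_cumul h0 => exact .univ_cumul h0
  case univ_cumul_eq h0 => exact .univ_cumul_eq h0
  case pi_form h0 h1 => exact .pi_form h0 h1
  case pi_intro h0 h1 => exact .pi_intro h0 h1
  case pi_elim h0 h1 => exact .pi_elim h0 h1
  case pi_comp h0 h1 h2 => exact .pi_comp h0 h1 h2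
  case pi_uniq h0 => exact .pi_uniq h0
  case pi_form_eq h0 h1 h2 => exact .pi_form_eq h0 h1 h2
  case pi_intro_eq h0 h1 h2 => exact .pi_intro_eq h0 h1 h2
  case pi_elim_eq h0 h1 => exact .pi_elim_eq h0 h1
  case sig_form h0 h1 => exact .sig_form h0 h1
  case sig_intro => exact .sig_intro (by assumption) (by assumption) (by assumption) (by assumption)
  case sig_elim => apply Deriv.sig_elim <;> assumption
  case sig_comp => apply Deriv.sig_comp <;> assumption
  case sig_form_eq h0 h1 h2 => exact .sig_form_eq h0 h1 h2
  case sig_intro_eq => exact .sig_intro_eq (by assumption) (by assumption) (by assumption) (by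
      assumption)
  case sig_elim_eq => apply Deriv.sig_elim_eq <;> assumption
  case sum_form h0 h1 => exact .sum_form h0 h1
  case sum_inl h0 h1 h2 => exact .sum_inl h0 h1 h2
  case sum_inr h0 h1 h2 => exact .sum_inr h0 h1 h2
  case sum_elim => apply Deriv.sum_elim <;> assumption
  case sum_comp_inl => apply Deriv.sum_comp_inl <;> assumption
  case sum_comp_inr => apply Deriv.sum_comp_inr <;> assumption
  case sum_form_eq h0 h1 => exact .sum_form_eq h0 h1
  case sum_inl_eq h0 h1 h2 => exact .sum_inl_eq h0 h1 h2
  case sum_inr_eq h0 h1 h2 => exact .sum_inr_eq h0 h1 h2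
  case sum_elim_eq => apply Deriv.sum_elim_eq <;> assumption
  case empty_form h0 => exact .empty_form h0
  case empty_elim h0 h1 => exact .empty_elim h0 h1
  case empty_elim_eq h0 h1 => exact .empty_elim_eq h0 h1
  case unit_form h0 => exact .unit_form h0
  case unit_intro h0 => exact .unit_intro h0
  case unit_elim => exact .unit_elim (by assumption) (by assumption) (by assumption)
  case unit_comp h0 h1 => exact .unit_comp h0 h1
  case unit_elim_eq => exact .unit_elim_eq (by assumption) (by assumption) (by assumption)
  case nat_form h0 => exact .nat_form h0
  case nat_zero h0 => exact .nat_zero h0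
  case nat_succ h0 => exact .nat_succ h0
  case nat_elim => exact .nat_elim (by assumption) (by assumption) (by assumption) (by assumption)
  case nat_comp_zero h0 h1 h2 => exact .nat_comp_zero h0 h1 h2
  case nat_comp_succ => exact .nat_comp_succ (by assumption) (by assumption) (by assumption) (by
      assumption)
  case nat_succ_eq h0 => exact .nat_succ_eq h0
  case nat_elim_eq => apply Deriv.nat_elim_eq <;> assumption
  case id_form h0 h1 h2 => exact .id_form h0 h1 h2
  case id_intro h0 h1 => exact .id_intro h0 h1
  case id_elim => apply Deriv.id_elim <;> assumption
  case id_comp => exact .id_comp (by assumption) (by assumption) (by assumption) (by assumption)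
  case id_form_eq h0 h1 h2 => exact .id_form_eq h0 h1 h2
  case id_intro_eq h0 h1 => exact .id_intro_eq h0 h1
  case id_elim_eq => apply Deriv.id_elim_eq <;> assumption
  case univalence h0 h1 => exact .univalence h0 h1
  case univalence_eq h0 h1 => exact .univalence_eq h0 h1

theorem Inhab.lift (n : ℕ) {A : Tm} : Inhab A → Inhab (A.lift n) :=
  fun ⟨_, h⟩ => ⟨_, Deriv.lift n h⟩

end MLTT

namespace MLTT
namespace Tm

noncomputable section

/-! ## Boolean equality -/
-- A separate test for each constructor lets `beq` recurse on its first argument and inspect the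
-- second one without matching on pairs of terms.
def onVar (t : Tm) (f : ℕ → Bool) : Bool := match t with | var k => f k | _ => false
def onUniv (t : Tm) (f : ℕ → Bool) : Bool := match t with | univ k => f k | _ => false
def onPi (t : Tm) (f : Tm → Tm → Bool) : Bool := match t with | pi a b => f a b | _ => false
def onLam (t : Tm) (f : Tm → Tm → Bool) : Bool := match t with | lam a b => f a b | _ => false
def onApp (t : Tm) (f : Tm → Tm → Bool) : Bool := match t with | app a b => f a b | _ => false
def onSig (t : Tm) (f : Tm → Tm → Bool) : Bool := match t with | sig a b => f a b | _ => false
def onPair (t : Tm) (f : Tm → Tm → Bool) : Bool := match t with | pair a b => f a b | _ => false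
def onSigInd (t : Tm) (f : Tm → Tm → Tm → Tm → Tm → Bool) : Bool :=
  match t with | sigInd a b c d e => f a b c d e | _ => false
def onSum (t : Tm) (f : Tm → Tm → Bool) : Bool := match t with | sum a b => f a b | _ => false
def onInl (t : Tm) (f : Tm → Bool) : Bool := match t with | inl a => f a | _ => false
def onInr (t : Tm) (f : Tm → Bool) : Bool := match t with | inr a => f a | _ => false
def onSumInd (t : Tm) (f : Tm → Tm → Tm → Tm → Tm → Tm → Bool) : Bool :=
  match t with | sumInd a b c d e g => f a b c d e g | _ => false
def onEmpty (t : Tm) : Bool := match t with | empty => true | _ => false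
def onEmptyInd (t : Tm) (f : Tm → Tm → Bool) : Bool :=
  match t with | emptyInd a b => f a b | _ => false
def onUnit (t : Tm) : Bool := match t with | unit => true | _ => false
def onStar (t : Tm) : Bool := match t with | star => true | _ => false
def onUnitInd (t : Tm) (f : Tm → Tm → Tm → Bool) : Bool :=
  match t with | unitInd a b c => f a b c | _ => false
def onNat (t : Tm) : Bool := match t with | nat => true | _ => false
def onZero (t : Tm) : Bool := match t with | zero => true | _ => false
def onSucc (t : Tm) (f : Tm → Bool) : Bool := match t with | succ a => f a | _ => false
def onNatInd (t : Tm) (f : Tm → Tm → Tm → Tm → Bool) : Bool :=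
  match t with | natInd a b c d => f a b c d | _ => false
def onId (t : Tm) (f : Tm → Tm → Tm → Bool) : Bool :=
  match t with | id a b c => f a b c | _ => false
def onRefl (t : Tm) (f : Tm → Bool) : Bool := match t with | refl a => f a | _ => false
def onIdInd (t : Tm) (f : Tm → Tm → Tm → Tm → Tm → Tm → Bool) : Bool :=
  match t with | idInd a b c d e g => f a b c d e g | _ => false
def onUa (t : Tm) (f : ℕ → Tm → Tm → Bool) : Bool :=
  match t with | ua i a b => f i a b | _ => false

/-- Syntactic equality. -/
def beq : Tm → Tm → Bool
  | var k, u => onVar u fun k' => Nat.beq k k'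
  | univ k, u => onUniv u fun k' => Nat.beq k k'
  | pi a b, u => onPi u fun a' b' => beq a a' && beq b b'
  | lam a b, u => onLam u fun a' b' => beq a a' && beq b b'
  | app a b, u => onApp u fun a' b' => beq a a' && beq b b'
  | sig a b, u => onSig u fun a' b' => beq a a' && beq b b'
  | pair a b, u => onPair u fun a' b' => beq a a' && beq b b'
  | sigInd a b c d e, u => onSigInd u fun a' b' c' d' e' =>
      beq a a' && beq b b' && beq c c' && beq d d' && beq e e'
  | sum a b, u => onSum u fun a' b' => beq a a' && beq b b'
  | inl a, u => onInl u fun a' => beq a a'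
  | inr a, u => onInr u fun a' => beq a a'
  | sumInd a b c d e g, u => onSumInd u fun a' b' c' d' e' g' =>
      beq a a' && beq b b' && beq c c' && beq d d' && beq e e' && beq g g'
  | empty, u => onEmpty u
  | emptyInd a b, u => onEmptyInd u fun a' b' => beq a a' && beq b b'
  | unit, u => onUnit u
  | star, u => onStar u
  | unitInd a b c, u => onUnitInd u fun a' b' c' => beq a a' && beq b b' && beq c c'
  | nat, u => onNat u
  | zero, u => onZero u
  | succ a, u => onSucc u fun a' => beq a a'
  | natInd a b c d, u => onNatInd u fun a' b' c' d' =>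
      beq a a' && beq b b' && beq c c' && beq d d'
  | id a b c, u => onId u fun a' b' c' => beq a a' && beq b b' && beq c c'
  | refl a, u => onRefl u fun a' => beq a a'
  | idInd a b c d e g, u => onIdInd u fun a' b' c' d' e' g' =>
      beq a a' && beq b b' && beq c c' && beq d d' && beq e e' && beq g g'
  | ua i a b, u => onUa u fun i' a' b' => Nat.beq i i' && beq a a' && beq b b'

/-! ## Weakening and substitution by counting binders -/

/-- Adds `n` to the variables that are free under `d` binders. -/
def shift (n : ℕ) (t : Tm) : ℕ → Tm :=
  -- Direct use of the recursor lets the kernel evaluate this by unfolding. The binder count is an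
  -- argument of the value, so the recursion is on `t` alone.
  Tm.rec (motive := fun _ => ℕ → Tm)
    (fun k d => Bool.rec (motive := fun _ => Tm) (var (Nat.add k n)) (var k) (Nat.ble k.succ d))
    (fun i _ => univ i)
    (fun _ _ rA rB d => pi (rA d) (rB d.succ))
    (fun _ _ rA rb d => lam (rA d) (rb d.succ))
    (fun _ _ rf ra d => app (rf d) (ra d))
    (fun _ _ rA rB d => sig (rA d) (rB d.succ))
    (fun _ _ ra rb d => pair (ra d) (rb d))
    (fun _ _ _ _ _ rA rB rC rg rp d => sigInd (rA d) (rB d.succ) (rC d.succ) (rg d.succ.succ) (rp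
        d))
    (fun _ _ rA rB d => sum (rA d) (rB d))
    (fun _ ra d => inl (ra d))
    (fun _ rb d => inr (rb d))
    (fun _ _ _ _ _ _ rA rB rC rc re rp d => sumInd (rA d) (rB d) (rC d.succ) (rc d.succ) (re
        d.succ) (rp d))
    (fun _ => empty)
    (fun _ _ rC ra d => emptyInd (rC d.succ) (ra d))
    (fun _ => unit)
    (fun _ => star)
    (fun _ _ _ rC rc ra d => unitInd (rC d.succ) (rc d) (ra d))
    (fun _ => nat)
    (fun _ => zero)
    (fun _ ra d => succ (ra d))
    (fun _ _ _ _ rC rz rs ra d => natInd (rC d.succ) (rz d) (rs d.succ.succ) (ra d))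
    (fun _ _ _ rA ra rb d => id (rA d) (ra d) (rb d))
    (fun _ ra d => refl (ra d))
    (fun _ _ _ _ _ _ rA rC rc ra rb rp d => idInd (rA d) (rC d.succ.succ.succ) (rc d.succ) (ra d)
        (rb d)
      (rp d))
    (fun i _ _ rA rB d => ua i (rA d) (rB d))
    t

/-- The `k`-th entry of `l` moved under `d` binders, or the variable that comes after `l`. -/
def lookup (d m : ℕ) (l : List Tm) : ℕ → Tm :=
  List.rec (motive := fun _ => ℕ → Tm) (fun k => var (Nat.add (Nat.add k m) d))
    (fun t _ r k => Nat.casesOn k (shift d t 0) r) l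

/-- Under `d` binders, replaces the next variables by the entries of `l` and adds `m` to the number of
variables that come after these. -/
def plug (l : List Tm) (m : ℕ) (t : Tm) : ℕ → Tm :=
  Tm.rec (motive := fun _ => ℕ → Tm)
    -- A variable below `d` is bound inside `t` and stays. Any other entry is weakened once, by `d`,
    -- at lookup, whereas `up` weakens at every binder.
    (fun k d => Bool.rec (motive := fun _ => Tm) (lookup d m l (Nat.sub k d)) (var k) (Nat.ble
        k.succ d))
    (fun i _ => univ i)
    (fun _ _ rA rB d => pi (rA d) (rB d.succ))
    (fun _ _ rA rb d => lam (rA d) (rb d.succ))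
    (fun _ _ rf ra d => app (rf d) (ra d))
    (fun _ _ rA rB d => sig (rA d) (rB d.succ))
    (fun _ _ ra rb d => pair (ra d) (rb d))
    (fun _ _ _ _ _ rA rB rC rg rp d => sigInd (rA d) (rB d.succ) (rC d.succ) (rg d.succ.succ) (rp
        d))
    (fun _ _ rA rB d => sum (rA d) (rB d))
    (fun _ ra d => inl (ra d))
    (fun _ rb d => inr (rb d))
    (fun _ _ _ _ _ _ rA rB rC rc re rp d => sumInd (rA d) (rB d) (rC d.succ) (rc d.succ) (re
        d.succ) (rp d))
    (fun _ => empty)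
    (fun _ _ rC ra d => emptyInd (rC d.succ) (ra d))
    (fun _ => unit)
    (fun _ => star)
    (fun _ _ _ rC rc ra d => unitInd (rC d.succ) (rc d) (ra d))
    (fun _ => nat)
    (fun _ => zero)
    (fun _ ra d => succ (ra d))
    (fun _ _ _ _ rC rz rs ra d => natInd (rC d.succ) (rz d) (rs d.succ.succ) (ra d))
    (fun _ _ _ rA ra rb d => id (rA d) (ra d) (rb d))
    (fun _ ra d => refl (ra d))
    (fun _ _ _ _ _ _ rA rC rc ra rb rp d => idInd (rA d) (rC d.succ.succ.succ) (rc d.succ) (ra d)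
        (rb d)
      (rp d))
    (fun i _ _ rA rB d => ua i (rA d) (rB d))
    t


end

/-! ### Agreement of the evaluable operations with equality, renaming and substitution. -/

theorem beq_eq (t : Tm) : ∀ u : Tm, beq t u = true → t = u := by
  induction t <;> intro u h <;>
    simp only [beq, onVar, onUniv, onPi, onLam, onApp, onSig, onPair, onSigInd, onSum, onInl,
      onInr, onSumInd, onEmpty, onEmptyInd, onUnit, onStar, onUnitInd, onNat, onZero, onSucc,
      onNatInd, onId, onRefl, onIdInd, onUa] at h <;>
    split at h <;> first | rfl | exact absurd h Bool.false_ne_true | skip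
  all_goals
    try simp only [Bool.and_eq_true, Nat.beq_eq] at h
    grind

theorem ble_rec {α : Type*} (k d : ℕ) (a b : α) :
    Bool.rec (motive := fun _ => α) b a (Nat.ble k.succ d) = if k < d then a else b := by
  by_cases h : k < d
  · rw [Nat.ble_eq_true_of_le h, if_pos h]
  · rw [Bool.eq_false_iff.2 fun e => h (Nat.le_of_ble_eq_true e), if_neg h]

theorem upRen_iterate (ξ : ℕ → ℕ) (d : ℕ) : upRen (upRen^[d] ξ) = upRen^[d + 1] ξ :=
  (Function.iterate_succ_apply' upRen d ξ).symm

theorem up_iterate (σ : ℕ → Tm) (d : ℕ) : up (up^[d] σ) = up^[d + 1] σ :=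
  (Function.iterate_succ_apply' up d σ).symm

theorem upRen_iterate_apply (n d k : ℕ) :
    upRen^[d] (fun j => j + n) k = if k < d then k else k + n := by
  induction d generalizing k with
  | zero => simp
  | succ d ih =>
    rw [← upRen_iterate]
    cases k with
    | zero => simp [upRen]
    | succ k => simp only [upRen, ih]; split <;> split <;> omega

theorem shift_eq (n : ℕ) (t : Tm) : ∀ d, shift n t d = rename (upRen^[d] (fun j => j + n)) t := by
  induction t <;> intro d <;> simp_all [shift, rename, upRen_iterate]
  rw [upRen_iterate_apply, ble_rec, apply_ite var]

/-- The substitution carried out by `plug`. -/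
def env (m : ℕ) : List Tm → ℕ → Tm
  | [] => fun k => var (k + m)
  | t :: l => scons t (env m l)

theorem lookup_eq (d m : ℕ) (l : List Tm) (k : ℕ) :
    lookup d m l k = (env m l k).rename (fun j => j + d) := by
  induction l generalizing k with
  | nil => rfl
  | cons t l ih =>
    cases k with
    | zero => exact shift_eq d t 0
    | succ k => exact ih k

theorem up_iterate_apply (σ : ℕ → Tm) (d k : ℕ) :
    up^[d] σ k = if k < d then var k else (σ (k - d)).rename (fun j => j + d) := by
  induction d generalizing k with
  | zero =>
    simp [rename_eq_subst]
    exact (subst_var _).symm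
  | succ d ih =>
    rw [← up_iterate]
    cases k with
    | zero => simp [up, scons]
    | succ k =>
      simp only [up, scons, ih, Nat.add_lt_add_iff_right, Nat.add_sub_add_right]
      split
      · rfl
      · rw [wk, rename_rename]; rfl

theorem plug_eq (l : List Tm) (m : ℕ) (t : Tm) :
    ∀ d, plug l m t d = subst (up^[d] (env m l)) t := by
  induction t <;> intro d <;> simp_all [plug, subst, up_iterate]
  rw [up_iterate_apply, ble_rec, lookup_eq]

theorem plug_inst (b a : Tm) : plug [a] 0 b 0 = b.inst a := plug_eq _ _ _ _

theorem plug_inst2 (c a b : Tm) : plug [b, a] 0 c 0 = c.inst2 a b := plug_eq _ _ _ _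

theorem plug_inst3 (c a b p : Tm) : plug [p, b, a] 0 c 0 = c.inst3 a b p := plug_eq _ _ _ _

theorem plug_instUnder2 (C t : Tm) : plug [t] 2 C 0 = C.instUnder2 t := plug_eq _ _ _ _

theorem plug_instUnder1 (C t : Tm) :
    plug [t] 1 C 0 = C.subst (scons t (fun k => var (k + 1))) := plug_eq _ _ _ _

theorem plug_instDiag (C : Tm) :
    plug [refl (var 0), var 0, var 0] 1 C 0 =
      C.subst (scons (refl (var 0)) (scons (var 0) (scons (var 0) (fun k => var (k + 1))))) :=
  plug_eq _ _ _ _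

theorem shift_one (t : Tm) : shift 1 t 0 = t.wk := shift_eq _ _ _

theorem shift_two (t : Tm) : shift 2 t 0 = t.wk.wk := by
  rw [shift_eq, wk, wk, rename_rename]; rfl

end Tm
end MLTT

/-! ### The procedure that normalizes and checks raw terms. -/

namespace MLTT
open Tm

noncomputable section

namespace Tm

/-- This equals `f k`; the recursion only makes the kernel bring `k` into constructor form before
`f` is unfolded. -/
def forceNat {α : Type} (k : ℕ) (f : ℕ → α) : α := Nat.rec (motive := fun _ => α) (f 0) (fun k _ =>
    f k.succ) k

/-- Evaluates `t` before it is passed to `f`. -/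
def force {α : Type} (t : Tm) : (Tm → α) → α :=
  Tm.rec (motive := fun _ => (Tm → α) → α)
    (fun k f => forceNat k fun k => f (var k))
    (fun i f => forceNat i fun i => f (univ i))
    (fun _ _ rA rB f => rA fun A => rB fun B => f (pi A B))
    (fun _ _ rA rb f => rA fun A => rb fun b => f (lam A b))
    (fun _ _ rg ra f => rg fun g => ra fun a => f (app g a))
    (fun _ _ rA rB f => rA fun A => rB fun B => f (sig A B))
    (fun _ _ ra rb f => ra fun a => rb fun b => f (pair a b))
    (fun _ _ _ _ _ rA rB rC rg rp f => rA fun A => rB fun B => rC fun C => rg fun g => rp fun p =>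
      f (sigInd A B C g p))
    (fun _ _ rA rB f => rA fun A => rB fun B => f (sum A B))
    (fun _ ra f => ra fun a => f (inl a))
    (fun _ rb f => rb fun b => f (inr b))
    (fun _ _ _ _ _ _ rA rB rC rc rd re f => rA fun A => rB fun B => rC fun C => rc fun c => rd fun
      d => re fun e => f (sumInd A B C c d e))
    (fun f => f empty)
    (fun _ _ rC ra f => rC fun C => ra fun a => f (emptyInd C a))
    (fun f => f unit)
    (fun f => f star)
    (fun _ _ _ rC rc ra f => rC fun C => rc fun c => ra fun a => f (unitInd C c a))
    (fun f => f nat)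
    (fun f => f zero)
    (fun _ rn f => rn fun n => f (succ n))
    (fun _ _ _ _ rC rz rs rn f => rC fun C => rz fun z => rs fun s => rn fun n => f (natInd C z s
      n))
    (fun _ _ _ rA ra rb f => rA fun A => ra fun a => rb fun b => f (id A a b))
    (fun _ ra f => ra fun a => f (refl a))
    (fun _ _ _ _ _ _ rA rC rc ra rb rp f => rA fun A => rC fun C => rc fun c => ra fun a => rb fun
      b => rp fun p => f (idInd A C c a b p))
    (fun i _ _ rA rB f => forceNat i fun i => rA fun A => rB fun B => f (ua i A B))
    t

theorem forceNat_eq {α : Type} (k : ℕ) (f : ℕ → α) : forceNat k f = f k := by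
  cases k <;> rfl

theorem force_eq {α : Type} (t : Tm) : ∀ f : Tm → α, force t f = f t := by
  induction t <;> intro f <;> simp_all only [force, forceNat_eq]

end Tm

/-- `Option.bind`, in a form that is fast to evaluate. -/
def _root_.Option.bindRec {α β : Type} (o : Option α) (f : α → Option β) : Option β :=
  Option.rec (motive := fun _ => Option β) none f o

namespace Checker

/-- A procedure for one term that, given a context and possibly a type for the term, returns a normal
form of the term and its type. -/
abbrev Sub := Ctx → Option Tm → Option (Tm × Tm)

abbrev Proc := Tm → Sub

def whenTrue {α : Type} (b : Bool) (r : Option α) : Option α := Bool.rec (motive := fun _ =>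
    Option α) none r b

/-- The first component of the result, if there is one, and otherwise `t`. -/
def nfOr (r : Option (Tm × Tm)) (t : Tm) : Tm := match r with | some p => p.1 | none => t

def viewUniv (t : Tm) : Option ℕ := match t with | univ i => some i | _ => none
def viewPi (t : Tm) : Option (Tm × Tm) := match t with | pi A B => some (A, B) | _ => none
def viewSig (t : Tm) : Option (Tm × Tm) := match t with | sig A B => some (A, B) | _ => none
def viewSum (t : Tm) : Option (Tm × Tm) := match t with | sum A B => some (A, B) | _ => none
def viewId (t : Tm) : Option (Tm × Tm × Tm) :=
  match t with | .id A a b => some (A, a, b) | _ => none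

variable (F : Proc)

/-- The level of the universe to which `U` is convertible. -/
def univOf (Γ : Ctx) (U : Tm) : Option ℕ :=
  match viewUniv U with
  | some i => some i
  | none => (F U Γ none).bindRec fun q => (viewUniv q.2).bindRec fun _ => viewUniv q.1

/-- The level and the normal form of a type. -/
def isTy (f : Sub) (Γ : Ctx) : Option (ℕ × Tm) :=
  (f Γ none).bindRec fun p => (univOf F Γ p.2).bindRec fun i => some (i, p.1)

/-- An expected type may have the required shape only up to conversion. It is normalized just when
the shape is not visible. -/
def viaNf {α : Type} (view : Tm → Option α) (Γ : Ctx) (T : Tm) : Option α :=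
  match view T with
  | some x => some x
  | none => (isTy F (F T) Γ).bindRec fun p => force p.2 view

/-- Are the types equal, or both universes and `T` the larger one? -/
def subNf (T' T : Tm) : Bool := T'.beq T || onUniv T' fun i => onUniv T fun j => Nat.ble i j

/-- Syntactic comparison comes first and normal forms are computed only if it fails. Cumulativity is
tried between universes themselves and not inside other types. -/
def sub (Γ : Ctx) (T' T : Tm) : Bool :=
  subNf T' T || ((isTy F (F T') Γ).bindRec fun N' => (isTy F (F T) Γ).bindRec fun N =>
    whenTrue (subNf N'.2 N.2) (some ())).isSome

/-- Are the types `A` and `B` convertible? -/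
def sameTy (Γ : Ctx) (A B : Tm) : Bool :=
  A.beq B || (isTy F (F A) Γ).elim false fun N => (isTy F (F B) Γ).elim false fun M => N.2.beq M.2

def expect (Γ : Ctx) (m : Option Tm) (t' T' : Tm) : Option (Tm × Tm) :=
  match m with
  | none => some (t', T')
  | some T => whenTrue (sub F Γ T' T) (some (t', T))

def check (f : Sub) (Γ : Ctx) (T : Tm) : Option Tm := (f Γ (some T)).bindRec fun p => some p.1

/-- Applied to the parts of a redex before contraction. Their typing would follow from that of the
redex by injectivity of the type formers, which is not available; checking them again replaces it.
-/
def ok (Γ : Ctx) (t T : Tm) : Bool := (F t Γ (some T)).isSome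

/-- The normal form of a reduct `t` of type `T`. -/
def reduct (Γ : Ctx) (t T : Tm) : Tm := force t fun t => nfOr (F t Γ (some T)) t

def nth (Γ : Ctx) : ℕ → Option Tm :=
  List.rec (motive := fun _ => ℕ → Option Tm) (fun _ => none) (fun A _ r k => Nat.casesOn k (some
      A) r) Γ

def goVar (k : ℕ) : Sub := fun Γ m =>
  (nth Γ k).bindRec fun A => force (shift k.succ A 0) fun A => expect F Γ m (var k) A

def goPi (A : Tm) (fA fB : Sub) : Sub := fun Γ m =>
  (isTy F fA Γ).bindRec fun p => (isTy F fB (A :: Γ)).bindRec fun q =>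
    expect F Γ m (pi p.2 q.2) (univ (bif Nat.ble p.1 q.1 then q.1 else p.1))

def goSig (A : Tm) (fA fB : Sub) : Sub := fun Γ m =>
  (isTy F fA Γ).bindRec fun p => (isTy F fB (A :: Γ)).bindRec fun q =>
    expect F Γ m (sig p.2 q.2) (univ (bif Nat.ble p.1 q.1 then q.1 else p.1))

def goSum (fA fB : Sub) : Sub := fun Γ m =>
  (isTy F fA Γ).bindRec fun p => (isTy F fB Γ).bindRec fun q =>
    expect F Γ m (sum p.2 q.2) (univ (bif Nat.ble p.1 q.1 then q.1 else p.1))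

/-- The normal form of `lam A b`, of type `T`, where `A` and `b` are normal. -/
def eta (Γ : Ctx) (T A b : Tm) : Tm :=
  match b with
  | app h v =>
      -- Putting `star` for the last variable and weakening again returns `h` exactly if that
      -- variable does not occur in `h`.
      bif v.beq (var 0) && (shift 1 (plug [star] 0 h 0) 0).beq h && ok F Γ (plug [star] 0 h 0) T
          then
        plug [star] 0 h 0
      else lam A b
  | _ => lam A b

def goLam (A : Tm) (fA fb : Sub) : Sub := fun Γ m =>
  match m with
  | none => (isTy F fA Γ).bindRec fun p => (fb (A :: Γ) none).bindRec fun q =>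
      some (lam p.2 q.1, pi A q.2)
  | some T => (viaNf F viewPi Γ T).bindRec fun r =>
      whenTrue (sameTy F Γ r.1 A)
        ((check fb (r.1 :: Γ) r.2).bindRec fun b' =>
          some (eta F Γ T ((isTy F fA Γ).elim A Prod.snd) b', T))

/-- If the recheck fails, the redex is kept. This is harmless, since soundness requires the result
to be convertible to the input and not to be normal. -/
def beta (Γ : Ctx) (A B f' a' : Tm) : Tm :=
  match f' with
  | lam A₀ b =>
      bif sameTy F Γ A A₀ && force b (fun b => ok F (A :: Γ) b B) then
        reduct F Γ (plug [a'] 0 b 0) (plug [a'] 0 B 0)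
      else app f' a'
  | _ => app f' a'

/-- The type of the arguments in the application of `f` to an argument with the procedure `fa`. -/
def argTy (f : Tm) (fa : Sub) (Γ : Ctx) : Option Tm :=
  match f with
  | lam A _ => (isTy F (F A) Γ).bindRec fun _ => some A
  | _ => (fa Γ none).bindRec fun p => some p.2

/-- The type `T` as a family over the values of `a`, if `a` is a variable. -/
def generalize (a T : Tm) : Tm :=
  match a with
  -- The list built here is `var 1, …, var k, var 0`: variable `k` becomes the new last variable and
  -- all others move up by one.
  | var k => plug (Nat.rec (motive := fun _ => List Tm → List Tm) id
      (fun i r l => r (var i.succ :: l)) k [var 0]) k.succ.succ T 0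
  | _ => shift 1 T 0

/-- The application of `f` to `a`, where the type of `f` is found from that of the application. -/
def goAppCheck (f a : Tm) (ff fa : Sub) : Sub := fun Γ m =>
  m.bindRec fun T => (argTy F f fa Γ).bindRec fun A => force (generalize a T) fun B =>
    (isTy F (F B) (A :: Γ)).bindRec fun _ => whenTrue ((plug [a] 0 B 0).beq T)
      ((check ff Γ (pi A B)).bindRec fun f' => (check fa Γ A).bindRec fun a' =>
        some (beta F Γ A B f' a', T))

/-- Inference for `f` fails, for instance, if `f` is an abstraction whose body is a pair. Then the
type of `f` is reconstructed from the expected type of the application. -/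
def goApp (f a : Tm) (ff fa : Sub) : Sub := fun Γ m =>
  Option.rec (motive := fun _ => Option (Tm × Tm)) (goAppCheck F f a ff fa Γ m)
    (fun p => (viaNf F viewPi Γ p.2).bindRec fun r =>
      (check fa Γ r.1).bindRec fun a' => force (plug [a] 0 r.2 0) fun T =>
        expect F Γ m (beta F Γ r.1 r.2 p.1 a') T) (ff Γ none)

def goPair (a : Tm) (fa fb : Sub) : Sub := fun Γ m =>
  m.bindRec fun T => (viaNf F viewSig Γ T).bindRec fun r =>
    (check fa Γ r.1).bindRec fun a' => force (plug [a] 0 r.2 0) fun T' =>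
      (check fb Γ T').bindRec fun b' => some (pair a' b', T)

def sigRed (Γ : Ctx) (A B g T p' other : Tm) : Tm :=
  match p' with
  | pair a b => bif ok F Γ a A && ok F Γ b (plug [a] 0 B 0) then
      reduct F Γ (plug [b, a] 0 g 0) T else other
  | _ => other

def goSigInd (A B C g p : Tm) (fA fB fC fg fp : Sub) : Sub := fun Γ m =>
  (isTy F fA Γ).bindRec fun A' => (isTy F fB (A :: Γ)).bindRec fun B' =>
  (isTy F fC (sig A B :: Γ)).bindRec fun C' =>
  force (plug [pair (var 1) (var 0)] 2 C 0) fun Tg =>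
  (check fg (B :: A :: Γ) Tg).bindRec fun g' =>
  (check fp Γ (sig A B)).bindRec fun p' =>
  force (plug [p] 0 C 0) fun T =>
    expect F Γ m (sigRed F Γ A B g T p' (sigInd A'.2 B'.2 C'.2 g' p')) T

def goInl (fa : Sub) : Sub := fun Γ m =>
  m.bindRec fun T => (viaNf F viewSum Γ T).bindRec fun r =>
    (check fa Γ r.1).bindRec fun a' => some (inl a', T)

def goInr (fa : Sub) : Sub := fun Γ m =>
  m.bindRec fun T => (viaNf F viewSum Γ T).bindRec fun r =>
    (check fa Γ r.2).bindRec fun a' => some (inr a', T)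

def sumRed (Γ : Ctx) (A B c d T e' other : Tm) : Tm :=
  match e' with
  | inl a => bif ok F Γ a A then reduct F Γ (plug [a] 0 c 0) T else other
  | inr b => bif ok F Γ b B then reduct F Γ (plug [b] 0 d 0) T else other
  | _ => other

def goSumInd (A B C c d e : Tm) (fA fB fC fc fd fe : Sub) : Sub := fun Γ m =>
  (isTy F fA Γ).bindRec fun A' => (isTy F fB Γ).bindRec fun B' =>
  (isTy F fC (sum A B :: Γ)).bindRec fun C' =>
  force (plug [inl (var 0)] 1 C 0) fun Tc => (check fc (A :: Γ) Tc).bindRec fun c' =>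
  force (plug [inr (var 0)] 1 C 0) fun Td => (check fd (B :: Γ) Td).bindRec fun d' =>
  (check fe Γ (sum A B)).bindRec fun e' => force (plug [e] 0 C 0) fun T =>
    expect F Γ m (sumRed F Γ A B c d T e' (sumInd A'.2 B'.2 C'.2 c' d' e')) T

def goEmptyInd (C a : Tm) (fC fa : Sub) : Sub := fun Γ m =>
  (isTy F fC (empty :: Γ)).bindRec fun C' => (check fa Γ empty).bindRec fun a' =>
    force (plug [a] 0 C 0) fun T => expect F Γ m (emptyInd C'.2 a') T

def unitRed (Γ : Ctx) (c T a' other : Tm) : Tm :=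
  match a' with
  | .star => reduct F Γ c T
  | _ => other

def goUnitInd (C c a : Tm) (fC fc fa : Sub) : Sub := fun Γ m =>
  (isTy F fC (unit :: Γ)).bindRec fun C' =>
  force (plug [star] 0 C 0) fun Tc => (check fc Γ Tc).bindRec fun c' =>
  (check fa Γ unit).bindRec fun a' => force (plug [a] 0 C 0) fun T =>
    expect F Γ m (unitRed F Γ c T a' (unitInd C'.2 c' a')) T

def natRed (Γ : Ctx) (C z s T n' other : Tm) : Tm :=
  match n' with
  | zero => reduct F Γ z T
  | succ k => bif ok F Γ k nat then reduct F Γ (plug [natInd C z s k, k] 0 s 0) T else other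
  | _ => other

def goNatInd (C z s n : Tm) (fC fz fs fn : Sub) : Sub := fun Γ m =>
  (isTy F fC (nat :: Γ)).bindRec fun C' =>
  force (plug [zero] 0 C 0) fun Tz => (check fz Γ Tz).bindRec fun z' =>
  force (plug [succ (var 1)] 2 C 0) fun Ts => (check fs (C :: nat :: Γ) Ts).bindRec fun s' =>
  (check fn Γ nat).bindRec fun n' => force (plug [n] 0 C 0) fun T =>
    expect F Γ m (natRed F Γ C z s T n' (natInd C'.2 z' s' n')) T

def goSucc (fn : Sub) : Sub := fun Γ m =>
  (check fn Γ nat).bindRec fun n' => expect F Γ m (succ n') nat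

def goId (A : Tm) (fA fa fb : Sub) : Sub := fun Γ m =>
  (isTy F fA Γ).bindRec fun A' => (check fa Γ A).bindRec fun a' => (check fb Γ A).bindRec fun b' =>
    expect F Γ m (id A'.2 a' b') (univ A'.1)

/-- Is the term `a` of type `A`, with the normal form `a'`, convertible to `b`? -/
def sameTm (Γ : Ctx) (A a a' b : Tm) : Bool :=
  a.beq b || (check (F b) Γ A).elim false fun b' => a'.beq b'

def goRefl (a : Tm) (fa : Sub) : Sub := fun Γ m =>
  match m with
  | none => (fa Γ none).bindRec fun p => some (refl p.1, id p.2 a a)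
  | some T => (viaNf F viewId Γ T).bindRec fun r => (check fa Γ r.1).bindRec fun a' =>
      whenTrue (sameTm F Γ r.1 a a' r.2.1)
        (whenTrue (sameTm F Γ r.1 a a' r.2.2) (some (refl a', T)))

/-- The computation rule needs the same point in three places, so the normal form of `q` is compared
with those of both end points. -/
def idRed (Γ : Ctx) (A c T a' b' p' other : Tm) : Tm :=
  match p' with
  | .refl q => bif (check (F q) Γ A).elim false (fun q' => q'.beq a' && q'.beq b') then
      reduct F Γ (plug [q] 0 c 0) T else other
  | _ => other

def goIdInd (A C c a b p : Tm) (fA fC fc fa fb fp : Sub) : Sub := fun Γ m =>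
  (isTy F fA Γ).bindRec fun A' =>
  force (shift 1 A 0) fun A₁ => force (shift 2 A 0) fun A₂ =>
  (isTy F fC (id A₂ (var 1) (var 0) :: A₁ :: A :: Γ)).bindRec fun C' =>
  force (plug [refl (var 0), var 0, var 0] 1 C 0) fun Tc =>
  (check fc (A :: Γ) Tc).bindRec fun c' =>
  (check fa Γ A).bindRec fun a' => (check fb Γ A).bindRec fun b' =>
  (check fp Γ (id A a b)).bindRec fun p' => force (plug [p, b, a] 0 C 0) fun T =>
    expect F Γ m (idRed F Γ A c T a' b' p' (idInd A'.2 C'.2 c' a' b' p')) T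

def goUa (i : ℕ) (A B : Tm) (fA fB : Sub) : Sub := fun Γ m =>
  (check fA Γ (univ i)).bindRec fun A' => (check fB Γ (univ i)).bindRec fun B' =>
    force (isEquiv (id (univ i) A B) (equiv A B) (idToEquiv i A B)) fun T =>
      expect F Γ m (ua i A' B') T

/-- The procedure that uses `F` for types and reducts. -/
def layer (t : Tm) : Sub :=
  Tm.rec (motive := fun _ => Sub)
    (fun k => goVar F k)
    (fun i => fun Γ m => expect F Γ m (univ i) (univ i.succ))
    (fun A _ rA rB => goPi F A rA rB)
    (fun A _ rA rb => goLam F A rA rb)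
    (fun f a rf ra => goApp F f a rf ra)
    (fun A _ rA rB => goSig F A rA rB)
    (fun a _ ra rb => goPair F a ra rb)
    (fun A B C g p rA rB rC rg rp => goSigInd F A B C g p rA rB rC rg rp)
    (fun _ _ rA rB => goSum F rA rB)
    (fun _ ra => goInl F ra)
    (fun _ rb => goInr F rb)
    (fun A B C c d e rA rB rC rc rd re => goSumInd F A B C c d e rA rB rC rc rd re)
    (fun Γ m => expect F Γ m empty (univ 0))
    (fun C a rC ra => goEmptyInd F C a rC ra)
    (fun Γ m => expect F Γ m unit (univ 0))
    (fun Γ m => expect F Γ m star unit)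
    (fun C c a rC rc ra => goUnitInd F C c a rC rc ra)
    (fun Γ m => expect F Γ m nat (univ 0))
    (fun Γ m => expect F Γ m zero nat)
    (fun _ rn => goSucc F rn)
    (fun C z s n rC rz rs rn => goNatInd F C z s n rC rz rs rn)
    (fun A _ _ rA ra rb => goId F A rA ra rb)
    (fun a ra => goRefl F a ra)
    (fun A C c a b p rA rC rc ra rb rp => goIdInd F A C c a b p rA rC rc ra rb rp)
    (fun i A B rA rB => goUa F i A B rA rB)
    t
end Checker

end

namespace Checker

/-! ### Soundness -/

theorem _root_.MLTT.Deriv.isSubst_succ {Γ : Ctx} {C : Tm} {j : ℕ}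
    (hC : Deriv (.typ (nat :: Γ) C (univ j))) :
    IsSubst (C :: nat :: Γ) (scons (succ (var 1)) (fun k => var (k + 2))) (nat :: Γ) := by
  have h := Deriv.ctx_cons hC.wf hC
  refine IsSubst.cons (((IsSubst.var hC.wf.ctx_tail).wk (B := nat) (i := 0)
    (.nat_form hC.wf.ctx_tail)).wk hC) (.nat_succ h.var_one)

/-- The expected type, if there is one, is a type. -/
def GoodMode (Γ : Ctx) (m : Option Tm) : Prop := ∀ T, m = some T → ∃ i, Deriv (.typ Γ T (univ i))

/-- The result of a procedure is convertible to the given term and has the expected type. -/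
def GoodResult (Γ : Ctx) (t : Tm) (m : Option Tm) (r : Tm × Tm) : Prop :=
  Deriv (.eq Γ t r.1 r.2) ∧ ∀ T, m = some T → r.2 = T

/-- Every result of the procedure for `t` is good. -/
def SoundAt (t : Tm) (f : Sub) : Prop :=
  ∀ Γ m r, Deriv (.ctx Γ) → GoodMode Γ m → f Γ m = some r → GoodResult Γ t m r

def Sound (F : Proc) : Prop := ∀ t, SoundAt t (F t)

theorem _root_.Option.bindRec_eq_some_iff {α β : Type} {o : Option α} {f : α → Option β} {b : β} :
    o.bindRec f = some b ↔ ∃ a, o = some a ∧ f a = some b := by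
  cases o <;> simp [Option.bindRec]

theorem nth_eq (Γ : Ctx) : ∀ k, nth Γ k = Γ[k]? := by
  induction Γ with
  | nil => exact fun _ => rfl
  | cons A Γ ih =>
    intro k
    cases k with
    | zero => rfl
    | succ k => exact ih k

theorem ble_max (i j : ℕ) : (bif Nat.ble i j then j else i) = max i j := by
  rcases le_total i j with h | h
  · rw [Nat.ble_eq_true_of_le h, max_eq_right h]; rfl
  · rcases h.eq_or_lt with rfl | h
    · rw [max_self]; cases Nat.ble j j <;> rfl
    · rw [Bool.eq_false_iff.2 fun e => h.not_ge (Nat.le_of_ble_eq_true e), max_eq_left h.le]; rfl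

theorem _root_.MLTT.Deriv.lam_domain {Γ : Ctx} {A A' b B : Tm} {i j : ℕ}
    (hA : Deriv (.typ Γ A (univ i))) (he : Deriv (.eq Γ A A' (univ j)))
    (hb : Deriv (.typ (A :: Γ) b B)) : Deriv (.eq Γ (lam A b) (lam A' b) (pi A B)) :=
  .pi_intro_eq (Deriv.cumul_le (le_max_left i j) hA) (Deriv.cumul_eq_le (le_max_right i j) he)
    (.eq_refl hb)

theorem whenTrue_eq {α : Type} {b : Bool} {r : Option α} {x : α} (h : whenTrue b r = some x) :
    b = true ∧ r = some x := by
  cases b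
  · nomatch h
  · exact ⟨rfl, h⟩

theorem viewUniv_eq {t : Tm} {i : ℕ} (h : viewUniv t = some i) : t = univ i := by
  cases t <;> simp_all [viewUniv]

theorem viewPi_eq {t : Tm} {r : Tm × Tm} (h : viewPi t = some r) : t = pi r.1 r.2 := by
  cases t <;> simp_all [viewPi]
  simp [← h]

theorem viewSig_eq {t : Tm} {r : Tm × Tm} (h : viewSig t = some r) : t = sig r.1 r.2 := by
  cases t <;> simp_all [viewSig]
  simp [← h]

theorem viewSum_eq {t : Tm} {r : Tm × Tm} (h : viewSum t = some r) : t = sum r.1 r.2 := by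
  cases t <;> simp_all [viewSum]
  simp [← h]

theorem viewId_eq {t : Tm} {r : Tm × Tm × Tm} (h : viewId t = some r) :
    t = .id r.1 r.2.1 r.2.2 := by
  cases t <;> simp_all [viewId]
  simp [← h]

theorem goodMode_none {Γ : Ctx} : GoodMode Γ none := fun _ h => nomatch h

theorem goodMode_some {Γ : Ctx} {T : Tm} {i : ℕ} (h : Deriv (.typ Γ T (univ i))) :
    GoodMode Γ (some T) := fun _ e => ⟨i, Option.some.inj e ▸ h⟩

theorem subNf_sound {Γ : Ctx} {t t' T' T : Tm} {j : ℕ} (h : subNf T' T = true)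
    (he : Deriv (.eq Γ t t' T')) (hT : Deriv (.typ Γ T (univ j))) : Deriv (.eq Γ t t' T) := by
  rw [subNf, Bool.or_eq_true] at h
  rcases h with h | h
  · exact beq_eq _ _ h ▸ he
  · cases T' <;> simp only [onUniv, Bool.false_eq_true] at h
    cases T <;> simp only [Bool.false_eq_true] at h
    exact Deriv.cumul_eq_le (Nat.le_of_ble_eq_true h) he

section
variable {F : Proc} (hF : Sound F) {Γ : Ctx} {m : Option Tm} {r : Tm × Tm}
theorem check_sound (sa : SoundAt t fa) (hT : Deriv (.typ Γ T (univ i)))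
    (h : check fa Γ T = some t') :
    Deriv (.eq Γ t t' T) := by
  simp only [check, Option.bindRec_eq_some_iff] at h
  obtain ⟨p, hp, h⟩ := h
  cases h
  obtain ⟨h₁, h₂⟩ := sa _ _ _ hT.wf (goodMode_some hT) hp
  exact h₂ T rfl ▸ h₁

include hF
variable {fA fB fC fa fb fc fd fe ff fg fn fp fs fz : Sub} {A A' B B' a a' b b' t t' T T' f f' p p'
    q C C' other U : Tm} {i j k : ℕ}

theorem univOf_sound (hA : Deriv (.eq Γ A A' U)) (h : univOf F Γ U = some i) :
    Deriv (.eq Γ A A' (univ i)) := by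
  unfold univOf at h
  split at h
  · next k hk => cases h; exact viewUniv_eq hk ▸ hA
  · simp only [Option.bindRec_eq_some_iff] at h
    obtain ⟨q, hq, k, hk, hi⟩ := h
    have := (hF _ _ _ _ hA.wf_eq goodMode_none hq).1
    rw [viewUniv_eq hk, viewUniv_eq hi] at this
    exact hA.eq_conv this

theorem isTy_sound {p : ℕ × Tm} (sA : SoundAt A fA) (hΓ : Deriv (.ctx Γ))
    (h : isTy F fA Γ = some p) :
    Deriv (.eq Γ A p.2 (univ p.1)) := by
  simp only [isTy, Option.bindRec_eq_some_iff] at h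
  obtain ⟨q, hq, i, hi, h⟩ := h
  cases h
  exact univOf_sound hF (sA _ _ _ hΓ goodMode_none hq).1 hi

theorem viaNf_sound {α : Type} {view : Tm → Option α} {x : α} (hT : Deriv (.typ Γ T (univ i)))
    (h : viaNf F view Γ T = some x) :
    ∃ N j, view N = some x ∧ Deriv (.eq Γ T N (univ j)) := by
  unfold viaNf at h
  split at h
  · next y hy => cases h; exact ⟨T, i, hy, .eq_refl hT⟩
  · simp only [Option.bindRec_eq_some_iff] at h
    obtain ⟨q, hq, h⟩ := h
    rw [force_eq] at h
    exact ⟨_, _, h, isTy_sound hF (hF _) hT.wf hq⟩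

theorem sub_sound (h : sub F Γ T' T = true) (he : Deriv (.eq Γ t t' T'))
    (hT : Deriv (.typ Γ T (univ j))) : Deriv (.eq Γ t t' T) := by
  rw [sub, Bool.or_eq_true] at h
  rcases h with h | h
  · exact subNf_sound h he hT
  · simp only [Option.isSome_iff_exists, Option.bindRec_eq_some_iff] at h
    obtain ⟨_, N', hN', N, hN, h⟩ := h
    have h₁ := isTy_sound hF (hF _) he.wf_eq hN'
    have h₂ := isTy_sound hF (hF _) he.wf_eq hN
    exact (subNf_sound (whenTrue_eq h).1 (he.eq_conv h₁) h₂.typ_right).eq_conv h₂.eq_symm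

theorem sameTy_sound (hA : Deriv (.typ Γ A (univ i))) (h : sameTy F Γ A B = true) :
    ∃ j, Deriv (.eq Γ A B (univ j)) := by
  rw [sameTy, Bool.or_eq_true] at h
  rcases h with h | h
  · exact ⟨i, beq_eq _ _ h ▸ .eq_refl hA⟩
  · cases hN : isTy F (F A) Γ with
    | none => rw [hN] at h; exact absurd h Bool.false_ne_true
    | some N =>
      cases hM : isTy F (F B) Γ with
      | none => rw [hN, hM] at h; exact absurd h Bool.false_ne_true
      | some M =>
        rw [hN, hM] at h
        have h₁ := Deriv.cumul_eq_le (le_max_left N.1 M.1) (isTy_sound hF (hF _) hA.wf hN)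
        have h₂ := Deriv.cumul_eq_le (le_max_right N.1 M.1) (isTy_sound hF (hF _) hA.wf hM)
        rw [beq_eq _ _ h] at h₁
        exact ⟨_, h₁.eq_trans h₂.eq_symm⟩

theorem expect_sound (hm : GoodMode Γ m) (he : Deriv (.eq Γ t t' T'))
    (h : expect F Γ m t' T' = some r) : GoodResult Γ t m r := by
  cases m with
  | none =>
    cases h
    exact ⟨he, fun _ e => nomatch e⟩
  | some T =>
    obtain ⟨hs, h⟩ := whenTrue_eq h
    cases h
    obtain ⟨i, hT⟩ := hm T rfl
    exact ⟨sub_sound hF hs he hT, fun _ e => Option.some.inj e⟩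

theorem ok_sound (hT : Deriv (.typ Γ T (univ i))) (h : ok F Γ t T = true) :
    Deriv (.typ Γ t T) := by
  obtain ⟨p, hp⟩ := Option.isSome_iff_exists.1 h
  obtain ⟨h₁, h₂⟩ := hF _ _ _ _ hT.wf (goodMode_some hT) hp
  exact h₂ T rfl ▸ h₁.typ_left

/-- If the previous layer gives no answer, `reduct` returns `t` itself, so the claim does not depend
on success. -/
theorem reduct_sound (ht : Deriv (.typ Γ t T)) : Deriv (.eq Γ t (reduct F Γ t T) T) := by
  obtain ⟨i, hT⟩ := ht.type_form
  unfold reduct nfOr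
  rw [force_eq]
  split
  · next p hp =>
    obtain ⟨h₁, h₂⟩ := hF _ _ _ _ hT.wf (goodMode_some hT) hp
    exact h₂ T rfl ▸ h₁
  · exact .eq_refl ht

theorem goVar_sound (hΓ : Deriv (.ctx Γ)) (hm : GoodMode Γ m) (h : goVar F k Γ m = some r) :
    GoodResult Γ (var k) m r := by
  simp only [goVar, Option.bindRec_eq_some_iff, nth_eq, force_eq, shift_eq] at h
  obtain ⟨A, hA, h⟩ := h
  refine expect_sound hF hm (.eq_refl ?_) h
  exact .var hΓ hA

theorem goPi_sound (hΓ : Deriv (.ctx Γ)) (hm : GoodMode Γ m)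
    (sA : SoundAt A fA) (sB : SoundAt B fB)
    (h : goPi F A fA fB Γ m = some r) :
    GoodResult Γ (pi A B) m r := by
  simp only [goPi, Option.bindRec_eq_some_iff, ble_max] at h
  obtain ⟨p, hp, q, hq, h⟩ := h
  have h₁ := isTy_sound hF sA hΓ hp
  have h₂ := isTy_sound hF sB (.ctx_cons hΓ h₁.typ_left) hq
  exact expect_sound hF hm (.pi_form_eq (Deriv.cumul_le (le_max_left _ _) h₁.typ_left)
    (Deriv.cumul_eq_le (le_max_left _ _) h₁) (Deriv.cumul_eq_le (le_max_right _ _) h₂)) h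

theorem goSig_sound (hΓ : Deriv (.ctx Γ)) (hm : GoodMode Γ m)
    (sA : SoundAt A fA) (sB : SoundAt B fB)
    (h : goSig F A fA fB Γ m = some r) :
    GoodResult Γ (sig A B) m r := by
  simp only [goSig, Option.bindRec_eq_some_iff, ble_max] at h
  obtain ⟨p, hp, q, hq, h⟩ := h
  have h₁ := isTy_sound hF sA hΓ hp
  have h₂ := isTy_sound hF sB (.ctx_cons hΓ h₁.typ_left) hq
  exact expect_sound hF hm (.sig_form_eq (Deriv.cumul_le (le_max_left _ _) h₁.typ_left)
    (Deriv.cumul_eq_le (le_max_left _ _) h₁) (Deriv.cumul_eq_le (le_max_right _ _) h₂)) h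

theorem goSum_sound (hΓ : Deriv (.ctx Γ)) (hm : GoodMode Γ m)
    (sA : SoundAt A fA) (sB : SoundAt B fB)
    (h : goSum F fA fB Γ m = some r) :
    GoodResult Γ (sum A B) m r := by
  simp only [goSum, Option.bindRec_eq_some_iff, ble_max] at h
  obtain ⟨p, hp, q, hq, h⟩ := h
  have h₁ := isTy_sound hF sA hΓ hp
  have h₂ := isTy_sound hF sB hΓ hq
  exact expect_sound hF hm (.sum_form_eq (Deriv.cumul_eq_le (le_max_left _ _) h₁)
    (Deriv.cumul_eq_le (le_max_right _ _) h₂)) h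

theorem eta_sound (hA : Deriv (.eq Γ A A' (univ i))) (hb : Deriv (.typ (A :: Γ) b B))
    (hT : Deriv (.eq Γ T (pi A B) (univ j))) : Deriv (.eq Γ (lam A b) (eta F Γ T A' b) T) := by
  have h₀ : Deriv (.eq Γ (lam A b) (lam A' b) (pi A B)) :=
    .pi_intro_eq hA.typ_left hA (.eq_refl hb)
  unfold eta
  split
  · next h v =>
    refine Bool.rec (fun _ => h₀.eq_conv hT.eq_symm) (fun hc => ?_)
      (v.beq (var 0) && (shift 1 (plug [star] 0 h 0) 0).beq h && ok F Γ (plug [star] 0 h 0) T)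
      (motive := fun c => (v.beq (var 0) && (shift 1 (plug [star] 0 h 0) 0).beq h &&
        ok F Γ (plug [star] 0 h 0) T) = c → Deriv (.eq Γ (lam A (app h v)) (bif c then
          plug [star] 0 h 0 else lam A' (app h v)) T)) rfl
    simp only [Bool.and_eq_true] at hc
    obtain ⟨⟨hv, hh⟩, hg⟩ := hc
    have hg := (ok_sound hF hT.typ_left hg).conv hT
    -- The η-rule for the candidate `g` reads `g ≡ lam A (app g.wk (var 0))`; by the tests, `g.wk`
    -- is `h` and `var 0` is `v`.
    have e := hg.pi_uniq
    rw [← shift_one, beq_eq _ _ hh, ← beq_eq _ _ hv] at e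
    exact e.eq_symm.eq_conv hT.eq_symm
  · exact h₀.eq_conv hT.eq_symm

theorem goLam_sound (hΓ : Deriv (.ctx Γ)) (hm : GoodMode Γ m)
    (sA : SoundAt A fA) (sb : SoundAt b fb)
    (h : goLam F A fA fb Γ m = some r) :
    GoodResult Γ (lam A b) m r := by
  unfold goLam at h
  cases m with
  | none =>
    simp only [Option.bindRec_eq_some_iff] at h
    obtain ⟨p, hp, q, hq, h⟩ := h
    have hA := isTy_sound hF sA hΓ hp
    cases h
    have hb := (sb _ _ _ (.ctx_cons hΓ hA.typ_left) goodMode_none hq).1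
    exact ⟨.pi_intro_eq hA.typ_left hA hb, fun _ e => nomatch e⟩
  | some T =>
    simp only [Option.bindRec_eq_some_iff] at h
    obtain ⟨⟨A₁, B₁⟩, hv, h⟩ := h
    obtain ⟨hs, h⟩ := whenTrue_eq h
    simp only [Option.bindRec_eq_some_iff] at h
    obtain ⟨b', hb', h⟩ := h
    cases h
    obtain ⟨i, hT⟩ := hm T rfl
    obtain ⟨N, j, hN, hTN⟩ := viaNf_sound hF hT hv
    rw [viewPi_eq hN] at hTN
    obtain ⟨l, hA₁, hB₁⟩ := Deriv.pi_gen hTN.typ_right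
    obtain ⟨n, hAA⟩ := sameTy_sound hF hA₁ hs
    have hb := check_sound sb hB₁ hb'
    have h₁ : Deriv (.eq Γ (lam A b) (lam A₁ b') T) :=
      ((Deriv.lam_domain hA₁ hAA hb.typ_left).eq_symm.eq_trans
        (.pi_intro_eq hA₁ (.eq_refl hA₁) hb)).eq_conv hTN.eq_symm
    obtain ⟨n', hA₁'⟩ : ∃ n', Deriv (.eq Γ A₁ ((isTy F fA Γ).elim A Prod.snd) (univ n')) := by
      cases hp : isTy F fA Γ with
      | none => exact ⟨n, hAA⟩
      | some p =>
        exact ⟨_, (Deriv.cumul_eq_le (le_max_left n p.1) hAA).eq_trans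
          (Deriv.cumul_eq_le (le_max_right n p.1) (isTy_sound hF sA hΓ hp))⟩
    exact ⟨h₁.eq_trans (eta_sound hF hA₁' hb.typ_right hTN), fun _ e => Option.some.inj e⟩

theorem beta_sound (hf : Deriv (.eq Γ f f' (pi A B))) (ha : Deriv (.eq Γ a a' A)) :
    Deriv (.eq Γ (app f a) (beta F Γ A B f' a') (B.inst a)) := by
  have h₀ := hf.pi_elim_eq ha
  obtain ⟨_, hPi⟩ := hf.typ_left.type_form
  obtain ⟨i, hA, hB⟩ := Deriv.pi_gen hPi
  unfold beta
  split
  · next A₀ b =>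
    rw [force_eq]
    cases hc : (sameTy F Γ A A₀ && ok F (A :: Γ) b B)
    · exact h₀
    · rw [Bool.and_eq_true] at hc
      obtain ⟨j, hAA⟩ := sameTy_sound hF hA hc.1
      have hb := ok_sound hF hB hc.2
      -- The annotation `A₀` is exchanged for the expected domain `A`, where `b` was rechecked and
      -- the β-rule applies.
      have h₁ := (Deriv.lam_domain hA hAA hb).eq_symm.pi_elim_eq
        (.eq_refl ha.typ_right)
      have h₂ := h₁.eq_trans (.pi_comp hA hb ha.typ_right)
      have h₃ := reduct_sound hF (Deriv.inst hb ha.typ_right)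
      have hT := Deriv.inst_congr hB ha.typ_left ha
      rw [cond_true, plug_inst, plug_inst]
      exact h₀.eq_trans ((h₂.eq_trans h₃).eq_conv hT.eq_symm)
  · exact h₀

theorem argTy_sound (hΓ : Deriv (.ctx Γ)) (sa : SoundAt a fa) (h : argTy F f fa Γ = some A) :
    ∃ i, Deriv (.typ Γ A (univ i)) := by
  unfold argTy at h
  split at h
  · rw [Option.bindRec_eq_some_iff] at h
    obtain ⟨p, hp, h⟩ := h
    cases h
    exact ⟨_, (isTy_sound hF (hF _) hΓ hp).typ_left⟩
  · rw [Option.bindRec_eq_some_iff] at h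
    obtain ⟨p, hp, h⟩ := h
    cases h
    exact (sa _ _ _ hΓ goodMode_none hp).1.typ_left.type_form

theorem goAppCheck_sound (hΓ : Deriv (.ctx Γ)) (hm : GoodMode Γ m)
    (sf : SoundAt f ff) (sa : SoundAt a fa)
    (h : goAppCheck F f a ff fa Γ m = some r) :
    GoodResult Γ (app f a) m r := by
  simp only [goAppCheck, Option.bindRec_eq_some_iff, force_eq] at h
  obtain ⟨T, rfl, A, hA, p, hp, h⟩ := h
  obtain ⟨hB, h⟩ := whenTrue_eq h
  simp only [Option.bindRec_eq_some_iff] at h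
  obtain ⟨f', hf', a', ha', h⟩ := h
  cases h
  obtain ⟨i, hA⟩ := argTy_sound hF hΓ sa hA
  have hp := (isTy_sound hF (hF _) (.ctx_cons hΓ hA) hp).typ_left
  have hf := check_sound sf (.pi_form (Deriv.cumul_le (le_max_left i p.1) hA)
    (Deriv.cumul_le (le_max_right i p.1) hp)) hf'
  have h₁ := beta_sound hF hf (check_sound sa hA ha')
  -- Nothing about `generalize` has to be proved: that `B` at `a` is `T` was tested by the
  -- procedure.
  rw [← plug_inst, beq_eq _ _ hB] at h₁
  exact ⟨h₁, fun _ e => Option.some.inj e⟩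

theorem goApp_sound (hΓ : Deriv (.ctx Γ)) (hm : GoodMode Γ m)
    (sf : SoundAt f ff) (sa : SoundAt a fa)
    (h : goApp F f a ff fa Γ m = some r) :
    GoodResult Γ (app f a) m r := by
  unfold goApp at h
  cases hp : ff Γ none with
  | none =>
    rw [hp] at h
    exact goAppCheck_sound hF hΓ hm sf sa h
  | some p =>
    rw [hp] at h
    simp only [Option.bindRec_eq_some_iff, force_eq] at h
    obtain ⟨⟨A, B⟩, hv, a', ha', h⟩ := h
    have hf := (sf _ _ _ hΓ goodMode_none hp).1
    obtain ⟨i, hT⟩ := hf.typ_left.type_form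
    obtain ⟨N, j, hN, hTN⟩ := viaNf_sound hF hT hv
    rw [viewPi_eq hN] at hTN
    obtain ⟨l, hA, hB⟩ := Deriv.pi_gen hTN.typ_right
    have ha := check_sound sa hA ha'
    refine expect_sound hF hm ?_ h
    rw [plug_inst]
    exact beta_sound hF (hf.eq_conv hTN) ha

theorem goPair_sound (hm : GoodMode Γ m)
    (sa : SoundAt a fa) (sb : SoundAt b fb)
    (h : goPair F a fa fb Γ m = some r) :
    GoodResult Γ (pair a b) m r := by
  simp only [goPair, Option.bindRec_eq_some_iff, force_eq] at h
  obtain ⟨T, rfl, ⟨A, B⟩, hv, a', ha', b', hb', h⟩ := h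
  cases h
  obtain ⟨i, hT⟩ := hm T rfl
  obtain ⟨N, j, hN, hTN⟩ := viaNf_sound hF hT hv
  rw [viewSig_eq hN] at hTN
  obtain ⟨l, hA, hB⟩ := Deriv.sig_gen hTN.typ_right
  have ha := check_sound sa hA ha'
  rw [plug_inst] at hb'
  have hb := check_sound sb (Deriv.inst hB ha.typ_left) hb'
  exact ⟨(Deriv.sig_intro_eq hA hB ha hb).eq_conv hTN.eq_symm, fun _ e => Option.some.inj e⟩

theorem sigRed_sound {g : Tm} (hA : Deriv (.typ Γ A (univ i)))
    (hB : Deriv (.typ (A :: Γ) B (univ i))) (hC : Deriv (.typ (sig A B :: Γ) C (univ j)))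
    (hg : Deriv (.typ (B :: A :: Γ) g (C.instUnder2 (pair (var 1) (var 0)))))
    (hp : Deriv (.eq Γ p p' (sig A B)))
    (ho : Deriv (.eq Γ (sigInd A B C g p) other (C.inst p))) :
    Deriv (.eq Γ (sigInd A B C g p) (sigRed F Γ A B g (C.inst p) p' other) (C.inst p)) := by
  unfold sigRed
  split
  · next a b =>
    cases hc : (ok F Γ a A && ok F Γ b (plug [a] 0 B 0))
    · exact ho
    · rw [Bool.and_eq_true, plug_inst] at hc
      have ha := ok_sound hF hA hc.1
      have hb := ok_sound hF (Deriv.inst hB ha) hc.2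
      have hT := Deriv.inst_congr hC hp.typ_left hp
      have h₁ : Deriv (.eq Γ (sigInd A B C g p) (sigInd A B C g (pair a b)) (C.inst p)) :=
        .sig_elim_eq hA hB (.eq_refl hA) (.eq_refl hB) (.eq_refl hC) (.eq_refl hg) hp
      have h₂ := (Deriv.sig_comp hA hB hC hg ha hb).eq_conv hT.eq_symm
      rw [cond_true, plug_inst2]
      exact (h₁.eq_trans h₂).eq_trans (reduct_sound hF h₂.typ_right)
  · exact ho

theorem goSigInd_sound {g : Tm} (hΓ : Deriv (.ctx Γ)) (hm : GoodMode Γ m)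
    (sA : SoundAt A fA) (sB : SoundAt B fB) (sC : SoundAt C fC) (sg : SoundAt g fg) (sp : SoundAt p
        fp)
    (h : goSigInd F A B C g p fA fB fC fg fp Γ m = some r) : GoodResult Γ (sigInd A B C g p) m r :=
        by
  simp only [goSigInd, Option.bindRec_eq_some_iff, force_eq, plug_inst,
      plug_instUnder2] at h
  obtain ⟨A', hA', B', hB', C', hC', g', hg', p', hp', h⟩ := h
  have hA := isTy_sound hF sA hΓ hA'
  have hB := isTy_sound hF sB (.ctx_cons hΓ hA.typ_left) hB'
  replace hA := Deriv.cumul_eq_le (le_max_left A'.1 B'.1) hA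
  replace hB := Deriv.cumul_eq_le (le_max_right A'.1 B'.1) hB
  have hS := Deriv.sig_form hA.typ_left hB.typ_left
  have hC := isTy_sound hF sC (.ctx_cons hΓ hS) hC'
  have hg := check_sound sg (hC.typ_left.subst_typ (.ctx_cons hB.typ_left.wf hB.typ_left)
    (Deriv.isSubst_pair hA.typ_left hB.typ_left)) hg'
  have hp := check_sound sp hS hp'
  exact expect_sound hF hm (sigRed_sound hF hA.typ_left hB.typ_left hC.typ_left hg.typ_left hp
    (.sig_elim_eq hA.typ_left hB.typ_left hA hB hC hg hp)) h

theorem goInl_sound (hm : GoodMode Γ m)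
    (sa : SoundAt a fa)
    (h : goInl F fa Γ m = some r) :
    GoodResult Γ (inl a) m r := by
  simp only [goInl, Option.bindRec_eq_some_iff] at h
  obtain ⟨T, rfl, ⟨A, B⟩, hv, a', ha', h⟩ := h
  cases h
  obtain ⟨i, hT⟩ := hm T rfl
  obtain ⟨N, j, hN, hTN⟩ := viaNf_sound hF hT hv
  rw [viewSum_eq hN] at hTN
  obtain ⟨l, hA, hB⟩ := Deriv.sum_gen hTN.typ_right
  have ha := check_sound sa hA ha'
  exact ⟨(Deriv.sum_inl_eq hA hB ha).eq_conv hTN.eq_symm, fun _ e => Option.some.inj e⟩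

theorem goInr_sound (hm : GoodMode Γ m)
    (sa : SoundAt a fa)
    (h : goInr F fa Γ m = some r) :
    GoodResult Γ (inr a) m r := by
  simp only [goInr, Option.bindRec_eq_some_iff] at h
  obtain ⟨T, rfl, ⟨A, B⟩, hv, a', ha', h⟩ := h
  cases h
  obtain ⟨i, hT⟩ := hm T rfl
  obtain ⟨N, j, hN, hTN⟩ := viaNf_sound hF hT hv
  rw [viewSum_eq hN] at hTN
  obtain ⟨l, hA, hB⟩ := Deriv.sum_gen hTN.typ_right
  have ha := check_sound sa hB ha'
  exact ⟨(Deriv.sum_inr_eq hA hB ha).eq_conv hTN.eq_symm, fun _ e => Option.some.inj e⟩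

theorem sumRed_sound {c d e e' : Tm} (hA : Deriv (.typ Γ A (univ i)))
    (hB : Deriv (.typ Γ B (univ i))) (hC : Deriv (.typ (sum A B :: Γ) C (univ j)))
    (hc : Deriv (.typ (A :: Γ) c (C.subst (scons (inl (var 0)) (fun k => var (k + 1))))))
    (hd : Deriv (.typ (B :: Γ) d (C.subst (scons (inr (var 0)) (fun k => var (k + 1))))))
    (he : Deriv (.eq Γ e e' (sum A B)))
    (ho : Deriv (.eq Γ (sumInd A B C c d e) other (C.inst e))) :
    Deriv (.eq Γ (sumInd A B C c d e) (sumRed F Γ A B c d (C.inst e) e' other) (C.inst e)) := by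
  have h₁ : Deriv (.eq Γ (sumInd A B C c d e) (sumInd A B C c d e') (C.inst e)) :=
    .sum_elim_eq hA hB (.eq_refl hA) (.eq_refl hB) (.eq_refl hC) (.eq_refl hc) (.eq_refl hd) he
  have hT := Deriv.inst_congr hC he.typ_left he
  unfold sumRed
  split
  · next a =>
    cases hk : ok F Γ a A
    · exact ho
    · have ha := ok_sound hF hA hk
      have h₂ := (Deriv.sum_comp_inl hA hB hC hc hd ha).eq_conv hT.eq_symm
      rw [cond_true, plug_inst]
      exact (h₁.eq_trans h₂).eq_trans (reduct_sound hF h₂.typ_right)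
  · next b =>
    cases hk : ok F Γ b B
    · exact ho
    · have hb := ok_sound hF hB hk
      have h₂ := (Deriv.sum_comp_inr hA hB hC hc hd hb).eq_conv hT.eq_symm
      rw [cond_true, plug_inst]
      exact (h₁.eq_trans h₂).eq_trans (reduct_sound hF h₂.typ_right)
  · exact ho

theorem goSumInd_sound {c d e : Tm} (hΓ : Deriv (.ctx Γ)) (hm : GoodMode Γ m)
    (sA : SoundAt A fA) (sB : SoundAt B fB) (sC : SoundAt C fC) (sc : SoundAt c fc) (sd : SoundAt d
        fd) (se : SoundAt e fe)
    (h : goSumInd F A B C c d e fA fB fC fc fd fe Γ m = some r) : GoodResult Γ (sumInd A B C c d e)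
        m r := by
  simp only [goSumInd, Option.bindRec_eq_some_iff, force_eq, plug_inst,
      plug_instUnder1] at h
  obtain ⟨A', hA', B', hB', C', hC', c', hc', d', hd', e', he', h⟩ := h
  have hA := Deriv.cumul_eq_le (le_max_left A'.1 B'.1) (isTy_sound hF sA hΓ hA')
  have hB := Deriv.cumul_eq_le (le_max_right A'.1 B'.1) (isTy_sound hF sB hΓ hB')
  have hS := Deriv.sum_form hA.typ_left hB.typ_left
  have hC := isTy_sound hF sC (.ctx_cons hΓ hS) hC'
  have hΓA := Deriv.ctx_cons hΓ hA.typ_left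
  have hΓB := Deriv.ctx_cons hΓ hB.typ_left
  have hc := check_sound sc (hC.typ_left.subst_typ hΓA
    (Deriv.isSubst_under (B := sum A B) hA.typ_left (.sum_inl (hA.typ_left.weaken hA.typ_left)
      (hB.typ_left.weaken hA.typ_left) hΓA.var_zero))) hc'
  have hd := check_sound sd (hC.typ_left.subst_typ hΓB
    (Deriv.isSubst_under (B := sum A B) hB.typ_left (.sum_inr (hA.typ_left.weaken hB.typ_left)
      (hB.typ_left.weaken hB.typ_left) hΓB.var_zero))) hd'
  have he := check_sound se hS he'
  exact expect_sound hF hm (sumRed_sound hF hA.typ_left hB.typ_left hC.typ_left hc.typ_left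
    hd.typ_left he (.sum_elim_eq hA.typ_left hB.typ_left hA hB hC hc hd he)) h

theorem goEmptyInd_sound (hΓ : Deriv (.ctx Γ)) (hm : GoodMode Γ m)
    (sC : SoundAt C fC) (sa : SoundAt a fa)
    (h : goEmptyInd F C a fC fa Γ m = some r) : GoodResult Γ (emptyInd C a) m r := by
  simp only [goEmptyInd, Option.bindRec_eq_some_iff, force_eq, plug_inst] at h
  obtain ⟨C', hC', a', ha', h⟩ := h
  have hE : Deriv (.typ Γ .empty (univ 0)) := .empty_form hΓ
  have hC := isTy_sound hF sC (.ctx_cons hΓ hE) hC'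
  have ha := check_sound sa hE ha'
  exact expect_sound hF hm (.empty_elim_eq hC ha) h

theorem unitRed_sound {c : Tm} (hC : Deriv (.typ (unit :: Γ) C (univ j)))
    (hc : Deriv (.typ Γ c (C.inst .star))) (ha : Deriv (.eq Γ a a' unit))
    (ho : Deriv (.eq Γ (unitInd C c a) other (C.inst a))) :
    Deriv (.eq Γ (unitInd C c a) (unitRed F Γ c (C.inst a) a' other) (C.inst a)) := by
  unfold unitRed
  split
  · have h₁ : Deriv (.eq Γ (unitInd C c a) (unitInd C c .star) (C.inst a)) :=
      .unit_elim_eq (.eq_refl hC) (.eq_refl hc) ha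
    have h₂ := (Deriv.unit_comp hC hc).eq_conv (Deriv.inst_congr hC ha.typ_left ha).eq_symm
    exact (h₁.eq_trans h₂).eq_trans (reduct_sound hF h₂.typ_right)
  · exact ho

theorem goUnitInd_sound {c : Tm} (hΓ : Deriv (.ctx Γ)) (hm : GoodMode Γ m)
    (sC : SoundAt C fC) (sc : SoundAt c fc) (sa : SoundAt a fa)
    (h : goUnitInd F C c a fC fc fa Γ m = some r) : GoodResult Γ (unitInd C c a) m r := by
  simp only [goUnitInd, Option.bindRec_eq_some_iff, force_eq, plug_inst] at h
  obtain ⟨C', hC', c', hc', a', ha', h⟩ := h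
  have hE : Deriv (.typ Γ unit (univ 0)) := .unit_form hΓ
  have hC := isTy_sound hF sC (.ctx_cons hΓ hE) hC'
  have hc := check_sound sc (Deriv.inst hC.typ_left (.unit_intro hΓ)) hc'
  have ha := check_sound sa hE ha'
  exact expect_sound hF hm (unitRed_sound hF hC.typ_left hc.typ_left ha
    (.unit_elim_eq hC hc ha)) h

theorem natRed_sound {z s n n' : Tm} (hC : Deriv (.typ (nat :: Γ) C (univ j)))
    (hz : Deriv (.typ Γ z (C.inst zero)))
    (hs : Deriv (.typ (C :: nat :: Γ) s (C.instUnder2 (succ (var 1)))))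
    (hn : Deriv (.eq Γ n n' nat))
    (ho : Deriv (.eq Γ (natInd C z s n) other (C.inst n))) :
    Deriv (.eq Γ (natInd C z s n) (natRed F Γ C z s (C.inst n) n' other) (C.inst n)) := by
  have h₁ : Deriv (.eq Γ (natInd C z s n) (natInd C z s n') (C.inst n)) :=
    .nat_elim_eq hC (.eq_refl hC) (.eq_refl hz) (.eq_refl hs) hn
  have hT := Deriv.inst_congr hC hn.typ_left hn
  unfold natRed
  split
  · have h₂ := (Deriv.nat_comp_zero hC hz hs).eq_conv hT.eq_symm
    exact (h₁.eq_trans h₂).eq_trans (reduct_sound hF h₂.typ_right)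
  · next k =>
    cases hk : ok F Γ k nat
    · exact ho
    · have h₂ := (Deriv.nat_comp_succ hC hz hs
        (ok_sound hF (.nat_form (i := 0) hn.wf_eq) hk)).eq_conv hT.eq_symm
      rw [cond_true, plug_inst2]
      exact (h₁.eq_trans h₂).eq_trans (reduct_sound hF h₂.typ_right)
  · exact ho

theorem goNatInd_sound {z s n : Tm} (hΓ : Deriv (.ctx Γ)) (hm : GoodMode Γ m)
    (sC : SoundAt C fC) (sz : SoundAt z fz) (ss : SoundAt s fs) (sn : SoundAt n fn)
    (h : goNatInd F C z s n fC fz fs fn Γ m = some r) : GoodResult Γ (natInd C z s n) m r := by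
  simp only [goNatInd, Option.bindRec_eq_some_iff, force_eq, plug_inst,
      plug_instUnder2] at h
  obtain ⟨C', hC', z', hz', s', hs', n', hn', h⟩ := h
  have hE : Deriv (.typ Γ nat (univ 0)) := .nat_form hΓ
  have hC := isTy_sound hF sC (.ctx_cons hΓ hE) hC'
  have hz := check_sound sz (Deriv.inst hC.typ_left (.nat_zero hΓ)) hz'
  have hΓC := Deriv.ctx_cons (.ctx_cons hΓ hE) hC.typ_left
  have hs := check_sound ss (hC.typ_left.subst_typ hΓC (Deriv.isSubst_succ hC.typ_left)) hs'
  have hn := check_sound sn hE hn'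
  exact expect_sound hF hm (natRed_sound hF hC.typ_left hz.typ_left hs.typ_left hn
    (.nat_elim_eq hC.typ_left hC hz hs hn)) h

theorem goSucc_sound (hΓ : Deriv (.ctx Γ)) (hm : GoodMode Γ m)
    (sa : SoundAt a fa)
    (h : goSucc F fa Γ m = some r) :
    GoodResult Γ (succ a) m r := by
  simp only [goSucc, Option.bindRec_eq_some_iff] at h
  obtain ⟨a', ha', h⟩ := h
  exact expect_sound hF hm (.nat_succ_eq (check_sound sa (.nat_form (i := 0) hΓ) ha')) h

theorem goId_sound (hΓ : Deriv (.ctx Γ)) (hm : GoodMode Γ m)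
    (sA : SoundAt A fA) (sa : SoundAt a fa) (sb : SoundAt b fb)
    (h : goId F A fA fa fb Γ m = some r) :
    GoodResult Γ (.id A a b) m r := by
  simp only [goId, Option.bindRec_eq_some_iff] at h
  obtain ⟨A', hA', a', ha', b', hb', h⟩ := h
  have hA := isTy_sound hF sA hΓ hA'
  exact expect_sound hF hm (.id_form_eq hA (check_sound sa hA.typ_left ha')
    (check_sound sb hA.typ_left hb')) h

theorem sameTm_sound (ha : Deriv (.eq Γ a a' A)) (hb : Deriv (.typ Γ b A))
    (h : sameTm F Γ A a a' b = true) :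
    Deriv (.eq Γ a b A) := by
  obtain ⟨i, hA⟩ := hb.type_form
  rw [sameTm, Bool.or_eq_true] at h
  rcases h with h | h
  · exact beq_eq _ _ h ▸ .eq_refl ha.typ_left
  · cases hx : check (F b) Γ A with
    | none => rw [hx] at h; exact absurd h Bool.false_ne_true
    | some x =>
      rw [hx] at h
      have := check_sound (hF _) hA hx
      rw [← beq_eq _ _ h] at this
      exact ha.eq_trans this.eq_symm

theorem goRefl_sound (hΓ : Deriv (.ctx Γ)) (hm : GoodMode Γ m)
    (sa : SoundAt a fa)
    (h : goRefl F a fa Γ m = some r) :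
    GoodResult Γ (.refl a) m r := by
  cases m with
  | none =>
    simp only [goRefl, Option.bindRec_eq_some_iff] at h
    obtain ⟨p, hp, h⟩ := h
    cases h
    have ha := (sa _ _ _ hΓ goodMode_none hp).1
    obtain ⟨i, hA⟩ := ha.typ_left.type_form
    exact ⟨.id_intro_eq hA ha, fun _ e => nomatch e⟩
  | some T =>
    simp only [goRefl, Option.bindRec_eq_some_iff] at h
    obtain ⟨⟨A, x, y⟩, hv, a', ha', h⟩ := h
    obtain ⟨hx, h⟩ := whenTrue_eq h
    obtain ⟨hy, h⟩ := whenTrue_eq h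
    cases h
    obtain ⟨i, hT⟩ := hm T rfl
    obtain ⟨N, j, hN, hTN⟩ := viaNf_sound hF hT hv
    rw [viewId_eq hN] at hTN
    obtain ⟨l, hA, hx', hy'⟩ := Deriv.id_gen hTN.typ_right
    have ha := check_sound sa hA ha'
    exact ⟨((Deriv.id_intro_eq hA ha).eq_conv (.id_form_eq (.eq_refl hA)
      (sameTm_sound hF ha hx' hx) (sameTm_sound hF ha hy' hy))).eq_conv hTN.eq_symm,
      fun _ e => Option.some.inj e⟩

theorem idRed_sound {c : Tm} (hA : Deriv (.typ Γ A (univ i)))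
    (hC : Deriv (.typ (.id A.wk.wk (var 1) (var 0) :: A.wk :: A :: Γ) C (univ j)))
    (hc : Deriv (.typ (A :: Γ) c
      (C.subst (scons (.refl (var 0)) (scons (var 0) (scons (var 0) (fun k => var (k + 1))))))))
    (ha : Deriv (.eq Γ a a' A)) (hb : Deriv (.eq Γ b b' A)) (hp : Deriv (.eq Γ p p' (.id A a b)))
    (ho : Deriv (.eq Γ (idInd A C c a b p) other (C.inst3 a b p))) :
    Deriv (.eq Γ (idInd A C c a b p) (idRed F Γ A c (C.inst3 a b p) a' b' p' other)
      (C.inst3 a b p)) := by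
  unfold idRed
  split
  · next q =>
    cases hk : (check (F q) Γ A).elim false (fun q' => q'.beq a' && q'.beq b')
    · exact ho
    · cases hq' : check (F q) Γ A with
      | none => rw [hq'] at hk; exact absurd hk.symm Bool.false_ne_true.symm
      | some q' =>
        rw [hq', Option.elim_some, Bool.and_eq_true] at hk
        have hq := check_sound (hF _) hA hq'
        rw [← beq_eq _ _ hk.1] at ha
        rw [← beq_eq _ _ hk.2] at hb
        -- The normal forms of `a`, `b` and `q` coincide, so both end points are convertible to `q`.
        have haq := ha.eq_trans hq.eq_symm
        have hbq := hb.eq_trans hq.eq_symm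
        have h₁ : Deriv (.eq Γ (idInd A C c a b p) (idInd A C c q q (.refl q)) (C.inst3 a b p)) :=
          .id_elim_eq hA (.eq_refl hA) (.eq_refl hC) (.eq_refl hc) haq hbq hp
        -- The computation rule has its type at `q, q, refl q`; functionality of the motive moves it
        -- to `a, b, p`.
        have hT := hC.functional (Deriv.inst3_subst ha.typ_left haq hb.typ_left hbq hp.typ_left hp)
        have h₂ := (Deriv.id_comp hA hC hc hq.typ_left).eq_conv hT.eq_symm
        rw [cond_true, plug_inst]
        exact (h₁.eq_trans h₂).eq_trans (reduct_sound hF h₂.typ_right)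
  · exact ho

theorem goIdInd_sound {c : Tm} (hΓ : Deriv (.ctx Γ)) (hm : GoodMode Γ m)
    (sA : SoundAt A fA) (sC : SoundAt C fC) (sc : SoundAt c fc) (sa : SoundAt a fa) (sb : SoundAt b
        fb) (sp : SoundAt p fp)
    (h : goIdInd F A C c a b p fA fC fc fa fb fp Γ m = some r) : GoodResult Γ (idInd A C c a b p) m
        r := by
  simp only [goIdInd, Option.bindRec_eq_some_iff, force_eq, plug_inst3, plug_instDiag,
      shift_one,
    shift_two] at h
  obtain ⟨A', hA', C', hC', c', hc', a', ha', b', hb', p', hp', h⟩ := h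
  have hA := isTy_sound hF sA hΓ hA'
  have hC := isTy_sound hF sC (.ctx_cons (.ctx_cons (.ctx_cons hΓ hA.typ_left)
    hA.typ_left.idCtx.1) hA.typ_left.idCtx.2) hC'
  have hc := check_sound sc (hC.typ_left.subst_typ (.ctx_cons hΓ hA.typ_left)
    (Deriv.isSubst_diag hA.typ_left)) hc'
  have ha := check_sound sa hA.typ_left ha'
  have hb := check_sound sb hA.typ_left hb'
  have hp := check_sound sp (.id_form hA.typ_left ha.typ_left hb.typ_left) hp'
  exact expect_sound hF hm (idRed_sound hF hA.typ_left hC.typ_left hc.typ_left ha hb hp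
    (.id_elim_eq hA.typ_left hA hC hc ha hb hp)) h

theorem goUa_sound (hΓ : Deriv (.ctx Γ)) (hm : GoodMode Γ m)
    (sA : SoundAt A fA) (sB : SoundAt B fB)
    (h : goUa F i A B fA fB Γ m = some r) :
    GoodResult Γ (ua i A B) m r := by
  simp only [goUa, Option.bindRec_eq_some_iff, force_eq] at h
  obtain ⟨A', hA', B', hB', h⟩ := h
  exact expect_sound hF hm (.univalence_eq (check_sound sA (.univ_intro hΓ) hA')
    (check_sound sB (.univ_intro hΓ) hB')) h

/-- Subterms are covered by induction on the term. Types and reducts, which need not be subterms,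
are covered by soundness of `F`. -/
theorem layer_sound : Sound (layer F) := by
  intro t
  induction t with
  | var k => exact fun _ _ _ hΓ hm h => goVar_sound hF hΓ hm h
  | univ i => exact fun _ _ _ hΓ hm h => expect_sound hF hm (.eq_refl (.univ_intro hΓ)) h
  | pi A B sA sB => exact fun _ _ _ hΓ hm h => goPi_sound hF hΓ hm sA sB h
  | lam A b sA sb => exact fun _ _ _ hΓ hm h => goLam_sound hF hΓ hm sA sb h
  | app f a sf sa => exact fun _ _ _ hΓ hm h => goApp_sound hF hΓ hm sf sa h
  | sig A B sA sB => exact fun _ _ _ hΓ hm h => goSig_sound hF hΓ hm sA sB h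
  | pair a b sa sb => exact fun _ _ _ _ hm h => goPair_sound hF hm sa sb h
  | sigInd A B C g p sA sB sC sg sp =>
    exact fun _ _ _ hΓ hm h => goSigInd_sound hF hΓ hm sA sB sC sg sp h
  | sum A B sA sB => exact fun _ _ _ hΓ hm h => goSum_sound hF hΓ hm sA sB h
  | inl a sa => exact fun _ _ _ _ hm h => goInl_sound hF hm sa h
  | inr a sa => exact fun _ _ _ _ hm h => goInr_sound hF hm sa h
  | sumInd A B C c d e sA sB sC sc sd se =>
    exact fun _ _ _ hΓ hm h => goSumInd_sound hF hΓ hm sA sB sC sc sd se h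
  | empty => exact fun _ _ _ hΓ hm h => expect_sound hF hm (.eq_refl (.empty_form hΓ)) h
  | emptyInd C a sC sa => exact fun _ _ _ hΓ hm h => goEmptyInd_sound hF hΓ hm sC sa h
  | unit => exact fun _ _ _ hΓ hm h => expect_sound hF hm (.eq_refl (.unit_form hΓ)) h
  | star => exact fun _ _ _ hΓ hm h => expect_sound hF hm (.eq_refl (.unit_intro hΓ)) h
  | unitInd C c a sC sc sa => exact fun _ _ _ hΓ hm h => goUnitInd_sound hF hΓ hm sC sc sa h
  | nat => exact fun _ _ _ hΓ hm h => expect_sound hF hm (.eq_refl (.nat_form hΓ)) h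
  | zero => exact fun _ _ _ hΓ hm h => expect_sound hF hm (.eq_refl (.nat_zero hΓ)) h
  | succ a sa => exact fun _ _ _ hΓ hm h => goSucc_sound hF hΓ hm sa h
  | natInd C z s n sC sz ss sn =>
    exact fun _ _ _ hΓ hm h => goNatInd_sound hF hΓ hm sC sz ss sn h
  | id A a b sA sa sb => exact fun _ _ _ hΓ hm h => goId_sound hF hΓ hm sA sa sb h
  | refl a sa => exact fun _ _ _ hΓ hm h => goRefl_sound hF hΓ hm sa h
  | idInd A C c a b p sA sC sc sa sb sp =>
    exact fun _ _ _ hΓ hm h => goIdInd_sound hF hΓ hm sA sC sc sa sb sp h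
  | ua i A B sA sB => exact fun _ _ _ hΓ hm h => goUa_sound hF hΓ hm sA sB h

end

end Checker

/-- The procedure with `n` layers. -/
noncomputable def run (n : ℕ) : Checker.Proc :=
  -- Descent into subterms stays within one layer, so `n` bounds only the nesting of calls on types
  -- and reducts, not the size of terms.
  Nat.rec (motive := fun _ => Checker.Proc) (fun _ _ _ => none) (fun _ F => Checker.layer F) n

theorem run_sound (n : ℕ) : Checker.Sound (run n) := by
  induction n with
  | zero => exact fun _ _ _ _ _ _ h => nomatch h
  | succ n ih => exact Checker.layer_sound ih

/-- Is `t` a term of the type `T` that may use terms of the closed types in `Δ`? -/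
noncomputable def checkIn (Δ : List Tm) (t T : Tm) : Bool :=
  force T fun T => (Checker.isTy (run 100) (run 100 T) []).isSome && force t fun t =>
    (run 100 t Δ (some T)).isSome

theorem inhab_of_checkIn {Δ : List Tm} {t T : Tm} (h : checkIn Δ t T = true)
    (hΔ : ∀ A ∈ Δ, Inhab A) : Inhab T := by
  rw [checkIn, force_eq, force_eq, Bool.and_eq_true] at h
  obtain ⟨p, hp⟩ := Option.isSome_iff_exists.1 h.1
  have hT := (Checker.isTy_sound (run_sound 100) (run_sound 100 T) .ctx_nil hp).typ_left
  exact inhab_of_lemmas hΔ hT fun hc => Checker.ok_sound (run_sound 100)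
    (hT.of_closed hc) h.2

end MLTT

namespace MLTT

/-! ## Terms with binders as functions -/

/-- Terms that depend on the number of variables in scope. -/
abbrev Src := ℕ → Tm

/-- A term together with the type that it is meant to have. -/
structure E (A : Src) where
  raw : Src

namespace Src

instance {A : Src} : CoeOut (E A) Src := ⟨E.raw⟩

/-- The variable bound when `l` variables were in scope. -/
def atLevel (l : ℕ) : Src := fun d => .var (d - (l + 1))

/-- A bound variable is remembered by its level, which does not change as further binders are
crossed. The same holds for `hyp`, with level `l` for the lemma listed as number `l`. -/
def bnd (A : Src) (d : ℕ) : E A := ⟨atLevel d⟩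

def hyp {A : Src} (l : ℕ) : E A := ⟨atLevel l⟩

/-- The index of `E` guides elaboration only, and correctness does not depend on it: the procedure
sees raw terms. Casts appear where two types agree only by conversion in the object theory, or where
the index is irrelevant. -/
def cast {A B : Src} (a : E A) : E B := ⟨a.raw⟩

def U (i : ℕ) : Src := fun _ => .univ i

def Pi (A : Src) (B : E A → Src) : Src := fun d => .pi (A d) (B (bnd A d) (d + 1))

def lam {A : Src} {B : E A → Src} (f : (x : E A) → E (B x)) : E (Pi A B) :=
  ⟨fun d => .lam (A d) ((f (bnd A d)).raw (d + 1))⟩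

def app {A : Src} {B : E A → Src} (f : E (Pi A B)) (a : E A) : E (B a) :=
  ⟨fun d => .app (f.raw d) (a.raw d)⟩

instance {A : Src} {B : E A → Src} : CoeFun (E (Pi A B)) (fun _ => (a : E A) → E (B a)) := ⟨app⟩

abbrev Fn (A B : Src) : Src := Pi A fun _ => B

infixr:25 " ⇒ " => Fn

def Sg (A : Src) (B : E A → Src) : Src := fun d => .sig (A d) (B (bnd A d) (d + 1))

def pair {A : Src} {B : E A → Src} (a : E A) (b : E (B a)) : E (Sg A B) :=
  ⟨fun d => .pair (a.raw d) (b.raw d)⟩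

def split {A : Src} {B : E A → Src} (C : E (Sg A B) → Src)
    (g : (x : E A) → (y : E (B x)) → E (C (pair x y))) (p : E (Sg A B)) : E (C p) :=
  ⟨fun d => .sigInd (A d) (B (bnd A d) (d + 1)) (C (bnd (Sg A B) d) (d + 1))
    ((g (bnd A d) (bnd (B (bnd A d)) (d + 1))).raw (d + 2)) (p.raw d)⟩

def fst {A : Src} {B : E A → Src} (p : E (Sg A B)) : E A := split (fun _ => A) (fun x _ => x) p

def snd {A : Src} {B : E A → Src} (p : E (Sg A B)) : E (B (fst p)) :=
  split (fun p => B (fst p)) (fun _ y => cast y) p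

abbrev Prd (A B : Src) : Src := Sg A fun _ => B

def Sum (A B : Src) : Src := fun d => .sum (A d) (B d)

def inl {A B : Src} (a : E A) : E (Sum A B) := ⟨fun d => .inl (a.raw d)⟩

def inr {A B : Src} (b : E B) : E (Sum A B) := ⟨fun d => .inr (b.raw d)⟩

def cases {A B : Src} (C : E (Sum A B) → Src) (f : (x : E A) → E (C (inl x)))
    (g : (y : E B) → E (C (inr y))) (e : E (Sum A B)) : E (C e) :=
  ⟨fun d => .sumInd (A d) (B d) (C (bnd (Sum A B) d) (d + 1)) ((f (bnd A d)).raw (d + 1))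
    ((g (bnd B d)).raw (d + 1)) (e.raw d)⟩

def Empty : Src := fun _ => .empty

def absurd (C : Src) (e : E Empty) : E C := ⟨fun d => .emptyInd (C (d + 1)) (e.raw d)⟩

def One : Src := fun _ => .unit

def star : E One := ⟨fun _ => .star⟩

def oneInd (C : E One → Src) (c : E (C star)) (e : E One) : E (C e) :=
  ⟨fun d => .unitInd (C (bnd One d) (d + 1)) (c.raw d) (e.raw d)⟩

def Id {A : Src} (x y : E A) : Src := fun d => .id (A d) (x.raw d) (y.raw d)

def refl {A : Src} (x : E A) : E (Id x x) := ⟨fun d => .refl (x.raw d)⟩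

def J {A : Src} (C : (x y : E A) → E (Id x y) → Src) (c : (x : E A) → E (C x x (refl x)))
    {a b : E A} (p : E (Id a b)) : E (C a b p) :=
  ⟨fun d => .idInd (A d)
    (C (bnd A d) (bnd A (d + 1)) (bnd (Id (bnd A d) (bnd A (d + 1))) (d + 2)) (d + 3))
    ((c (bnd A d)).raw (d + 1)) (a.raw d) (b.raw d) (p.raw d)⟩

def N : Src := fun _ => .nat

def Z : E N := ⟨fun _ => .zero⟩

def S (n : E N) : E N := ⟨fun d => .succ (n.raw d)⟩

def natRec (C : E N → Src) (z : E (C Z)) (s : (n : E N) → E (C n) → E (C (S n))) (n : E N) :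
    E (C n) :=
  ⟨fun d => .natInd (C (bnd N d) (d + 1)) (z.raw d)
    ((s (bnd N d) (bnd (C (bnd N d)) (d + 1))).raw (d + 2)) (n.raw d)⟩

def asTy {i : ℕ} (A : Src) : E (U i) := ⟨A⟩

/-- The application of `h` to several arguments. -/
def call {X Y : Src} (h : E X) (l : List Src) : E Y :=
  ⟨fun d => l.foldl (fun f a => .app f (a d)) (h.raw d)⟩

/-! ### Identity types and transport -/

def tr {A : Src} (P : E A → Src) {x y : E A} (p : E (Id x y)) (u : E (P x)) : E (P y) :=
  app (J (fun x y _ => P x ⇒ P y) (fun _ => lam fun u => u) p) u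

def sym {A : Src} {x y : E A} (p : E (Id x y)) : E (Id y x) :=
  J (fun x y _ => Id y x) (fun x => refl x) p

/-- Recursion is on the second path, so `trans p (refl y)` reduces to `p`, while the left unit law
needs a proof (`idLeft`). -/
def trans {A : Src} {x y z : E A} (p : E (Id x y)) (q : E (Id y z)) : E (Id x z) :=
  tr (fun w => Id x w) q p

def ap {A B : Src} (f : E A → E B) {x y : E A} (p : E (Id x y)) : E (Id (f x) (f y)) :=
  J (fun x y _ => Id (f x) (f y)) (fun x => refl (f x)) p

/-! ### Truncation levels, loop spaces and equivalences -/

abbrev Contr (A : Src) : Src := Sg A fun a => Pi A fun x => Id a x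

/-- `A` has h-level `k`; here `A` is a type of the universe `U i`. -/
def HL (i : ℕ) (k : E N) (A : Src) : Src :=
  app (natRec (fun _ => U i ⇒ U i) (lam fun A => asTy (Contr A))
    (fun _ P => lam fun A => asTy (Pi A fun x => Pi A fun y => app P (asTy (Id x y)))) k) (asTy A)

abbrev HLS (i : ℕ) (k : E N) (A : Src) : Src := Pi A fun x => Pi A fun y => HL i k (Id x y)

/-- The underlying type of the `j`-fold loop space. -/
def Om (i : ℕ) (j : E N) (A : Src) (a : E A) : Src :=
  app (app (B := fun A => A.raw ⇒ U i) (natRec (fun _ => Pi (U i) fun A => A ⇒ U i)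
    (lam fun A => lam fun _ => A)
    (fun _ F => lam fun _ => lam fun a =>
      app (app (B := fun A => A.raw ⇒ U i) F (asTy (Id a a))) (cast (refl a))) j) (asTy A)) (cast a)

/-- The base point of the `j`-fold loop space. -/
def pt (i : ℕ) (j : E N) (A : Src) (a : E A) : E (Om i j A a) :=
  cast (app (app (B := fun A => Pi A fun a => Om i j A a)
    (natRec (fun j => Pi (U i) fun A => Pi A fun a => Om i j A a)
      (lam fun _ => lam fun a => cast a)
      (fun _ f => lam fun _ => lam fun a =>
        cast (app (app f (asTy (Id a a))) (cast (refl a)))) j) (asTy A)) (cast a))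

def IsEq (A B : Src) (f : E (A ⇒ B)) : Src :=
  Prd (Sg (B ⇒ A) fun g => Pi B fun y => Id (f (g y)) y)
    (Sg (B ⇒ A) fun h => Pi A fun x => Id (h (f x)) x)

def Eqv (A B : Src) : Src := Sg (A ⇒ B) fun f => IsEq A B f

def idEqv (A : Src) : E (Eqv A A) :=
  let h : E (Sg (A ⇒ A) fun g => Pi A fun y => Id (app g y) y) :=
    pair (lam fun x => x) (lam fun x => cast (refl x))
  pair (lam fun x => x) (cast (pair (B := fun _ => Sg (A ⇒ A) fun g => Pi A fun y => Id (app g y)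
      y) h h))

def idToEqv (i : ℕ) (A B : E (U i)) : E (Id A B ⇒ Eqv A B) :=
  lam fun p => J (fun A B _ => Eqv A B) (fun A => idEqv A) p

def ua (i : ℕ) (A B : E (U i)) : E (IsEq (Id A B) (Eqv A B) (idToEqv i A B)) :=
  ⟨fun d => .ua i (A.raw d) (B.raw d)⟩

/-- The path that corresponds to an equivalence of types. -/
def eqvToId (i : ℕ) (A B : E (U i)) (e : E (Eqv A B)) : E (Id A B) :=
  split (A := Eqv A B ⇒ Id A B)
    (B := fun g => Pi (Eqv A B) fun y => Id (app (idToEqv i A B) (g y)) y) (fun _ => Id A B)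
    (fun g _ => app g e)
    (split (A := Sg (Eqv A B ⇒ Id A B) fun g => Pi (Eqv A B) fun y => Id (app (idToEqv i A B) (g
        y)) y)
      (B := fun _ => Sg (Eqv A B ⇒ Id A B) fun h => Pi (Id A B) fun x => Id (h (app (idToEqv i A B)
          x)) x)
      (fun _ => Sg (Eqv A B ⇒ Id A B) fun g => Pi (Eqv A B) fun y => Id (app (idToEqv i A B) (g y))
          y)
      (fun u _ => u) (ua i A B))

/-! ### Inhabited types -/

/-- The closed type `T` is inhabited. -/
def Holds (T : Src) : Prop := Inhab (T 0)

namespace Holds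

variable {T D₀ D₁ D₂ D₃ D₄ D₅ D₆ D₇ : Src}

theorem of₀ (t : E T) (h : checkIn [] (t.raw 0) (T 0) = true) : Holds T :=
  inhab_of_checkIn h (by simp)

theorem of₁ (h₀ : Holds D₀) (t : E D₀ → E T)
    (h : checkIn [D₀ 0] ((t (hyp 0)).raw 1) (T 0) = true) : Holds T :=
  inhab_of_checkIn h (by simpa [Holds] using h₀)

theorem of₂ (h₀ : Holds D₀) (h₁ : Holds D₁) (t : E D₀ → E D₁ → E T)
    (h : checkIn [D₁ 0, D₀ 0] ((t (hyp 0) (hyp 1)).raw 2) (T 0) = true) : Holds T :=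
  inhab_of_checkIn h (by simpa [Holds] using ⟨h₁, h₀⟩)

theorem of₃ (h₀ : Holds D₀) (h₁ : Holds D₁) (h₂ : Holds D₂) (t : E D₀ → E D₁ → E D₂ → E T)
    (h : checkIn [D₂ 0, D₁ 0, D₀ 0] ((t (hyp 0) (hyp 1) (hyp 2)).raw 3) (T 0) = true) :
    Holds T :=
  inhab_of_checkIn h (by simpa [Holds] using ⟨h₂, h₁, h₀⟩)

theorem of₄ (h₀ : Holds D₀) (h₁ : Holds D₁) (h₂ : Holds D₂) (h₃ : Holds D₃)
    (t : E D₀ → E D₁ → E D₂ → E D₃ → E T)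
    (h : checkIn [D₃ 0, D₂ 0, D₁ 0, D₀ 0] ((t (hyp 0) (hyp 1) (hyp 2) (hyp 3)).raw 4) (T 0) =
      true) : Holds T :=
  inhab_of_checkIn h (by simpa [Holds] using ⟨h₃, h₂, h₁, h₀⟩)

theorem of₅ (h₀ : Holds D₀) (h₁ : Holds D₁) (h₂ : Holds D₂) (h₃ : Holds D₃) (h₄ : Holds D₄)
    (t : E D₀ → E D₁ → E D₂ → E D₃ → E D₄ → E T)
    (h : checkIn [D₄ 0, D₃ 0, D₂ 0, D₁ 0, D₀ 0]
      ((t (hyp 0) (hyp 1) (hyp 2) (hyp 3) (hyp 4)).raw 5) (T 0) = true) : Holds T :=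
  inhab_of_checkIn h (by simpa [Holds] using ⟨h₄, h₃, h₂, h₁, h₀⟩)

theorem of₆ (h₀ : Holds D₀) (h₁ : Holds D₁) (h₂ : Holds D₂) (h₃ : Holds D₃) (h₄ : Holds D₄)
    (h₅ : Holds D₅) (t : E D₀ → E D₁ → E D₂ → E D₃ → E D₄ → E D₅ → E T)
    (h : checkIn [D₅ 0, D₄ 0, D₃ 0, D₂ 0, D₁ 0, D₀ 0]
      ((t (hyp 0) (hyp 1) (hyp 2) (hyp 3) (hyp 4) (hyp 5)).raw 6) (T 0) = true) : Holds T :=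
  inhab_of_checkIn h (by simpa [Holds] using ⟨h₅, h₄, h₃, h₂, h₁, h₀⟩)

/-- Reduces a statement uniform in the universe level to level `0`, where a single evaluation
suffices. The equation `e` holds by `rfl` in every use. -/
theorem shift (i : ℕ) (T : ℕ → Src) (h : Holds (T 0)) (e : (T 0 0).lift i = T i 0) :
    Holds (T i) :=
  (congrArg Inhab e).mp (Inhab.lift i h)

end Holds

/-! ### Elementary facts on truncation levels -/

set_option maxRecDepth 100000

/-- The inverse of a path is a left inverse. -/
abbrev symTransTy (i : ℕ) : Src := Pi (U i) fun A => Pi A fun x => Pi A fun y => Pi (Id x y) fun p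
    =>
  Id (trans (sym p) p) (refl y)

theorem symTrans (i : ℕ) : Holds (symTransTy i) := .shift i _ (.of₀
  (lam fun _ => lam fun _ => lam fun _ => lam fun p =>
    J (fun _ y p => Id (trans (sym p) p) (refl y)) (fun x => cast (refl (refl x))) p)
  (by decide +kernel)) rfl

/-- The identity types of a contractible type are contractible. -/
abbrev contrPathsTy (i : ℕ) : Src := Pi (U i) fun A => Contr A ⇒ Pi A fun x => Pi A fun y =>
  Contr (Id x y)

/-- The path through the centre equals every other path by path induction: at `refl` it has the form
`trans (sym p) p`. -/
theorem contrPaths (i : ℕ) : Holds (contrPathsTy i) := .shift i _ (.of₁ (symTrans 0) (fun st =>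
  lam fun A => lam fun c => lam fun x => lam fun y =>
    let h := fun x y => trans (sym (snd c x)) (snd c y)
    pair (h x y) (lam fun p => J (fun x y p => Id (h x y) p)
      (fun x => st A (fst c) x (snd c x)) p)) (by decide +kernel)) rfl

/-- The h-levels are cumulative. -/
abbrev cumulTy (i : ℕ) : Src := Pi N fun k => Pi (U i) fun A => HL i k A ⇒ HL i (S k) A

theorem cumul (i : ℕ) : Holds (cumulTy i) := .shift i _ (.of₁ (contrPaths 0) (fun cp =>
  lam fun k => natRec (fun k => Pi (U 0) fun A => HL 0 k A ⇒ HL 0 (S k) A)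
    (lam fun A => lam fun h => cast (lam fun x => lam fun y => cp A (cast h) x y))
    (fun k ih => lam fun A => lam fun h => cast (lam fun x => lam fun y =>
      ih (asTy (Id x y)) (app (app (cast (B := HLS 0 k A) h) x) y))) k) (by decide +kernel)) rfl

/-- The identity types of a retract of `B` are retracts of identity types of `B`. -/
abbrev retrPathsTy (i : ℕ) : Src := Pi (U i) fun A => Pi (U i) fun B => Pi (A ⇒ B) fun s =>
  Pi (B ⇒ A) fun r => (Pi A fun x => Id (r (s x)) x) ⇒ Pi A fun x => Pi A fun y =>
    Sg (Id (s x) (s y) ⇒ Id x y) fun r' => Pi (Id x y) fun p => Id (r' (ap s p)) p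

/-- A path `q` is sent to `ap r q` conjugated by the homotopy from `r ∘ s` to the identity. At
`refl` this reduces to `trans (sym p) p`. -/
theorem retrPaths (i : ℕ) : Holds (retrPathsTy i) := .shift i _ (.of₁ (symTrans 0) (fun st =>
  lam fun A => lam fun B => lam fun s => lam fun r => lam fun e => lam fun x => lam fun y =>
    let r' := fun {x y} q => trans (trans (sym (e x)) (ap r q)) (e y)
    pair (lam fun q => r' q) (lam fun p => cast (J (fun _ _ p => Id (r' (ap s p)) p)
      (fun x => cast (st A (app r (app s x)) x (app e x))) p))) (by decide +kernel)) rfl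

/-- A retract of a type of h-level `k` has h-level `k`. -/
abbrev hlRetrTy (i : ℕ) : Src := Pi N fun k => Pi (U i) fun A => Pi (U i) fun B =>
  Pi (A ⇒ B) fun s => Pi (B ⇒ A) fun r => (Pi A fun x => Id (r (s x)) x) ⇒
  HL i k B ⇒ HL i k A

theorem hlRetr (i : ℕ) : Holds (hlRetrTy i) := .shift i _ (.of₁ (retrPaths 0) (fun rp =>
  lam fun k => natRec (fun k => Pi (U 0) fun A => Pi (U 0) fun B => Pi (A ⇒ B) fun s =>
      Pi (B ⇒ A) fun r => (Pi A fun x => Id (r (s x)) x) ⇒ HL 0 k B ⇒ HL 0 k A)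
    (lam fun A => lam fun B => lam fun s => lam fun r => lam fun e => lam fun c =>
      split (A := B) (B := fun b => Pi B fun y => Id b y) (fun _ => HL 0 Z A)
        (fun b h => cast (pair (A := A) (B := fun a => Pi A fun x => Id a x) (r b)
          (lam fun x => trans (ap r (h (s x))) (cast (app e x))))) (cast c))
    (fun k ih => lam fun A => lam fun B => lam fun s => lam fun r => lam fun e => lam fun h =>
      cast (lam fun x => lam fun y =>
        split (fun _ => HL 0 k (Id x y)) (fun r' e' => cast (ih (asTy (Id x y)) (asTy (Id (s x) (s
            y)))
          (lam fun p => ap s p) (cast r') (cast e') (app (app (cast (B := HLS 0 k B) h) (s x)) (s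
              y))))
          (app (app (app (app (app (app (app rp A) B) s) r) (cast e)) x) y))) k)
  (by decide +kernel)) rfl

/-! ### Universe levels and dependent pairs -/

/-- The h-level of `A` in a universe is one in the next universe. -/
abbrev hlUpTy (i : ℕ) : Src := Pi N fun k => Pi (U i) fun A => HL i k A ⇒ HL (i + 1) k A

/-- For variable `k` the two sides are recursions into different universes and are not convertible,
although they unfold alike. Hence the induction on `k`, here and in `hlDown`. -/
theorem hlUp (i : ℕ) : Holds (hlUpTy i) := .shift i _ (.of₀
  (lam fun k => natRec (fun k => Pi (U 0) fun A => HL 0 k A ⇒ HL 1 k A)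
    (lam fun A => lam fun h => cast h)
    (fun k ih => lam fun A => lam fun h => cast (lam fun x => lam fun y =>
      ih (asTy (Id x y)) (app (app (cast (B := HLS 0 k A) h) x) y))) k) (by decide +kernel)) rfl

/-- The h-level of `A : U i` may be computed in the next universe. -/
abbrev hlDownTy (i : ℕ) : Src := Pi N fun k => Pi (U i) fun A => HL (i + 1) k A ⇒ HL i k A

theorem hlDown (i : ℕ) : Holds (hlDownTy i) := .shift i _ (.of₀
  (lam fun k => natRec (fun k => Pi (U 0) fun A => HL 1 k A ⇒ HL 0 k A)
    (lam fun A => lam fun h => cast h)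
    (fun k ih => lam fun A => lam fun h => cast (lam fun x => lam fun y =>
      ih (asTy (Id x y)) (app (app (cast (B := HLS 1 k A) h) x) y))) k) (by decide +kernel)) rfl

/-- A contractible type has every h-level. -/
abbrev contrHLTy (i : ℕ) : Src := Pi N fun k => Pi (U i) fun A => Contr A ⇒ HL i k A

theorem contrHL (i : ℕ) : Holds (contrHLTy i) := .shift i _ (.of₁ (cumul 0) (fun cu =>
  lam fun k => natRec (fun k => Pi (U 0) fun A => Contr A ⇒ HL 0 k A)
    (lam fun A => lam fun h => cast h)
    (fun k ih => lam fun A => lam fun h => cu k A (ih A h)) k) (by decide +kernel)) rfl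

/-- A path in a type of dependent pairs. -/
def pairEq {A : Src} (B : E A → Src) {a a' : E A} (p : E (Id a a')) {b : E (B a)} {b' : E (B a')}
    (q : E (Id (tr B p b) b')) : E (Id (pair (B := B) a b) (pair a' b')) :=
  app (app (app (J (fun a a' p => Pi (B a) fun b => Pi (B a') fun b' =>
      Id (tr B p b) b' ⇒ Id (pair (B := B) a b) (pair a' b'))
    (fun a => lam fun _ => lam fun _ => lam fun q =>
      cast (J (fun b b' _ => Id (pair (B := B) a b) (pair a b')) (fun b => refl (pair a b)) q)) p)
    b) b') q

/-- Pairs of paths that join the components of `u` and `v`. -/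
abbrev SigPath {A : Src} (B : E A → Src) (u v : E (Sg A B)) : Src :=
  Sg (Id (fst u) (fst v)) fun p => Id (tr B p (snd u)) (snd v)

/-- The pair of paths given by a path. -/
def sigPath {A : Src} (B : E A → Src) {u v : E (Sg A B)} (p : E (Id u v)) : E (SigPath B u v) :=
  J (fun u v _ => SigPath B u v)
    (fun u => pair (refl (fst u)) (cast (refl (snd u)))) p

/-- The path given by a pair of paths. -/
def sigPathInv {A : Src} (B : E A → Src) (u v : E (Sg A B)) :
    E (Pi (Id (fst u) (fst v)) fun p => Id (tr B p (snd u)) (snd v) ⇒ Id u v) :=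
  split (fun u => Pi (Id (fst u) (fst v)) fun p => Id (tr B p (snd u)) (snd v) ⇒ Id u v)
    (fun a b => cast (split (fun v => Pi (Id a (fst v)) fun p => Id (tr B p b) (snd v) ⇒
        Id (pair a b) v)
      (fun a' b' => cast (lam (A := Id a a') fun p =>
        lam (A := Id (tr B p b) b') fun q => pairEq B p q)) v)) u

/-- The identity types of a type of dependent pairs are retracts of types of pairs of paths. -/
abbrev sigPathsTy (i : ℕ) : Src := Pi (U i) fun A => Pi (A ⇒ U i) fun B =>
  Pi (Sg A fun a => B a) fun u => Pi (Sg A fun a => B a) fun v =>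
  Sg (SigPath (fun a => B a) u v ⇒ Id u v) fun r =>
    Pi (Id u v) fun p => Id (r (sigPath (fun a => B a) p)) p

theorem sigPaths (i : ℕ) : Holds (sigPathsTy i) := .shift i _ (.of₀
  (lam fun A => lam fun B => lam fun u => lam fun v =>
    let r := fun u v => lam (A := SigPath (fun a => B a) u v) (B := fun _ => Id u v)
      fun w => split (fun _ => Id u v) (fun p q => app (app (sigPathInv (fun a => B a) u v) p) q) w
    pair (r u v) (lam fun p => J (fun u v p => Id (r u v (sigPath (fun a => B a) p)) p)
      (fun u => split (fun u => Id (r u u (sigPath (fun a => B a) (refl u))) (refl u))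
        (fun a b => cast (refl (refl (pair (B := fun a => B a) a b)))) u) p))
  (by decide +kernel)) rfl

/-- The h-levels are closed under dependent pairs. -/
abbrev hlSigTy (i : ℕ) : Src := Pi N fun k => Pi (U i) fun A => Pi (A ⇒ U i) fun B =>
  HL i k A ⇒ (Pi A fun a => HL i k (B a)) ⇒ HL i k (Sg A fun a => B a)

theorem hlSig (i : ℕ) : Holds (hlSigTy i) := .shift i _
  (.of₃ (contrPaths 0) (sigPaths 0) (hlRetr 0) (fun cp sp hr =>
  lam fun k => natRec (fun k => Pi (U 0) fun A => Pi (A ⇒ U 0) fun B =>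
      HL 0 k A ⇒ (Pi A fun a => HL 0 k (B a)) ⇒ HL 0 k (Sg A fun a => B a))
    (lam fun A => lam fun B => lam fun hA => lam fun hB =>
      split (A := A) (B := fun a => Pi A fun x => Id a x) (fun _ => HL 0 Z (Sg A fun a => B a))
        (fun a c => cast (pair (A := Sg A fun a => B a)
            (B := fun u => Pi (Sg A fun a => B a) fun v => Id u v)
          (pair a (fst (cast (B := Contr (B a)) (hB a))))
          (lam fun v => split (B := fun a => B a)
            (fun v => Id (pair (B := fun a => B a) a (fst (cast (B := Contr (B a)) (hB a)))) v)
            (fun a' b' => pairEq (fun a => B a) (c a')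
              (fst (cp (B a') (cast (hB a')) (tr (fun a => B a) (c a')
                (fst (cast (B := Contr (B a)) (hB a)))) b'))) v))) (cast hA))
    (fun k ih => lam fun A => lam fun B => lam fun hA => lam fun hB =>
      cast (lam fun u => lam fun v => split (fun _ => HL 0 k (Id u v)) (fun r e =>
        cast (hr k (asTy (Id u v)) (asTy (SigPath (fun a => B a) u v))
          (lam fun p => sigPath (fun a => B a) p) (cast r) (cast e)
          (cast (ih (asTy (Id (fst u) (fst v)))
            (lam fun p => asTy (Id (tr (fun a => B a) (cast p) (snd u)) (snd v)))
            (app (app (cast (B := HLS 0 k A) hA) (fst u)) (fst v))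
            (lam fun p => cast (app (app (cast (B := HLS 0 k (B (fst v))) (hB (fst v)))
              (tr (fun a => B a) (cast p) (snd u))) (snd v)))))))
        (app (app (app (app sp A) B) u) v))) k) (by decide +kernel)) rfl

/-! ### Univalence and function extensionality -/

/-- A function with an inverse on both sides is an equivalence. -/
def mkIsEq {A B : Src} (f : E (A ⇒ B)) (g : E B → E A) (ε : (y : E B) → E (Id (f (g y)) y))
    (η : (x : E A) → E (Id (g (f x)) x)) : E (IsEq A B f) :=
  let u : E (Sg (B ⇒ A) fun g => Pi B fun y => Id (f (g y)) y) :=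
    pair (lam fun y => g y) (lam fun y => cast (ε y))
  let v : E (Sg (B ⇒ A) fun h => Pi A fun x => Id (h (f x)) x) :=
    pair (lam fun y => g y) (lam fun x => cast (η x))
  pair (B := fun _ => Sg (B ⇒ A) fun h => Pi A fun x => Id (h (f x)) x) u v

/-- Equivalence induction: what holds for identity functions holds for all equivalences. -/
abbrev equivIndTy (i : ℕ) : Src :=
  Pi (Pi (U i) fun A => Pi (U i) fun B => (A ⇒ B) ⇒ U (i + 1)) fun P =>
  (Pi (U i) fun A => app (app (app P A) A) (lam (A := A) fun x => cast x)) ⇒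
  Pi (U i) fun A => Pi (U i) fun B => Pi (A ⇒ B) fun f => IsEq A B f ⇒ app (app (app P A) B) (cast
      f)

/-- By the right inverse contained in univalence, an equivalence is identified with the image of a
path between types, and for such images path induction applies. -/
theorem equivInd (i : ℕ) : Holds (equivIndTy i) := .shift i _ (.of₀
  (lam fun P => lam fun b => lam fun A => lam fun B => lam fun f => lam fun h =>
    let e : E (Eqv A B) := pair f h
    split (A := Sg (Eqv A B ⇒ Id A B) fun g => Pi (Eqv A B) fun y => Id (app (idToEqv 0 A B) (g y))
        y)
      (B := fun _ => Sg (Eqv A B ⇒ Id A B) fun g => Pi (Id A B) fun y => Id (g (app (idToEqv 0 A B)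
          y)) y)
      (fun _ => app (app (app P A) B) (cast f))
      (fun u _ => split (A := Eqv A B ⇒ Id A B)
          (B := fun g => Pi (Eqv A B) fun y => Id (app (idToEqv 0 A B) (g y)) y)
          (fun _ => app (app (app P A) B) (cast f)) (fun g ε =>
        cast (tr (fun e : E (Eqv A B) => app (app (app P A) B) (cast (fst e))) (app ε e)
          (J (fun A B p => app (app (app P A) B) (cast (fst (cast (B := Eqv A B) (app (idToEqv 0 A
              B) p)))))
            (fun A => cast (app b A)) (app g e)))) u) (ua 0 A B))
  (by decide +kernel)) rfl

/-- Pairs of points of `A` joined by a path. -/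
abbrev PathSpace (A : Src) : Src := Sg A fun x => Sg A fun y => Id x y

/-- A path as a point of the path space. -/
def path {A : Src} {x y : E A} (p : E (Id x y)) : E (PathSpace A) :=
  pair x (pair (B := fun y => Id x y) y p)

/-- The map that sends `x` to the constant path at `x` is an equivalence. -/
abbrev diagEqTy (i : ℕ) : Src := Pi (U i) fun A =>
  IsEq A (PathSpace A) (lam (A := A) fun x => path (refl x))

theorem diagEq (i : ℕ) : Holds (diagEqTy i) := .shift i _ (.of₀
  (lam fun A => mkIsEq (lam (A := A) fun x => path (refl x)) (fun t => fst t)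
      (fun t => cast (split (B := fun x => Sg A fun y => Id x y) (fun t => Id (path (refl (fst t)))
          t)
        (fun x w => cast (split (B := fun y => Id x y) (fun w => Id (path (refl x)) (pair (B := fun
            x => Sg A fun y => Id x y) x w))
          (fun y p => J (fun x y p => Id (path (refl x)) (path p))
            (fun x => refl (path (refl x))) p) w)) t))
      (fun x => cast (refl x))) (by decide +kernel)) rfl

/-- Equivalences are epimorphisms. -/
abbrev cancelEquivTy (i : ℕ) : Src := Pi (U i) fun C => Pi (U i) fun A => Pi (U i) fun B =>
  Pi (A ⇒ B) fun f => IsEq A B f ⇒ Pi (B ⇒ C) fun u => Pi (B ⇒ C) fun v =>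
    Id (lam (A := A) fun x => u (f x)) (lam (A := A) fun x => v (f x)) ⇒ Id u v

/-- Equivalence induction reduces to the identity function, where precomposition does nothing by
judgmental η. -/
theorem cancelEquiv (i : ℕ) : Holds (cancelEquivTy i) := .shift i _ (.of₁ (equivInd 0) (fun ei =>
  lam fun C => lam fun A => lam fun B => lam fun f => lam fun e =>
   cast (app (app (app (app (app (app ei
          (lam fun X => lam fun Y => lam (A := X ⇒ Y) fun f => asTy (Pi (Y ⇒ C) fun u =>
              Pi (Y ⇒ C) fun v =>
            Id (lam (A := X) fun x => u (app f x)) (lam (A := X) fun x => v (app f x)) ⇒ Id u v)))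
          (lam fun X => cast (lam (A := X ⇒ C) fun u => lam (A := X ⇒ C) fun v => lam (A := Id u v)
              fun p => p)))
          A) B) f) (cast e))) (by decide +kernel)) rfl

/-- Homotopic non-dependent functions are equal. -/
abbrev naiveFunextTy (i : ℕ) : Src := Pi (U i) fun A => Pi (U i) fun B =>
  Pi (A ⇒ B) fun f => Pi (A ⇒ B) fun g => (Pi A fun x => Id (f x) (g x)) ⇒ Id f g

/-- The two end point maps `PathSpace B → B` agree after composition with the diagonal, which is an
equivalence, so they are equal. Precomposition with `x ↦ h x` gives `f = g`. -/
theorem naiveFunext (i : ℕ) : Holds (naiveFunextTy i) := .shift i _ (.of₂ (diagEq 0) (cancelEquiv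
    0) (fun dq ce =>
  lam fun A => lam fun B => lam fun f => lam fun g => lam fun h =>
    cast (ap (A := PathSpace B ⇒ B) (fun u => lam (A := A) fun x => u (path (h x)))
      (app (app (app (app (app (app (app (app ce B) B) (asTy (PathSpace B))) (cast (lam (A := B)
          fun x => path (refl x))))
        (cast (app dq B))) (lam (A := PathSpace B) fun t => fst t)) (lam (A := PathSpace B) fun t
            => fst (snd t)))
        (cast (refl (lam (A := B) fun x => x)))))) (by decide +kernel)) rfl

/-- A product of contractible types is contractible. -/
abbrev weakFunextTy (i : ℕ) : Src := Pi (U i) fun A => Pi (A ⇒ U i) fun B =>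
  (Pi A fun a => Contr (B a)) ⇒ Contr (Pi A fun a => B a)

/-- Each `B x` equals `One` by univalence, so the family `B` equals the constant one by
`naiveFunext` one universe higher. For the constant family, `naiveFunext` shows that `A ⇒ One` is
contractible. -/
theorem weakFunext (i : ℕ) : Holds (weakFunextTy i) := .shift i _ (.of₂ (naiveFunext 0)
    (naiveFunext 1) (fun nf nf' =>
  lam fun A => lam fun B => lam fun h =>
    let c : E (A ⇒ One) := lam fun _ => star
    let p (x : E A) : E (Id (A := U 0) (asTy One) (asTy (B x))) :=
      eqvToId 0 (asTy One) (asTy (B x)) (pair (lam (A := One) fun _ => fst (h x))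
          (mkIsEq _ (fun _ => star) (fun y => cast (app (snd (h x)) y))
            (fun u => cast (oneInd (fun y => Id star y) (refl star) u))))
    let q : E (Id (A := A ⇒ U 0) (lam fun _ => asTy One) B) :=
      call nf' [A, U 0, lam (A := A) fun _ => asTy (i := 0) One, B, lam (A := A) p]
    tr (fun B : E (A ⇒ U 0) => Contr (Pi A fun a => (B a))) q
      (cast (pair (A := A ⇒ One) (B := fun c => Pi (A ⇒ One) fun f => Id c f) c
        (lam fun f => call nf [A, One, c, f, lam (A := A) fun x => oneInd (fun y =>
            Id star y) (refl star) (f x)]))))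
  (by decide +kernel)) rfl

/-- If each `Σ b, C a b` is contractible, then so is the type of choice functions. -/
abbrev contrChoiceTy (i : ℕ) : Src := Pi (U i) fun A => Pi (A ⇒ U i) fun B =>
  Pi (Pi A fun a => B a ⇒ U i) fun C =>
  (Pi A fun a => Contr (Sg (B a) fun b => app (C a) b)) ⇒
    Contr (Sg (Pi A fun a => B a) fun g => Pi A fun a => app (C a) (g a))

/-- The type in question is a retract of the product of the types `Σ b, C a b`, which is
contractible by `weakFunext`. -/
theorem contrChoice (i : ℕ) : Holds (contrChoiceTy i) := .shift i _ (.of₂ (weakFunext 0) (hlRetr 0)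
    (fun wf hr =>
  lam fun A => lam fun B => lam fun C => lam fun h =>
    let Y (g : E (Pi A fun a => B a)) : Src := Pi A fun a => app (C a) (g a)
    let X : Src := Sg (Pi A fun a => B a) Y
    let D (a : E A) : Src := Sg (B a) fun b => app (C a) b
    let s (w : E X) : E (Pi A D) := lam fun a => pair (call (Y := B a) (fst w) [a]) (call (snd w)
        [a])
    let r (k : E (Pi A D)) : E X :=
      pair (B := Y) (lam fun a => fst (app (B := D) k a)) (lam fun a => cast (snd (app (B := D) k
          a)))
    call hr [Z, X, Pi A D, lam s, lam r,
      lam (A := X) fun w => split (B := Y) (fun w => Id (r (s w)) w) (fun g k => cast (refl (pair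
          (B := Y) g k))) w,
      call (Y := Contr (Pi A D)) wf [A, lam (A := A) fun a => asTy (i := 0) (D a),
          h]]) (by decide +kernel)) rfl

/-- Pointwise equality of dependent functions. -/
abbrev Homotopy {A : Src} {B : E A → Src} (f g : E (Pi A B)) : Src := Pi A fun x => Id (f x) (g x)

/-- The homotopy given by a path between functions. -/
def happly {A : Src} {B : E A → Src} {f g : E (Pi A B)} (p : E (Id f g)) : E (Homotopy f g) :=
  lam fun x => ap (A := Pi A B) (fun f => app f x) p

/-- The functions homotopic to `f` form a contractible type. -/
abbrev contrHomotopiesTy (i : ℕ) : Src := Pi (U i) fun A => Pi (A ⇒ U i) fun B =>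
  Pi (Pi A fun a => B a) fun f => Contr (Sg (Pi A fun a => B a) fun g => Homotopy f g)

theorem contrHomotopies (i : ℕ) : Holds (contrHomotopiesTy i) := .shift i _ (.of₁ (contrChoice 0)
    (fun cc =>
  lam fun A => lam fun B => lam fun f =>
    let G {a : E A} (b : E (B a)) : Src := Sg (B a) fun b' => Id b b'
    call cc [A, B, lam (A := A) fun a => lam (A := B a) fun b => asTy (i := 0) (Id (f a) b),
      lam (A := A) fun a => pair (B := fun w => Pi (G (f a)) fun v => Id w v)
        (pair (f a) (refl (f a)))
        (lam fun v => split (fun v => Id (pair (B := fun b => Id (f a) b) (f a) (refl (f a))) v)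
          (fun b p => J (fun a b p => Id (pair (B := fun b => Id a b) a (refl a)) (pair b p))
            (fun a => refl (pair (B := fun b => Id a b) a (refl a))) p) v)]) (by decide +kernel))
                rfl

/-- Induction on a contractible type from any of its points. -/
abbrev contrIndTy (i : ℕ) : Src := Pi (U i) fun X => Contr X ⇒ Pi (X ⇒ U i) fun D =>
  Pi X fun w => Pi (D w) fun u => Sg (Pi X fun v => D v) fun s => Id (s w) u

/-- Transport `u` along the chosen paths from `w`. The chosen loop at `w` is `refl` because `w = w`
is contractible. -/
theorem contrInd (i : ℕ) : Holds (contrIndTy i) := .shift i _ (.of₁ (contrPaths 0) (fun cp =>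
  lam fun X => lam fun c => lam fun D => lam fun w => lam fun u =>
    let q (v : E X) : E (Contr (Id w v)) := call cp [X, c, w, v]
    pair (lam fun v => tr (fun v => D v) (fst (q v)) u)
      (cast (ap (fun e => tr (fun v => D v) e u) (app (snd (q w)) (refl w))))) (by decide +kernel))
          rfl

/-- Function extensionality: `happly` has an inverse on both sides. -/
abbrev funextTy (i : ℕ) : Src := Pi (U i) fun A => Pi (A ⇒ U i) fun B =>
  Pi (Pi A fun a => B a) fun f => Pi (Pi A fun a => B a) fun g =>
  Sg (Homotopy f g ⇒ Id f g) fun r =>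
    Prd (Pi (Id f g) fun p => Id (r (happly p)) p) (Pi (Homotopy f g) fun h => Id (happly (r h)) h)

/-- Induction on the contractible type of functions homotopic to `f`, starting from `f` itself,
assigns to `(g, h)` a path `p` with `happly p = h`. The other composite is treated by path
induction, and there the value of the section at the starting point is needed. -/
theorem funext (i : ℕ) : Holds (funextTy i) := .shift i _ (.of₂ (contrHomotopies 0) (contrInd 0)
    (fun ch ci =>
  lam fun A => lam fun B => lam fun f => lam fun g =>
    let F : Src := Pi A fun a => B a
    let X (f : E F) : Src := Sg F fun g => Homotopy f g
    let D (f : E F) (w : E (X f)) : Src := Sg (Id f (fst w)) fun p => Id (happly p) (snd w)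
    let w₀ (f : E F) : E (X f) := pair f (lam fun x => refl (app f x))
    let d₀ (f : E F) : E (D f (w₀ f)) :=
      cast (pair (A := Id f f) (B := fun p => Id (happly p) (cast (snd (w₀ f)))) (refl f)
        (cast (refl (snd (w₀ f)))))
    let V (f : E F) (s : E (Pi (X f) (D f))) : Src := Id (s (w₀ f)) (d₀ f)
    let s (f : E F) : E (Sg (Pi (X f) (D f)) (V f)) := call ci [X f,
        call (Y := Contr (X f)) ch [A, B, f],
      lam (A := X f) fun w => asTy (i := 0) (D f w), w₀ f, d₀ f]
    let r (f g : E F) (s : E (Pi (X f) (D f))) (h : E (Homotopy f g)) : E (Id f g) := cast (fst (s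
        (pair g h)))
    let T (f g : E F) (s : E (Pi (X f) (D f))) (p : E (Id f g)) : Src := Id (r f g s (happly p)) p
    split (B := V f) (fun _ => Sg (Homotopy f g ⇒ Id f g) fun r =>
        Prd (Pi (Id f g) fun p => Id (r (happly p)) p) (Pi (Homotopy f g) fun h => Id (happly (r
            h)) h))
      (fun s e => pair (lam (r f g s)) (cast (pair (B := fun _ => Pi (Homotopy f g) fun h =>
          Id (happly (r f g s h)) h)
        (lam (A := Id f g) (B := T f g s) fun p => call (J (fun f g p => Pi (Pi (X f) (D f)) fun s
            => V f s ⇒ T f g s p)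
          (fun f => lam fun s => lam (A := V f s) fun e => cast (ap (fun u => fst u) e)) p) [s, e])
        (lam fun h => cast (snd (s (pair g h))))))) (s f)) (by decide +kernel)) rfl

/-! ### Truncation levels of function types, and properties -/

/-- The h-levels are closed under dependent products. -/
abbrev hlPiTy (i : ℕ) : Src := Pi N fun k => Pi (U i) fun A => Pi (A ⇒ U i) fun B =>
  (Pi A fun a => HL i k (B a)) ⇒ HL i k (Pi A fun a => B a)

theorem hlPi (i : ℕ) : Holds (hlPiTy i) := .shift i _ (.of₃ (weakFunext 0) (funext 0) (hlRetr 0)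
    (fun wf fe hr =>
  lam fun k => natRec (fun k => Pi (U 0) fun A => Pi (A ⇒ U 0) fun B =>
      (Pi A fun a => HL 0 k (B a)) ⇒ HL 0 k (Pi A fun a => B a))
    (lam fun A => lam fun B => lam fun h => call wf [A, B, h])
    (fun k ih => lam fun A => lam fun B => lam fun h =>
      let F : Src := Pi A fun a => B a
      cast (lam (A := F) fun f => lam (A := F) fun g =>
        split (fun _ => HL 0 k (Id f g)) (fun r e =>
            call hr [k, Id f g, Homotopy f g, lam (A := Id f g) fun p => happly p, r, fst e,
              call (Y := HL 0 k (Homotopy f g)) ih [A, lam (A := A) fun x => asTy (i := 0) (Id (f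
                  x) (g x)),
                lam (A := A) fun x => call (Y := HL 0 k (Id (f x) (g x))) h [x, f x, g x]]])
          (cast (B := Sg (Homotopy f g ⇒ Id f g) fun r =>
            Prd (Pi (Id f g) fun p => Id (r (happly p)) p) (Pi (Homotopy f g) fun h =>
                Id (happly (r h)) h))
            (app (app (app (app fe A) B) (cast f)) (cast g))))) k) (by decide +kernel)) rfl

/-- A type that is contractible as soon as it has a point is a proposition. -/
abbrev propOfTy (i : ℕ) : Src := Pi (U i) fun A => (A ⇒ Contr A) ⇒ HL i (S Z) A

theorem propOf (i : ℕ) : Holds (propOfTy i) := .shift i _ (.of₁ (contrPaths 0) (fun cp =>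
  lam fun A => lam fun h => cast (lam (A := A) fun x => lam (A := A) fun y =>
    call (Y := Contr (Id x y)) cp [A, h x, x, y])) (by decide +kernel)) rfl

/-- A proposition has every positive h-level. -/
abbrev propHLTy (i : ℕ) : Src := Pi N fun k => Pi (U i) fun A => HL i (S Z) A ⇒ HL i (S k) A

theorem propHL (i : ℕ) : Holds (propHLTy i) := .shift i _ (.of₁ (cumul 0) (fun cu =>
  lam fun k => natRec (fun k => Pi (U 0) fun A => HL 0 (S Z) A ⇒ HL 0 (S k) A)
    (lam fun A => lam fun h => h)
    (fun k ih => lam fun A => lam fun h => call cu [S k, A, call (Y := HL 0 (S k) A) ih [A, h]]) k)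
  (by decide +kernel)) rfl

/-- Being contractible is a proposition. -/
abbrev propContrTy (i : ℕ) : Src := Pi (U i) fun A => HL i (S Z) (Contr A)

theorem propContr (i : ℕ) : Holds (propContrTy i) := .shift i _
  (.of₄ (propOf 0) (hlSig 0) (hlPi 0) (contrPaths 0) (fun po hs hp cp =>
  lam fun A => call po [Contr A, lam (A := Contr A) fun c =>
    call (Y := Contr (Contr A)) hs [Z, A, lam (A := A) fun a => asTy (i := 0) (Pi A fun x =>
        Id a x), c,
      lam (A := A) fun a => call (Y := Contr (Pi A fun x => Id a x)) hp [Z, A,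
          lam (A := A) fun x => asTy (i := 0) (Id a x),
        lam (A := A) fun x => call (Y := Contr (Id a x)) cp [A, c, a,
            x]]]]) (by decide +kernel)) rfl

/-- Having h-level `k` is a proposition. -/
abbrev propIsHLTy (i : ℕ) : Src := Pi N fun k => Pi (U i) fun A => HL i (S Z) (HL i k A)

theorem propIsHL (i : ℕ) : Holds (propIsHLTy i) := .shift i _
  (.of₂ (propContr 0) (hlPi 0) (fun pc hp =>
  lam fun k => natRec (fun k => Pi (U 0) fun A => HL 0 (S Z) (HL 0 k A))
    (lam fun A => call pc [A])
    (fun k ih => lam fun A =>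
      call hp [S Z, A, lam (A := A) fun x => asTy (i := 0) (Pi A fun y => HL 0 k (Id x y)),
          lam (A := A) fun x =>
        call (Y := HL 0 (S Z) (Pi A fun y => HL 0 k (Id x y))) hp [S Z, A, lam (A := A) fun y =>
            asTy (i := 0) (HL 0 k (Id x y)),
          lam (A := A) fun y => call (Y := HL 0 (S Z) (HL 0 k (Id x y))) ih [Id x y]]]) k)
  (by decide +kernel)) rfl

/-- The functions homotopic to the identity form a contractible type. -/
abbrev contrSectionsTy (i : ℕ) : Src := Pi (U i) fun A =>
  Contr (Sg (A ⇒ A) fun g => Pi A fun y => Id (g y) y)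

theorem contrSections (i : ℕ) : Holds (contrSectionsTy i) := .shift i _ (.of₁ (contrChoice 0) (fun
    cc =>
  lam fun A =>
    let G (a : E A) : Src := Sg A fun b => Id b a
    call cc [A, lam (A := A) fun _ => A, lam (A := A) fun a => lam (A := A) fun b => asTy (i := 0)
        (Id b a),
      lam (A := A) fun a => pair (B := fun w => Pi (G a) fun v => Id w v) (pair a (refl a))
        (lam fun v => split (B := fun b => Id b a) (fun v => Id (pair (B := fun b =>
            Id b a) a (refl a)) v)
          (fun b p => J (fun b a p => Id (pair (B := fun b => Id b a) a (refl a)) (pair b p))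
            (fun a => refl (pair (B := fun b => Id b a) a (refl a))) p) v)]) (by decide +kernel))
                rfl

/-- Being an equivalence is a proposition. -/
abbrev propIsEqTy (i : ℕ) : Src := Pi (U i) fun A => Pi (U i) fun B => Pi (A ⇒ B) fun f =>
  HL i (S Z) (IsEq A B f)

/-- One may assume that `f` is an equivalence (`propOf`), then that it is the identity (`equivInd`).
In that case each half of `IsEq` is the type of functions homotopic to the identity. -/
theorem propIsEq (i : ℕ) : Holds (propIsEqTy i) := .shift i _
  (.of₄ (propOf 0) (hlSig 0) (contrSections 0) (equivInd 0) (fun po hs ci ei =>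
  lam fun A => lam fun B => lam fun f => call po [IsEq A B f, lam (A := IsEq A B f) fun e =>
    let X (A : E (U 0)) : Src := Sg (A ⇒ A) fun g => Pi A fun y => Id (g y) y
    call (Y := Contr (IsEq A B f)) ei [lam (A := U 0) fun A => lam (A := U 0) fun B => lam (A := A
        ⇒ B) fun f =>
        asTy (i := 1) (Contr (IsEq A B (cast f))),
      lam (A := U 0) fun A => call (Y := Contr (Prd (X A) (X A))) hs [Z, X A,
          lam (A := X A) fun _ => asTy (i := 0) (X A),
        call (Y := Contr (X A)) ci [A], lam (A := X A) fun _ => call (Y := Contr (X A)) ci [A]],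
      A, B, f, e]]) (by decide +kernel)) rfl

/-- The equivalences to a type of positive h-level form a type of that h-level. -/
abbrev hlEqvTy (i : ℕ) : Src := Pi N fun k => Pi (U i) fun A => Pi (U i) fun B =>
  HL i (S k) B ⇒ HL i (S k) (Eqv A B)

/-- The h-level must be positive, as `IsEq` is only a proposition: for contractible `B` and empty
`A` there is no equivalence. -/
theorem hlEqv (i : ℕ) : Holds (hlEqvTy i) := .shift i _
  (.of₄ (propIsEq 0) (hlSig 0) (hlPi 0) (propHL 0) (fun pe hs hp ph =>
  lam fun k => lam fun A => lam fun B => lam fun h =>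
    call hs [S k, A ⇒ B, lam (A := A ⇒ B) fun f => asTy (i := 0) (IsEq A B f),
      call (Y := HL 0 (S k) (A ⇒ B)) hp [S k, A, lam (A := A) fun _ => B, lam (A := A) fun _ => h],
      lam (A := A ⇒ B) fun f => call (Y := HL 0 (S k) (IsEq A B f)) ph [k, IsEq A B f,
        call (Y := HL 0 (S Z) (IsEq A B f)) pe [A, B, f]]]) (by decide +kernel)) rfl

/-! ### Subtypes and identity types of a universe -/

/-- The h-level of an identity type of a subtype is that in the ambient type. -/
abbrev hlSubPathsTy (i : ℕ) : Src := Pi N fun k => Pi (U i) fun A => Pi (A ⇒ U i) fun P =>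
  (Pi A fun a => HL i (S Z) (P a)) ⇒ Pi (Sg A fun a => P a) fun u => Pi (Sg A fun a => P a) fun v =>
    HL i k (Id (fst u) (fst v)) ⇒ HL i k (Id u v)

theorem hlSubPaths (i : ℕ) : Holds (hlSubPathsTy i) := .shift i _
  (.of₄ (sigPaths 0) (hlRetr 0) (hlSig 0) (contrHL 0) (fun sp hr hs ch =>
  lam fun k => lam fun A => lam fun P => lam fun h => lam fun u => lam fun v => lam fun H =>
    let P' (a : E A) : Src := P a
    let B (p : E (Id (fst u) (fst v))) : Src := Id (tr P' p (snd u)) (snd v)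
    split (fun _ => HL 0 k (Id u v))
      (fun r e => call hr [k, Id u v, SigPath P' u v, lam (A := Id u v) fun p => sigPath P' p, r, e,
        call (Y := HL 0 k (SigPath P' u v)) hs [k, Id (fst u) (fst v),
          lam (A := Id (fst u) (fst v)) fun p => asTy (i := 0) (B p), H,
          lam (A := Id (fst u) (fst v)) fun p => call (Y := HL 0 k (B p)) ch [k, B p,
            call (Y := Contr (B p)) h [fst v, tr P' p (snd u), snd v]]]])
      (app (app (app (app sp A) P) u) v)) (by decide +kernel)) rfl

/-- The first component of `pairEq B p q` is `p`. -/
abbrev fstPairEqTy (i : ℕ) : Src := Pi (U i) fun A => Pi (A ⇒ U i) fun B =>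
  Pi A fun a => Pi A fun a' => Pi (Id a a') fun p => Pi (B a) fun b => Pi (B a') fun b' =>
    Pi (Id (tr (fun a => B a) p b) b') fun q =>
      Id (A := Id a a') (cast (ap (A := Sg A fun a => B a) (fun u => fst u) (pairEq (fun a =>
          B a) p q))) p

theorem fstPairEq (i : ℕ) : Holds (fstPairEqTy i) := .shift i _ (.of₀
  (lam fun A => lam fun B => lam fun a => lam fun a' => lam fun p =>
    let B' (a : E A) : Src := B a
    let T {a a' : E A} (p : E (Id a a')) (b : E (B a)) (b' : E (B a')) (q : E (Id (tr B' p b) b'))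
        : Src :=
      Id (A := Id a a') (cast (ap (A := Sg A B') (fun u => fst u) (pairEq B' p q))) p
    J (fun a a' p => Pi (B a) fun b => Pi (B a') fun b' => Pi (Id (tr B' p b) b') fun q =>
        T p b b' q)
      (fun a => lam fun b => lam fun b' => cast (lam (A := Id b b') fun q =>
        J (fun b b' q => T (refl a) b b' (cast q)) (fun b => cast (refl (refl a))) q)) p)
            (by decide +kernel)) rfl

/-- The components of `pairEq B p q` are `p` and `q`. -/
abbrev sigPathPairEqTy (i : ℕ) : Src := Pi (U i) fun A => Pi (A ⇒ U i) fun B =>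
  Pi A fun a => Pi A fun a' => Pi (Id a a') fun p => Pi (B a) fun b => Pi (B a') fun b' =>
    Pi (Id (tr (fun a => B a) p b) b') fun q =>
      Id (A := Sg (Id a a') fun p => Id (tr (fun a => B a) p b) b')
        (cast (sigPath (fun a => B a) (pairEq (fun a => B a) p q))) (pair p q)

theorem sigPathPairEq (i : ℕ) : Holds (sigPathPairEqTy i) := .shift i _ (.of₀
  (lam fun A => lam fun B => lam fun a => lam fun a' => lam fun p =>
    let B' (a : E A) : Src := B a
    let T {a a' : E A} (p : E (Id a a')) (b : E (B a)) (b' : E (B a')) (q : E (Id (tr B' p b) b'))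
        : Src :=
      Id (A := Sg (Id a a') fun p => Id (tr B' p b) b') (cast (sigPath B' (pairEq B' p q))) (pair p
          q)
    J (fun a a' p => Pi (B a) fun b => Pi (B a') fun b' => Pi (Id (tr B' p b) b') fun q =>
        T p b b' q)
      (fun a => lam fun b => lam fun b' => cast (lam (A := Id b b') fun q =>
        J (fun b b' q => T (refl a) b b' (cast q))
          (fun b => cast (refl (A := Sg (Id a a) fun p => Id (tr B' p b) b) (pair (refl a) (cast
              (refl b))))) q)) p)
  (by decide +kernel)) rfl

/-- The h-level of a loop type in the ambient type is that in a subtype. -/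
abbrev hlSubBaseTy (i : ℕ) : Src := Pi N fun k => Pi (U i) fun A => Pi (A ⇒ U i) fun P =>
  (Pi A fun a => HL i (S Z) (P a)) ⇒ Pi A fun a => Pi (P a) fun b =>
    HL i k (Id (pair (B := fun a => P a) a b) (pair a b)) ⇒ HL i k (Id a a)

/-- Since `P` consists of propositions, each loop at `a` extends to a loop at `(a, b)`; by
`fstPairEq` this is a section of the projection. -/
theorem hlSubBase (i : ℕ) : Holds (hlSubBaseTy i) := .shift i _
  (.of₂ (fstPairEq 0) (hlRetr 0) (fun fp hr =>
  lam fun k => lam fun A => lam fun P => lam fun h => lam fun a => lam fun b => lam fun H =>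
    let P' (a : E A) : Src := P a
    let u : E (Sg A P') := pair a b
    let q (p : E (Id a a)) : E (Id (tr P' p b) b) :=
      fst (cast (B := Contr (Id (tr P' p b) b)) (call (Y := HL 0 Z (Id (tr P' p b) b)) h [a,
          tr P' p b, b]))
    call hr [k, Id a a, Id u u, lam (A := Id a a) fun p => pairEq P' p (q p),
      lam (A := Id u u) fun z => ap (fun u => fst u) z,
      lam (A := Id a a) fun p => call (Y := Id (A := Id a a) (cast (ap (A := Sg A P') (fun u =>
          fst u) (pairEq P' p (q p)))) p)
        fp [A, P, a, a, p, b, b, q p], H]) (by decide +kernel)) rfl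

/-- By univalence, `A = B` has the h-level of `A ≃ B`. -/
abbrev hlIdUTy (i : ℕ) : Src := Pi N fun k => Pi (U i) fun A => Pi (U i) fun B =>
  HL (i + 1) k (Eqv A B) ⇒ HL (i + 1) k (Id A B)

/-- The left inverse contained in univalence makes `A = B` a retract of `A ≃ B`. For the converse,
`hlEqvOfId` uses the right inverse. -/
theorem hlIdU (i : ℕ) : Holds (hlIdUTy i) := .shift i _ (.of₁ (hlRetr 1) (fun hr =>
  lam fun k => lam fun A => lam fun B => lam fun H =>
    let X : Src := Sg (Eqv A B ⇒ Id A B) fun g => Pi (Eqv A B) fun y => Id (app (idToEqv 0 A B) (g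
        y)) y
    let Y : Src := Sg (Eqv A B ⇒ Id A B) fun h => Pi (Id A B) fun x => Id (h (app (idToEqv 0 A B)
        x)) x
    split (A := X) (B := fun _ => Y) (fun _ => HL 1 k (Id A B))
      (fun _ v => split (A := Eqv A B ⇒ Id A B) (B := fun h => Pi (Id A B) fun x =>
          Id (h (app (idToEqv 0 A B) x)) x)
        (fun _ => HL 1 k (Id A B))
        (fun r e => call hr [k, Id A B, Eqv A B, idToEqv 0 A B, r, e,
            H]) v) (ua 0 A B)) (by decide +kernel)) rfl

/-- By univalence, `A ≃ B` has the h-level of `A = B`. -/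
abbrev hlEqvOfIdTy (i : ℕ) : Src := Pi N fun k => Pi (U i) fun A => Pi (U i) fun B =>
  HL (i + 1) k (Id A B) ⇒ HL i k (Eqv A B)

theorem hlEqvOfId (i : ℕ) : Holds (hlEqvOfIdTy i) := .shift i _ (.of₂ (hlRetr 1) (hlDown 0) (fun hr
    hd =>
  lam fun k => lam fun A => lam fun B => lam fun H =>
    let X : Src := Sg (Eqv A B ⇒ Id A B) fun g => Pi (Eqv A B) fun y => Id (app (idToEqv 0 A B) (g
        y)) y
    let Y : Src := Sg (Eqv A B ⇒ Id A B) fun h => Pi (Id A B) fun x => Id (h (app (idToEqv 0 A B)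
        x)) x
    split (A := X) (B := fun _ => Y) (fun _ => HL 0 k (Eqv A B))
      (fun u _ => split (A := Eqv A B ⇒ Id A B) (B := fun g => Pi (Eqv A B) fun y =>
          Id (app (idToEqv 0 A B) (g y)) y)
        (fun _ => HL 0 k (Eqv A B))
        (fun s e => call hd [k, Eqv A B, call (Y := HL 1 k (Eqv A B)) hr [k, Eqv A B, Id A B, s,
            idToEqv 0 A B, e, H]])
        u) (ua 0 A B)) (by decide +kernel)) rfl

/-- The homotopies from `f` to `f` have the h-level of `f = f`. -/
abbrev hlHomotopyTy (i : ℕ) : Src := Pi N fun k => Pi (U i) fun A => Pi (A ⇒ U i) fun B =>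
  Pi (Pi A fun a => B a) fun f => HL i k (Id f f) ⇒ HL i k (Homotopy f f)

theorem hlHomotopy (i : ℕ) : Holds (hlHomotopyTy i) := .shift i _ (.of₂ (funext 0) (hlRetr 0) (fun
    fe hr =>
  lam fun k => lam fun A => lam fun B => lam fun f => lam fun H =>
    split (fun _ => HL 0 k (Homotopy f f)) (fun s e =>
        call hr [k, Homotopy f f, Id f f, s, lam (A := Id f f) fun p => happly p, snd e, H])
      (cast (B := Sg (Homotopy f f ⇒ Id f f) fun r =>
            Prd (Pi (Id f f) fun p => Id (r (happly p)) p) (Pi (Homotopy f f) fun h =>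
                Id (happly (r h)) h))
            (app (app (app (app fe A) B) (cast f)) (cast f)))) (by decide +kernel)) rfl

/-! ### Iterated loop spaces -/

/-- The types of `U i` of h-level `k`. -/
abbrev Trunc (i : ℕ) (k : E N) : Src := Sg (U i) fun X => HL i k X

/-- The types of h-level `k + 1` form a type of h-level `k + 2`. -/
abbrev hlTruncTy (i : ℕ) : Src := Pi N fun k => HL (i + 1) (S (S k)) (Trunc i (S k))

/-- Having an h-level is a proposition, so identity types in `Trunc` are bounded by those of the
universe, and these by types of equivalences. Only the h-level of the target `v` is used. -/
theorem hlTrunc (i : ℕ) : Holds (hlTruncTy i) := .shift i _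
  (.of₅ (hlSubPaths 1) (propIsHL 0) (hlUp 0) (hlIdU 0) (hlEqv 0) (fun sp pl hu iu he =>
  lam fun k => cast (lam (A := Trunc 0 (S k)) fun u => lam (A := Trunc 0 (S k)) fun v =>
    call (Y := HL 1 (S k) (Id u v)) sp [S k, U 0, lam (A := U 0) fun X => asTy (i := 1) (HL 0 (S k)
        X),
      lam (A := U 0) fun X => call (Y := HL 1 (S Z) (HL 0 (S k) X)) hu [S Z, HL 0 (S k) X,
        call (Y := HL 0 (S Z) (HL 0 (S k) X)) pl [S k, X]], u, v,
      call (Y := HL 1 (S k) (Id (fst u) (fst v))) iu [S k, fst u, fst v,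
        call (Y := HL 1 (S k) (Eqv (fst u) (fst v))) hu [S k, Eqv (fst u) (fst v),
          call (Y := HL 0 (S k) (Eqv (fst u) (fst v))) he [k, fst u, fst v,
              snd v]]]])) (by decide +kernel)) rfl

/-- Iterated loop spaces of a type of h-level `k` have h-level `k`. -/
abbrev hlLoopsTy (i : ℕ) : Src := Pi N fun j => Pi N fun k => Pi (U i) fun A => Pi A fun a =>
  HL i k A ⇒ HL i k (Om i j A a)

theorem hlLoops (i : ℕ) : Holds (hlLoopsTy i) := .shift i _ (.of₁ (cumul 0) (fun cu =>
  lam fun j => natRec (fun j => Pi N fun k => Pi (U 0) fun A => Pi A fun a => HL 0 k A ⇒ HL 0 k (Om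
      0 j A a))
    (lam fun _ => lam fun _ => lam fun _ => lam fun h => cast h)
    (fun _ ih => lam fun k => lam fun A => lam fun a => lam fun h => call ih [k, Id a a, refl a,
      call (Y := HL 0 k (Id a a)) cu [k, A, h, a, a]]) j) (by decide +kernel)) rfl

/-- A type all of whose `j`-fold loops are trivial has h-level `j + 1`. -/
abbrev hlOfTrivialLoopsTy (i : ℕ) : Src := Pi N fun j => Pi (U i) fun A =>
  (Pi A fun a => Pi (Om i j A a) fun q => Id q (pt i j A a)) ⇒ HL i (S j) A

/-- In the step the induction hypothesis is applied to `x = y`. Its `j`-fold loops at `p` are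
trivial since by path induction `p` is `refl`, where they are `(j + 1)`-fold loops of `A`. -/
theorem hlOfTrivialLoops (i : ℕ) : Holds (hlOfTrivialLoopsTy i) := .shift i _ (.of₁ (propOf 0) (fun
    po =>
  lam fun j => natRec (fun j => Pi (U 0) fun A =>
      (Pi A fun a => Pi (Om 0 j A a) fun q => Id q (pt 0 j A a)) ⇒ HL 0 (S j) A)
    (lam fun A => lam fun h => call po [A, lam (A := A) fun a => pair (B := fun a => Pi A fun x =>
        Id a x) a
      (lam fun x => call (Y := Id a x) h [x, a])])
    (fun j ih => lam fun A => lam fun h => cast (lam (A := A) fun x => lam (A := A) fun y =>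
      call (Y := HL 0 (S j) (Id x y)) ih [Id x y, lam (A := Id x y) fun p =>
        J (fun x y p => Pi (Om 0 j (Id x y) p) fun q => Id q (pt 0 j (Id x y) p))
          (fun x => call h [x]) p])) j) (by decide +kernel)) rfl

/-- If `Π a, B a` has h-level `j + 1`, then its `j`-fold loops, taken pointwise, form a proposition. -/
abbrev propPiLoopsTy (i : ℕ) : Src := Pi N fun j => Pi (U i) fun A => Pi (A ⇒ U i) fun B =>
  Pi (Pi A fun a => B a) fun g => HL i (S j) (Pi A fun a => B a) ⇒
    HL i (S Z) (Pi A fun a => Om i j (B a) (g a))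

/-- By function extensionality the loops at `g` are the product of the types `g a = g a`. The
induction hypothesis applies to this family with `refl` as its section. -/
theorem propPiLoops (i : ℕ) : Holds (propPiLoopsTy i) := .shift i _ (.of₁ (hlHomotopy 0) (fun hh =>
  lam fun j => natRec (fun j => Pi (U 0) fun A => Pi (A ⇒ U 0) fun B =>
      Pi (Pi A fun a => B a) fun g => HL 0 (S j) (Pi A fun a => B a) ⇒
        HL 0 (S Z) (Pi A fun a => Om 0 j (B a) (g a)))
    (lam fun _ => lam fun _ => lam fun _ => lam fun h => cast h)
    (fun j ih => lam fun A => lam fun B => lam fun g => lam fun h =>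
      call ih [A, lam (A := A) fun a => asTy (i := 0) (Id (g a) (g a)), lam (A := A) fun a =>
          refl (g a),
        call (Y := HL 0 (S j) (Homotopy g g)) hh [S j, A, B, g,
            call (Y := HL 0 (S j) (Id g g)) h [g, g]]]) j)
  (by decide +kernel)) rfl

/-- The `j`-fold loops in a type of h-level `j + 2` form a set. -/
abbrev setLoopsTy (i : ℕ) : Src := Pi N fun j => Pi (U i) fun A => Pi A fun a =>
  HL i (S (S j)) A ⇒ HL i (S (S Z)) (Om i j A a)

theorem setLoops (i : ℕ) : Holds (setLoopsTy i) := .shift i _ (.of₀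
  (lam fun j => natRec (fun j => Pi (U 0) fun A => Pi A fun a =>
      HL 0 (S (S j)) A ⇒ HL 0 (S (S Z)) (Om 0 j A a))
    (lam fun _ => lam fun _ => lam fun h => cast h)
    (fun j ih => lam fun A => lam fun a => lam fun h => call ih [Id a a, refl a,
      call (Y := HL 0 (S (S j)) (Id a a)) h [a, a]]) j) (by decide +kernel)) rfl

/-- A set has every h-level from `2` on. -/
abbrev setHLTy (i : ℕ) : Src := Pi N fun k => Pi (U i) fun A => HL i (S (S Z)) A ⇒ HL i (S (S k)) A

theorem setHL (i : ℕ) : Holds (setHLTy i) := .shift i _ (.of₁ (propHL 0) (fun ph =>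
  lam fun k => lam fun A => lam fun h => cast (lam (A := A) fun x => lam (A := A) fun y =>
    call (Y := HL 0 (S k) (Id x y)) ph [k, Id x y, call (Y := HL 0 (S Z) (Id x y)) h [x, y]]))
  (by decide +kernel)) rfl

/-- A section acts on `j`-fold loops and reflects the trivial one. -/
abbrev loopsRetrTy (i : ℕ) : Src := Pi N fun j => Pi (U i) fun A => Pi (U i) fun B =>
  Pi (A ⇒ B) fun s => Pi (B ⇒ A) fun r => (Pi A fun x => Id (r (s x)) x) ⇒ Pi A fun a =>
    Sg (Om i j A a ⇒ Om i j B (s a)) fun t => Pi (Om i j A a) fun q =>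
      Id (t q) (pt i j B (s a)) ⇒ Id q (pt i j A a)

/-- By `retrPaths` the map `ap s` is again a section, and it sends `refl` to `refl` by computation,
so the induction continues in the identity types. -/
theorem loopsRetr (i : ℕ) : Holds (loopsRetrTy i) := .shift i _ (.of₁ (retrPaths 0) (fun rp =>
  lam fun j =>
    let T (j : E N) (A B : E (U 0)) (s : E (A ⇒ B)) (a : E A) : Src :=
      Sg (Om 0 j A a ⇒ Om 0 j B (s a)) fun t => Pi (Om 0 j A a) fun q =>
        Id (t q) (pt 0 j B (s a)) ⇒ Id q (pt 0 j A a)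
    natRec (fun j => Pi (U 0) fun A => Pi (U 0) fun B =>
      Pi (A ⇒ B) fun s => Pi (B ⇒ A) fun r => (Pi A fun x => Id (r (s x)) x) ⇒ Pi A fun a =>
          T j A B s a)
    (lam fun A => lam fun B => lam fun s => lam fun r => lam fun e => lam fun a =>
      cast (pair (A := A ⇒ B) (B := fun t => Pi A fun q => Id (t q) (s a) ⇒ Id q a) s
        (lam fun q => lam (A := Id (s q) (s a)) fun p =>
          trans (trans (sym (e q)) (ap (fun x => r x) p)) (e a))))
    (fun j ih => lam fun A => lam fun B => lam fun s => lam fun r => lam fun e => lam fun a =>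
      split (fun _ => T (S j) A B s a) (fun r' e' => call ih [Id a a, Id (s a) (s a),
          lam (A := Id a a) fun p => ap (fun x => s x) p, r', e', refl a])
        (app (app (app (app (app (app (app rp A) B) s) r) (cast e)) a) a)) j) (by decide +kernel))
            rfl

/-- If each `B x` has h-level `j`, then `j`-fold loops of `A` lift to `Σ x, B x`, and only trivial ones
have a trivial lift. -/
abbrev loopsSigTy (i : ℕ) : Src := Pi N fun j => Pi (U i) fun A => Pi (A ⇒ U i) fun B =>
  (Pi A fun x => HL i j (B x)) ⇒ Pi A fun a => Pi (B a) fun b =>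
    Sg (Om i j A a ⇒ Om i j (Sg A fun x => B x) (pair a b)) fun t => Pi (Om i j A a) fun q =>
      Id (t q) (pt i j (Sg A fun x => B x) (pair a b)) ⇒ Id q (pt i j A a)

/-- For `j = 0` the fibres are contractible and a point lifts by the centre of its fibre. In the
step, a loop at `(a, b)` amounts to a loop `p` at `a` together with a path from the transport of `b`
along `p` to `b`. The types of such paths have h-level `j`, so the induction hypothesis lifts from
`a = a`. -/
theorem loopsSig (i : ℕ) : Holds (loopsSigTy i) := .shift i _ (.of₂ (loopsRetr 0) (sigPathPairEq 0)
    (fun lr sp =>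
  lam fun j =>
    let T (j : E N) (A : E (U 0)) (B : E (A ⇒ U 0)) (a : E A) (b : E (B a)) : Src :=
      Sg (Om 0 j A a ⇒ Om 0 j (Sg A fun x => B x) (pair a b)) fun t => Pi (Om 0 j A a) fun q =>
        Id (t q) (pt 0 j (Sg A fun x => B x) (pair a b)) ⇒ Id q (pt 0 j A a)
    natRec (fun j => Pi (U 0) fun A => Pi (A ⇒ U 0) fun B =>
      (Pi A fun x => HL 0 j (B x)) ⇒ Pi A fun a => Pi (B a) fun b => T j A B a b)
    (lam fun A => lam fun B => lam fun h => lam fun a => lam fun b =>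
      let X : Src := Sg A fun x => B x
      let t (q : E A) : E X := pair q (fst (cast (B := Contr (B q)) (h q)))
      cast (pair (B := fun t : E (A ⇒ X) => Pi A fun q => Id (t q) (pair a b) ⇒ Id q a) (lam t)
        (lam fun q => cast (lam (A := Id (t q) (pair a b)) fun p =>
          ap (A := X) (fun u => fst u) p))))
    (fun j ih => lam fun A => lam fun B => lam fun h => lam fun a => lam fun b =>
      let B' (x : E A) : Src := B x
      let X : Src := Sg A B'
      let u : E X := pair a b
      let Q (p : E (Id a a)) : Src := Id (tr B' p b) b
      let Y : Src := Sg (Id a a) Q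
      let c : E Y := pair (refl a) (cast (refl b))
      let s (w : E Y) : E (Id u u) := split (B := Q) (fun _ => Id u u) (fun p q => pairEq B' p q) w
      let V (t : E (Om 0 j (Id a a) (refl a) ⇒ Om 0 j Y c)) : Src :=
        Pi (Om 0 j (Id a a) (refl a)) fun q => Id (t q) (pt 0 j Y c) ⇒ Id q (pt 0 j (Id a a) (refl
            a))
      let W (t : E (Om 0 j Y c ⇒ Om 0 j (Id u u) (refl u))) : Src :=
        Pi (Om 0 j Y c) fun q => Id (t q) (pt 0 j (Id u u) (refl u)) ⇒ Id q (pt 0 j Y c)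
      split (B := V) (fun _ => T (S j) A B a b)
        (fun t e => split (B := W) (fun _ => T (S j) A B a b)
          (fun t' e' => cast (pair
            (B := fun t => Pi (Om 0 j (Id a a) (refl a)) fun q =>
              Id (app t q) (pt 0 j (Id u u) (refl u)) ⇒ Id q (pt 0 j (Id a a) (refl a)))
            (lam (A := Om 0 j (Id a a) (refl a)) fun q => t' (t q))
            (lam fun q => cast (lam (A := Id (t' (t q)) (pt 0 j (Id u u) (refl u))) fun p =>
              e q (e' (t q) p)))))
          -- Pairs of paths form a retract of the loops at `u`, which carries the lift over. The
          -- section sends the base point `c` to `refl u` by computation.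
          (call lr [j, Y, Id u u, lam s, lam (A := Id u u) fun p => cast (B := Y) (sigPath B' p),
            lam (A := Y) fun w => split (B := Q) (fun w => Id (A := Y) (cast (sigPath B' (s w))) w)
              (fun p q => call sp [A, B, a, a, p, b, b, q]) w, c]))
        (call ih [Id a a, lam (A := Id a a) fun p => asTy (i := 0) (Q p),
          lam (A := Id a a) fun p => call (Y := HL 0 j (Q p)) h [a, tr B' p b, b], refl a,
              cast (B := Q (refl a)) (refl b)])) j)
  (by decide +kernel)) rfl

/-! ### Loops in a type of loops -/

/-- The constant path is a left unit. -/
abbrev idLeftTy (i : ℕ) : Src := Pi (U i) fun A => Pi A fun x => Pi A fun y => Pi (Id x y) fun p =>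
  Id (trans (refl x) p) p

theorem idLeft (i : ℕ) : Holds (idLeftTy i) := .shift i _ (.of₀
  (lam fun A => lam fun x => lam fun y => lam fun p =>
    J (fun x _ p => Id (trans (refl x) p) p) (fun x => cast (refl (refl x))) p)
        (by decide +kernel)) rfl

/-- Transport of loops is conjugation. -/
abbrev trLoopsTy (i : ℕ) : Src := Pi (U i) fun A => Pi A fun x => Pi A fun y => Pi (Id x y) fun p =>
  Pi (Id x x) fun r => Id (tr (fun z => Id z z) p r) (trans (sym p) (trans r p))

theorem trLoops (i : ℕ) : Holds (trLoopsTy i) := .shift i _ (.of₁ (idLeft 0) (fun il =>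
  lam fun A => lam fun x => lam fun y => lam fun p =>
    J (fun x _ p => Pi (Id x x) fun r => Id (tr (fun z => Id z z) p r) (trans (sym p) (trans r p)))
      (fun x => lam fun r => cast (sym (call (Y := Id (trans (refl x) r) r) il [A, x, x,
          r]))) p) (by decide +kernel)) rfl

/-- The inverse of a path cancels. -/
abbrev cancelLeftTy (i : ℕ) : Src := Pi (U i) fun A => Pi A fun x => Pi A fun y => Pi (Id x y) fun
    p =>
  Pi A fun z => Pi (Id y z) fun r => Id (trans (sym p) (trans p r)) r

theorem cancelLeft (i : ℕ) : Holds (cancelLeftTy i) := .shift i _ (.of₁ (symTrans 0) (fun st =>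
  lam fun A => lam fun x => lam fun y => lam fun p => lam fun z => lam fun r =>
    call (J (fun y _ r => Pi (Id x y) fun p => Id (trans (sym p) (trans p r)) r)
      (fun y => lam fun p => call st [A, x, y, p]) r) [p]) (by decide +kernel)) rfl

/-- A loop is fixed by conjugation with itself. -/
abbrev trLoopTy (i : ℕ) : Src := Pi (U i) fun A => Pi A fun x => Pi (Id x x) fun q =>
  Id (tr (fun z => Id z z) q q) q

/-- The conjugate of `q` by itself is `q⁻¹ · (q · q)`, and the first two factors cancel. -/
theorem trLoop (i : ℕ) : Holds (trLoopTy i) := .shift i _ (.of₂ (trLoops 0) (cancelLeft 0) (fun tl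
    cl =>
  lam fun A => lam fun x => lam fun q =>
    trans (call (Y := Id (tr (fun z => Id z z) q q) (trans (sym q) (trans q q))) tl [A, x, x, q, q])
      (call (Y := Id (trans (sym q) (trans q q)) q) cl [A, x, x, q, x, q])) (by decide +kernel)) rfl

/-- Points of `A` with an `(n + 1)`-fold loop. -/
abbrev Loops (i : ℕ) (n : E N) (A : Src) : Src := Sg A fun x => Om i (S n) A x

/-- In a type of `(n + 1)`-loops of `A`, each loop `q` carries an `(n + 1)`-loop that is trivial only if
`q` is trivial. -/
abbrev loopLoopsTy (i : ℕ) : Src := Pi N fun n => Pi (U i) fun A => HL i (S (S (S n))) A ⇒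
  Pi A fun a => Pi (Om i (S n) A a) fun q =>
    Sg (Om i (S n) (Loops i n A) (pair a q)) fun l =>
      Id l (pt i (S n) (Loops i n A) (pair a q)) ⇒ Id q (pt i (S n) A a)

/-- The recursion on `n` is a mere case distinction. For `n = 0` the general lifting of `loopsSig`
would need the types `x = x` to be propositions; the loop `q` at `(a, q)` nevertheless lifts, as it
commutes with itself. -/
theorem loopLoops (i : ℕ) : Holds (loopLoopsTy i) := .shift i _
  (.of₅ (trLoop 0) (fstPairEq 0) (loopsSig 0) (setHL 0) (setLoops 0) (fun tl fp ls sh sl =>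
  lam fun n =>
    let W (n : E N) (A : E (U 0)) (a : E A) (q : E (Om 0 (S n) A a)) (l : E (Om 0 (S n) (Loops 0 n
        A) (pair a q))) : Src :=
      Id l (pt 0 (S n) (Loops 0 n A) (pair a q)) ⇒ Id q (pt 0 (S n) A a)
    let T (n : E N) (A : E (U 0)) (a : E A) (q : E (Om 0 (S n) A a)) : Src :=
      Sg (Om 0 (S n) (Loops 0 n A) (pair a q)) (W n A a q)
    natRec (fun n => Pi (U 0) fun A => HL 0 (S (S (S n))) A ⇒ Pi A fun a => Pi (Om 0 (S n) A a) fun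
        q => T n A a q)
      (lam fun A => lam fun _ => lam fun a => cast (lam (A := Id a a) (B := fun q => T Z A a (cast
          q)) fun q =>
        let B (x : E A) : Src := Id x x
        let u : E (Sg A B) := pair a q
        -- Here `q` plays two roles: the path in the base and the point of the fibre that is carried
        -- along it. Its first component is `q`, so `l` can be trivial only if `q` is.
        let l : E (Id u u) := pairEq B q (call tl [A, a, q])
        cast (pair (B := fun l : E (Id u u) => Id l (refl u) ⇒ Id q (refl a)) l (lam fun z =>
          trans (sym (call (Y := Id (A := Id a a) (cast (ap (fun u => fst u) l)) q) fp
            [A, lam (A := A) fun x => asTy (i := 0) (Id x x), a, a, q, q, q,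
                call (Y := Id (tr B q q) q) tl [A, a, q]]))
            (cast (ap (fun l => ap (fun u => fst u) l) z))))))
      (fun m _ => lam fun A => lam fun h => lam fun a => lam fun q =>
        let j := S (S m)
        let V (t : E (Om 0 j A a ⇒ Om 0 j (Loops 0 (S m) A) (pair a q))) : Src := Pi (Om 0 j A a)
            fun q' =>
          Id (t q') (pt 0 j (Loops 0 (S m) A) (pair a q)) ⇒ Id q' (pt 0 j A a)
        split (B := V) (fun _ => T (S m) A a q)
          (fun t e => pair (B := W (S m) A a q) (t q) (app e q))
          -- With `n = m + 1`, the `(m + 2)`-fold loops of a type of h-level `m + 4` form a set, and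
          -- a set has the h-level `m + 2` that `loopsSig` asks for.
          (call ls [j, A, lam (A := A) fun x => asTy (i := 0) (Om 0 j A x), lam (A := A) fun x =>
            call (Y := HL 0 j (Om 0 j A x)) sh [m, Om 0 j A x,
              call (Y := HL 0 (S (S Z)) (Om 0 j A x)) sl [j, A, x, h]], a, q])) n)
  (by decide +kernel)) rfl

/-- If the sections of `R` form a proposition, then a section made of pairs that witness nontriviality
agrees with any given one. -/
abbrev propSectionsTy (i : ℕ) : Src := Pi (U i) fun A => Pi (A ⇒ U i) fun Q =>
  Pi ((Sg A fun a => Q a) ⇒ U i) fun R => Pi (Pi A fun a => Q a ⇒ U i) fun V =>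
    Pi (Pi (Sg A fun a => Q a) fun u => R u) fun g =>
    HL i (S Z) (Pi (Sg A fun a => Q a) fun u => R u) ⇒
    (Pi A fun a => Pi (Q a) fun q => Sg (R (pair a q)) fun l => Id l (g (pair a q)) ⇒ app (V a) q) ⇒
      Pi A fun a => Pi (Q a) fun q => app (V a) q

/-- The first components of the given pairs form a section. It equals `g`, and evaluation of this
equality at `(a, q)` is what the second component asks for. -/
theorem propSections (i : ℕ) : Holds (propSectionsTy i) := .shift i _ (.of₀
  (lam fun A => lam fun Q => lam fun R => lam fun V => lam fun g => lam fun h => lam fun e =>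
      lam fun a => lam fun q =>
    let Q' (a : E A) : Src := Q a
    let P : Src := Pi (Sg A Q') fun u => app (A := Sg A Q') R u
    let f : E P := lam fun u => split (B := Q') (fun u => app (A := Sg A Q') R u)
      (fun a q => fst (app (app e a) q)) u
    call (snd (app (app e a) q))
      [ap (fun f : E P => app f (pair a q)) (fst (call (Y := Contr (Id f (cast g))) h [f,
          g]))]) (by decide +kernel)) rfl

/-- If the loops at the identity of the type of `(n + 1)`-loops of `A` have h-level `n + 1`, then the
`(n + 1)`-loops of `A` are trivial. -/
abbrev trivialLoopsTy (i : ℕ) : Src := Pi N fun n => Pi (U i) fun A => HL i (S (S (S n))) A ⇒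
  HL i (S n) (Id (lam (A := Loops i n A) fun x => x) (lam fun x => x)) ⇒
  Pi A fun a => Pi (Om i (S n) A a) fun q => Id q (pt i (S n) A a)

/-- The heart of the proof. The `(n + 1)`-fold loops over all points of `Loops i n A` have two
sections, the constant loops and the lifts from `loopLoops`. The hypothesis makes the product a
proposition, so the lifts are trivial and with them all loops of `A`. -/
theorem trivialLoops (i : ℕ) : Holds (trivialLoopsTy i) := .shift i _
  (.of₄ (loopLoops 0) (hlHomotopy 0) (propPiLoops 0) (propSections 0) (fun ll hh pl ps =>
  lam fun n => lam fun A => lam fun h => lam fun H =>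
    let L : Src := Loops 0 n A
    let id : E (L ⇒ L) := lam fun x => x
    call ps [A, lam (A := A) fun a => asTy (i := 0) (Om 0 (S n) A a), lam (A := L) fun u =>
        asTy (i := 0) (Om 0 (S n) L u),
      lam (A := A) fun a => lam (A := Om 0 (S n) A a) fun q => asTy (i := 0) (Id q (pt 0 (S n) A
          a)),
      lam (A := L) fun x => pt 0 (S n) L x,
      call (Y := HL 0 (S Z) (Pi L fun x => Om 0 (S n) L x)) pl
        -- One loop has been used up: `(n + 1)`-fold loops at `x` are by definition `n`-fold loops
        -- of `x = x` at `refl`.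
        [n, L, lam (A := L) fun x => asTy (i := 0) (Id x x), lam (A := L) fun x => refl x,
          call (Y := HL 0 (S n) (Homotopy id id)) hh [S n, L, lam (A := L) fun _ => asTy (i := 0)
              L, id, H]],
      call (Y := Empty) ll [n, A, h]]) (by decide +kernel)) rfl

/-- If the automorphisms of the type of `(n + 1)`-loops of `A` have h-level `n + 2`, then so has `A`. -/
abbrev hlOfAutosTy (i : ℕ) : Src := Pi N fun n => Pi (U i) fun A => HL i (S (S (S n))) A ⇒
  HL (i + 1) (S (S n)) (Id (A := U i) (asTy (Loops i n A)) (asTy (Loops i n A))) ⇒ HL i (S (S n)) A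

theorem hlOfAutos (i : ℕ) : Holds (hlOfAutosTy i) := .shift i _
  (.of₅ (trivialLoops 0) (hlOfTrivialLoops 0) (hlEqvOfId 0) (hlSubBase 0) (propIsEq 0) (fun tl ol
      eq sb pe =>
  lam fun n => lam fun A => lam fun h => lam fun H =>
    let L : Src := Loops 0 n A
    let id : E (L ⇒ L) := lam fun x => x
    call ol [S n, A, call (Y := Pi A fun a => Pi (Om 0 (S n) A a) fun q => Id q (pt 0 (S n) A a))
        tl [n, A, h,
      call (Y := HL 0 (S n) (Id id id)) sb [S n, L ⇒ L, lam (A := L ⇒ L) fun f => asTy (i := 0)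
          (IsEq L L f),
        lam (A := L ⇒ L) fun f => call (Y := HL 0 (S Z) (IsEq L L f)) pe [L, L, f], id,
        -- This is the witness contained in `idEqv L` up to conversion, so the h-level of `idEqv L =
        -- idEqv L` applies.
        mkIsEq id (fun x => x) (fun x => cast (refl x)) (fun x => cast (refl x)),
        call (Y := Empty) (call (Y := HL 0 (S (S n)) (Eqv L L)) eq [S (S n), L, L, H]) [idEqv L,
            idEqv L]]]])
  (by decide +kernel)) rfl

/-! ### Negation -/

/-- Negation. -/
abbrev Not (A : Src) : Src := A ⇒ Empty

/-! ### The two-element type -/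

/-- The two-element type. -/
abbrev Two : Src := Sum One One

/-- The type of codes for the paths between two points of `Two`. -/
def TwoCode (x y : E Two) : Src :=
  cases (fun _ => U 0) (fun _ => cases (fun _ => U 0) (fun _ => asTy One) (fun _ => asTy Empty) y)
    (fun _ => cases (fun _ => U 0) (fun _ => asTy Empty) (fun _ => asTy One) y) x

/-- The code of a path. -/
def twoEncode {x y : E Two} (p : E (Id x y)) : E (TwoCode x y) :=
  J (fun x y _ => TwoCode x y) (fun x => cases (fun x => TwoCode x x) (fun _ => cast star) (fun _
      => cast star) x) p

/-- The values of a function on the unit type are equal. -/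
def onePath (f : E One → E Two) (u v : E One) : E (Id (f u) (f v)) :=
  oneInd (fun v => Id (f u) (f v)) (oneInd (fun u => Id (f u) (f star)) (refl (f star)) u) v

/-- The path given by a code. -/
def twoDecode : E (Pi Two fun x => Pi Two fun y => TwoCode x y ⇒ Id x y) :=
  lam fun x => cases (fun x => Pi Two fun y => TwoCode x y ⇒ Id x y)
    (fun u => lam fun y => cases (fun y => TwoCode (inl u) y ⇒ Id (inl u) y)
      (fun v => cast (lam (A := One) fun _ => onePath (fun u => inl u) u v))
      (fun v => cast (lam (A := Empty) fun c => absurd (Id (A := Two) (inl u) (inr v)) c)) y)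
    (fun u => lam fun y => cases (fun y => TwoCode (inr u) y ⇒ Id (inr u) y)
      (fun v => cast (lam (A := Empty) fun c => absurd (Id (A := Two) (inr u) (inl v)) c))
      (fun v => cast (lam (A := One) fun _ => onePath (fun u => inr u) u v)) y) x

/-- The codes are propositions. -/
abbrev twoCodePropTy : Src := Pi Two fun x => Pi Two fun y => HL 0 (S Z) (TwoCode x y)

theorem twoCodeProp : Holds twoCodePropTy := .of₂ (propOf 0) (contrHL 0) (fun po ch =>
  let e : E (HL 0 (S Z) Empty) := call po [Empty, lam (A := Empty) fun c => absurd (Contr Empty) c]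
  let o : E (HL 0 (S Z) One) := call ch [S Z, One, pair (A := One) (B := fun a => Pi One fun x =>
      Id a x) star
    (lam fun x => oneInd (fun x => Id star x) (refl star) x)]
  lam fun x => lam fun y => cases (fun x => HL 0 (S Z) (TwoCode x y))
    (fun u => cases (fun y => HL 0 (S Z) (TwoCode (inl u) y)) (fun _ => cast o) (fun _ => cast e) y)
    (fun u => cases (fun y => HL 0 (S Z) (TwoCode (inr u) y)) (fun _ => cast e) (fun _ =>
        cast o) y) x)
  (by decide +kernel)

/-- Decoding is a left inverse of encoding. -/
abbrev twoDecodeEncodeTy : Src := Pi Two fun x => Pi Two fun y => Pi (Id x y) fun p =>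
  Id (call (Y := Id x y) twoDecode [x, y, twoEncode p]) p

theorem twoDecodeEncode : Holds twoDecodeEncodeTy := .of₀
  (lam fun x => lam fun y => lam fun p =>
    let T {x y : E Two} (p : E (Id x y)) : Src := Id (call (Y := Id x y) twoDecode [x, y,
        twoEncode p]) p
    J (fun _ _ p => T p) (fun x => cases (fun x => T (refl x))
      (fun u => oneInd (fun u => T (refl (inl u))) (cast (refl (refl (A := Two) (inl star)))) u)
      (fun u => oneInd (fun u => T (refl (inr u))) (cast (refl (refl (A := Two) (inr star)))) u) x)
          p)
  (by decide +kernel)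

/-- The two-element type is a set. -/
abbrev twoSetTy (i : ℕ) : Src := HL i (S (S Z)) Two

/-- Encoding and decoding make `x = y` a retract of a proposition; that the codes are conversely a
retract of `x = y` is not needed. -/
theorem twoSet (i : ℕ) : Holds (twoSetTy i) := .shift i _ (.of₃ twoCodeProp twoDecodeEncode (hlRetr
    0) (fun cp de hr =>
  cast (lam (A := Two) fun x => lam (A := Two) fun y =>
    call (Y := HL 0 (S Z) (Id x y)) hr [S Z, Id x y, TwoCode x y, lam (A := Id x y) fun p =>
        twoEncode p,
      call (Y := Empty) twoDecode [x, y], call (Y := Empty) de [x, y], call (Y := Empty) cp [x,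
          y]]))
  (by decide +kernel)) rfl

/-- The two-element type is not a proposition. -/
abbrev twoNotPropTy (i : ℕ) : Src := Not (HL i (S Z) Two)

theorem twoNotProp (i : ℕ) : Holds (twoNotPropTy i) := .shift i _ (.of₀
  (lam fun h => cast (twoEncode (x := inl star) (y := inr star)
    (fst (call (Y := Contr (Id (A := Two) (inl star) (inr star))) h [inl (A := One) (B := One)
        star, inr (A := One) (B := One) star]))))
  (by decide +kernel)) rfl

/-- The exchange of the two elements. -/
def swap (x : E Two) : E Two := cases (fun _ => Two) (fun u => inr u) (fun u => inl u) x

/-- The exchange is an equivalence. -/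
def swapEqv : E (Eqv Two Two) :=
  pair (lam swap) (mkIsEq (lam swap) swap
    (fun x => cases (fun x => Id (app (lam swap) (swap x)) x) (fun u => cast (refl (A := Two) (inl
        u)))
      (fun u => cast (refl (A := Two) (inr u))) x)
    (fun x => cases (fun x => Id (swap (app (lam swap) x)) x) (fun u => cast (refl (A := Two) (inl
        u)))
      (fun u => cast (refl (A := Two) (inr u))) x))

/-! ### The universes of truncated types -/

/-- The sets of a universe do not form a set. -/
abbrev truncSetTy (i : ℕ) : Src := Not (HL (i + 1) (S (S Z)) (Trunc i (S (S Z))))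

/-- Otherwise `Two = Two`, and by univalence `Two ≃ Two`, would be a proposition. Evaluation of a
path from `idEqv Two` to `swapEqv` at the left point then gives a path between the two points. -/
theorem truncSet (i : ℕ) : Holds (truncSetTy i) := .shift i _
  (.of₅ (twoSet 0) (hlSubBase 1) (propIsHL 0) (hlUp 0) (hlEqvOfId 0) (fun ts sb pl hu eq =>
  lam fun H =>
    let u : E (Trunc 0 (S (S Z))) := pair (asTy Two) ts
    let two : E (U 0) := asTy Two
    let h : E (HL 0 (S Z) (Eqv Two Two)) := call eq [S Z, Two, Two,
      call (Y := HL 1 (S Z) (Id two two)) sb [S Z, U 0, lam (A := U 0) fun X => asTy (i := 1) (HL 0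
          (S (S Z)) X),
        lam (A := U 0) fun X => call (Y := HL 1 (S Z) (HL 0 (S (S Z)) X)) hu [S Z, HL 0 (S (S Z)) X,
          call (Y := HL 0 (S Z) (HL 0 (S (S Z)) X)) pl [S (S Z), X]], Two, ts,
        call (Y := HL 1 (S Z) (Id u u)) H [u, u]]]
    cast (twoEncode (x := inl star) (y := inr star) (cast (ap (fun e : E (Eqv Two Two) =>
        app (fst e) (inl star))
      (fst (call (Y := Contr (Id (idEqv Two) swapEqv)) h [idEqv Two, swapEqv]))))))
  (by decide +kernel)) rfl

/-- The `(n + 1)`-loops in the types of h-level `n + 2` of `U i`. -/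
abbrev LoopTy (i : ℕ) (n : E N) : Src := Loops (i + 1) n (Trunc i (S (S n)))

/-- The type of `(n + 1)`-loops has h-level `n + 3`. -/
abbrev hlLoopTyTy (i : ℕ) : Src := Pi N fun n => HL (i + 1) (S (S (S n))) (LoopTy i n)

theorem hlLoopTy (i : ℕ) : Holds (hlLoopTyTy i) := .shift i _
  (.of₃ (hlSig 1) (hlTrunc 0) (hlLoops 1) (fun hs ht hl =>
  lam fun n =>
    let T : Src := Trunc 0 (S (S n))
    let h : E (HL 1 (S (S (S n))) T) := call ht [S n]
    call hs [S (S (S n)), T, lam (A := T) fun x => asTy (i := 1) (Om 1 (S n) T x), h,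
        lam (A := T) fun x =>
      call (Y := HL 1 (S (S (S n))) (Om 1 (S n) T x)) hl [S n, S (S (S n)), T, x,
          h]]) (by decide +kernel)) rfl

/-- The inductive step: if the types of h-level `n + 2` in `U i` are not themselves of h-level `n + 2`,
then the types of h-level `n + 3` in the next universe are not of h-level `n + 3`. -/
abbrev truncStepTy (i : ℕ) : Src := Pi N fun n => Not (HL (i + 1) (S (S n)) (Trunc i (S (S n)))) ⇒
  Not (HL (i + 2) (S (S (S n))) (Trunc (i + 1) (S (S (S n)))))

/-- The type of `(n + 1)`-loops is a point of the larger subuniverse. Its loop type there bounds its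
loop type in the universe, and `hlOfAutos` passes the bound down to the smaller subuniverse. Taking
loops in a universe costs one level, hence three consecutive universes. -/
theorem truncStep (i : ℕ) : Holds (truncStepTy i) := .shift i _
  (.of₆ (hlOfAutos 1) (hlLoopTy 0) (hlTrunc 0) (hlSubBase 2) (propIsHL 1) (hlUp 1) (fun ha hl ht sb
      pl hu =>
  lam fun n => lam fun c => lam fun H =>
    let k : E N := S (S (S n))
    let T : Src := Trunc 0 (S (S n))
    let L : E (U 1) := asTy (LoopTy 0 n)
    let l : E (HL 1 k L) := call hl [n]
    let u : E (Trunc 1 k) := pair L l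
    call c [call (Y := HL 1 (S (S n)) T) ha [n, T, call (Y := HL 1 k T) ht [S n],
      call (Y := HL 2 (S (S n)) (Id L L)) sb [S (S n), U 1, lam (A := U 1) fun X => asTy (i := 2)
          (HL 1 k X),
        lam (A := U 1) fun X => call (Y := HL 2 (S Z) (HL 1 k X)) hu [S Z, HL 1 k X,
          call (Y := HL 1 (S Z) (HL 1 k X)) pl [k, X]], L, l,
        call (Y := HL 2 (S (S n)) (Id u u)) H [u, u]]]]) (by decide +kernel)) rfl

/-- The types of h-level `n + 2` are a retract of the type of their loops. -/
abbrev loopTyNotTy (i : ℕ) : Src := Pi N fun n => Not (HL (i + 1) (S (S n)) (Trunc i (S (S n)))) ⇒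
  Not (HL (i + 1) (S (S n)) (LoopTy i n))

theorem loopTyNot (i : ℕ) : Holds (loopTyNotTy i) := .shift i _ (.of₁ (hlRetr 1) (fun hr =>
  lam fun n => lam fun c => lam fun H =>
    let T : Src := Trunc 0 (S (S n))
    let B (x : E T) : Src := Om 1 (S n) T x
    call c [call (Y := HL 1 (S (S n)) T) hr [S (S n), T, Sg T B,
      lam (A := T) fun x => pair (B := B) x (pt 1 (S n) T x), lam (A := Sg T B) fun u => fst u,
      lam (A := T) fun x => refl x, H]]) (by decide +kernel)) rfl

end Src
end MLTT

namespace MLTT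
open Tm

/-! ### External truncation levels and loop spaces -/

/-- Are `t` and `t'` equal terms of type `T`? -/
noncomputable def equalIn (Γ : Ctx) (t t' T : Tm) : Bool :=
  force t fun t => force t' fun t' => (Checker.check (run 100 t) Γ T).elim false fun u =>
    (Checker.check (run 100 t') Γ T).elim false fun u' => u.beq u'

theorem equalIn_sound {Γ : Ctx} {t t' T : Tm} {i : ℕ} (hT : Deriv (.typ Γ T (univ i)))
    (h : equalIn Γ t t' T = true) : Deriv (.eq Γ t t' T) := by
  rw [equalIn, force_eq, force_eq] at h
  cases hu : Checker.check (run 100 t) Γ T with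
  | none => rw [hu] at h; cases h
  | some u =>
    rw [hu] at h
    cases hu' : Checker.check (run 100 t') Γ T with
    | none => rw [hu'] at h; cases h
    | some u' =>
      rw [hu'] at h
      have e : u = u' := beq_eq _ _ h
      subst e
      exact (Checker.check_sound (run_sound 100 t) hT hu).eq_trans
        (Checker.check_sound (run_sound 100 t') hT hu').eq_symm

/-- The internal form of the natural number `k`. -/
def numeral : ℕ → Tm
  | 0 => zero
  | k + 1 => succ (numeral k)

theorem numeral_subst (σ : ℕ → Tm) (k : ℕ) : (numeral k).subst σ = numeral k := by
  induction k with
  | zero => rfl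
  | succ k ih => rw [numeral, subst, ih]

theorem numeral_wk (k : ℕ) : (numeral k).wk = numeral k := by
  rw [wk_eq_subst, numeral_subst]

theorem numeral_intro {Γ : Ctx} (hΓ : Deriv (.ctx Γ)) (k : ℕ) : Deriv (.typ Γ (numeral k) nat) := by
  induction k with
  | zero => exact .nat_zero hΓ
  | succ k ih => exact .nat_succ ih

/-- The type that `A` has h-level `n`, for an internal natural number `n`. -/
def hLevelAt (i : ℕ) (n A : Tm) : Tm := Src.HL i ⟨fun _ => n⟩ (fun _ => A) 0

/-- The underlying type of the `n`-fold loop space, for an internal natural number `n`. -/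
def loopsAt (i : ℕ) (n A a : Tm) : Tm := Src.Om i ⟨fun _ => n⟩ (fun _ => A) ⟨fun _ => a⟩ 0

theorem hLevelAt_subst (σ : ℕ → Tm) (i : ℕ) (n A : Tm) :
    (hLevelAt i n A).subst σ = hLevelAt i (n.subst σ) (A.subst σ) := rfl

theorem loopsAt_subst (σ : ℕ → Tm) (i : ℕ) (n A a : Tm) :
    (loopsAt i n A a).subst σ = loopsAt i (n.subst σ) (A.subst σ) (a.subst σ) := rfl

set_option maxRecDepth 100000

theorem natCtx (i : ℕ) : Deriv (.ctx [univ i, nat]) :=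
  .ctx_cons (.ctx_cons .ctx_nil (.nat_form (i := 0) .ctx_nil))
    (.univ_intro (.ctx_cons .ctx_nil (.nat_form (i := 0) .ctx_nil)))

theorem loopCtx (i : ℕ) : Deriv (.ctx [var 0, univ i, nat]) :=
  .ctx_cons (natCtx i) (.var_zero (natCtx i))

/-- The recursion equations for h-levels and loop spaces are evaluated for variables only.
Substitution then gives them for arbitrary terms over arbitrary contexts. -/
theorem hLevelAt_zero_var (i : ℕ) : Deriv (.eq [univ i, nat] (hLevelAt i zero (var 0))
    (hLevel 0 (var 0)) (univ i)) :=
  Deriv.lift i (equalIn_sound (Γ := [univ 0, nat]) (t := hLevelAt 0 zero (var 0))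
    (t' := hLevel 0 (var 0)) (T := univ 0) (.univ_intro (natCtx 0)) (by decide +kernel))

theorem hLevelAt_succ_var (i : ℕ) : Deriv (.eq [univ i, nat] (hLevelAt i (succ (var 1)) (var 0))
    (pi (var 0) (pi (var 1) (hLevelAt i (var 3) (id (var 2) (var 1) (var 0))))) (univ i)) :=
  Deriv.lift i (equalIn_sound (Γ := [univ 0, nat]) (t := hLevelAt 0 (succ (var 1)) (var 0))
    (t' := pi (var 0) (pi (var 1) (hLevelAt 0 (var 3) (id (var 2) (var 1) (var 0)))))
    (T := univ 0) (.univ_intro (natCtx 0)) (by decide +kernel))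

theorem loopsAt_zero_var (i : ℕ) : Deriv (.eq [var 0, univ i, nat]
    (loopsAt i zero (var 1) (var 0)) (var 1) (univ i)) :=
  Deriv.lift i (equalIn_sound (Γ := [var 0, univ 0, nat]) (t := loopsAt 0 zero (var 1) (var 0))
    (t' := var 1) (T := univ 0) (.univ_intro (loopCtx 0)) (by decide +kernel))

theorem loopsAt_succ_var (i : ℕ) : Deriv (.eq [var 0, univ i, nat]
    (loopsAt i (succ (var 2)) (var 1) (var 0))
    (loopsAt i (var 2) (id (var 1) (var 0) (var 0)) (refl (var 0))) (univ i)) :=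
  Deriv.lift i (equalIn_sound (Γ := [var 0, univ 0, nat])
    (t := loopsAt 0 (succ (var 2)) (var 1) (var 0))
    (t' := loopsAt 0 (var 2) (id (var 1) (var 0) (var 0)) (refl (var 0)))
    (T := univ 0) (.univ_intro (loopCtx 0)) (by decide +kernel))

section

variable {Γ : Ctx} {A A' a a' n : Tm} {i : ℕ}

theorem isSubst_nat (hn : Deriv (.typ Γ n nat)) (hA : Deriv (.typ Γ A (univ i))) :
    IsSubst Γ (scons A (scons n var)) [univ i, nat] :=
  IsSubst.cons (IsSubst.cons (fun k A hk => by simp at hk) hn) hA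

theorem isSubst_point (hn : Deriv (.typ Γ n nat)) (hA : Deriv (.typ Γ A (univ i)))
    (ha : Deriv (.typ Γ a A)) :
    IsSubst Γ (scons a (scons A (scons n var))) [var 0, univ i, nat] :=
  IsSubst.cons (isSubst_nat hn hA) ha

theorem hLevelAt_zero (hA : Deriv (.typ Γ A (univ i))) :
    Deriv (.eq Γ (hLevelAt i zero A) (hLevel 0 A) (univ i)) :=
  (hLevelAt_zero_var i).subst_eq (σ := scons A (scons zero var)) hA.wf (isSubst_nat (.nat_zero
      hA.wf) hA)

theorem hLevelAt_succ (hn : Deriv (.typ Γ n nat)) (hA : Deriv (.typ Γ A (univ i))) :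
    Deriv (.eq Γ (hLevelAt i (succ n) A)
      (pi A (pi A.wk (hLevelAt i n.wk.wk (id A.wk.wk (var 1) (var 0))))) (univ i)) :=
  (hLevelAt_succ_var i).subst_eq hA.wf (isSubst_nat hn hA)

theorem loopsAt_zero (hA : Deriv (.typ Γ A (univ i))) (ha : Deriv (.typ Γ a A)) :
    Deriv (.eq Γ (loopsAt i zero A a) A (univ i)) :=
  (loopsAt_zero_var i).subst_eq hA.wf (isSubst_point (.nat_zero hA.wf) hA ha)

theorem loopsAt_succ (hn : Deriv (.typ Γ n nat)) (hA : Deriv (.typ Γ A (univ i)))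
    (ha : Deriv (.typ Γ a A)) :
    Deriv (.eq Γ (loopsAt i (succ n) A a) (loopsAt i n (id A a a) (refl a)) (univ i)) :=
  (loopsAt_succ_var i).subst_eq hA.wf (isSubst_point hn hA ha)

theorem idCtx_eq (hA : Deriv (.eq Γ A A' (univ i))) :
    Deriv (.eq (A.wk :: A :: Γ) (id A.wk.wk (var 1) (var 0)) (id A'.wk.wk (var 1) (var 0))
      (univ i)) := by
  have h : Deriv (.typ (A :: Γ) A.wk (univ i)) := hA.typ_left.weaken hA.typ_left
  have hc := Deriv.ctx_cons h.wf h
  exact .id_form_eq ((hA.weaken_eq hA.typ_left).weaken_eq h) (.eq_refl (.var_one hc))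
    (.eq_refl (.var_zero hc))

/-- The context and the types vary in the induction, as the step passes to an identity type over two
more variables. Allowing convertible `A` and `A'` also lets the subject be replaced at the end. -/
theorem hLevelAt_numeral (k : ℕ) (hA : Deriv (.eq Γ A A' (univ i))) :
    Deriv (.eq Γ (hLevelAt i (numeral k) A) (hLevel k A') (univ i)) := by
  induction k generalizing Γ A A' with
  | zero =>
    exact (hLevelAt_zero hA.typ_left).eq_trans (.sig_form_eq hA.typ_left hA
      (.pi_form_eq (hA.typ_left.weaken hA.typ_left) (hA.weaken_eq hA.typ_left) (idCtx_eq hA)))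
  | succ k ih =>
    refine (hLevelAt_succ (numeral_intro hA.wf_eq k) hA.typ_left).eq_trans (.pi_form_eq hA.typ_left
      hA (.pi_form_eq (hA.typ_left.weaken hA.typ_left) (hA.weaken_eq hA.typ_left) ?_))
    rw [numeral_wk, numeral_wk]
    exact ih (idCtx_eq hA)

theorem loopsAt_numeral (k : ℕ) (hA : Deriv (.eq Γ A A' (univ i))) (ha : Deriv (.eq Γ a a' A)) :
    Deriv (.eq Γ (loopsAt i (numeral k) A a) (iterLoopSpace k (A', a')).1 (univ i)) := by
  induction k generalizing A A' a a' with
  | zero => exact (loopsAt_zero hA.typ_left ha.typ_left).eq_trans hA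
  | succ k ih =>
    exact (loopsAt_succ (numeral_intro hA.wf_eq k) hA.typ_left ha.typ_left).eq_trans
      (ih (.id_form_eq hA ha ha) (.id_intro_eq hA.typ_left ha))

end

/-- The types of `U_i` of h-level `n`, for an internal natural number `n`. -/
def truncAt (i : ℕ) (n : Tm) : Tm := sig (univ i) (hLevelAt i n.wk (var 0))

/-- The `(n + 1)`-loops in the types of `U_i` of h-level `n + 2`. -/
def loopAt (i : ℕ) (n : Tm) : Tm :=
  sig (truncAt i (succ (succ n)))
    (loopsAt (i + 1) (succ n.wk) (truncAt i (succ (succ n.wk))) (var 0))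

theorem truncAt_subst (σ : ℕ → Tm) (i : ℕ) (n : Tm) :
    (truncAt i n).subst σ = truncAt i (n.subst σ) := by
  rw [truncAt, subst, hLevelAt_subst, subst_wk]; rfl

theorem loopAt_subst (σ : ℕ → Tm) (i : ℕ) (n : Tm) :
    (loopAt i n).subst σ = loopAt i (n.subst σ) := by
  rw [loopAt, subst, loopsAt_subst, truncAt_subst, truncAt_subst]
  simp only [subst, subst_wk]; rfl

theorem neg_subst (σ : ℕ → Tm) (A : Tm) : (neg A).subst σ = neg (A.subst σ) := by
  rw [neg, subst_arrow]; rfl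

theorem inhab_numeral (m : ℕ) {B : Tm} (h : Inhab (pi nat B)) : Inhab (B.inst (numeral m)) :=
  let ⟨_, ht⟩ := h
  ⟨_, .pi_elim ht (numeral_intro .ctx_nil m)⟩

theorem inhab_arrow {A B : Tm} (h : Inhab (arrow A B)) (ha : Inhab A) : Inhab B := by
  obtain ⟨f, hf⟩ := h
  obtain ⟨a, ha⟩ := ha
  exact ⟨_, hf.arrow_elim ha⟩

theorem inhab_hlTruncAt (i m : ℕ) :
    Inhab (hLevelAt (i + 1) (numeral (m + 2)) (truncAt i (numeral (m + 1)))) := by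
  have h := inhab_numeral m (Src.hlTrunc i)
  exact h

theorem inhab_hlLoopAt (i m : ℕ) :
    Inhab (hLevelAt (i + 1) (numeral (m + 3)) (loopAt i (numeral m))) :=
  inhab_numeral m (Src.hlLoopTy i)

theorem truncAt_wk (i : ℕ) (n : Tm) : (truncAt i n).wk = truncAt i n.wk := by
  rw [wk_eq_subst, truncAt_subst, wk_eq_subst]

theorem loopAt_wk (i : ℕ) (n : Tm) : (loopAt i n).wk = loopAt i n.wk := by
  rw [wk_eq_subst, loopAt_subst, wk_eq_subst]

theorem neg_hLevelAt_wk (i : ℕ) (n A : Tm) :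
    (neg (hLevelAt i n A)).wk = neg (hLevelAt i n.wk A.wk) := by
  rw [wk_eq_subst, neg_subst, hLevelAt_subst, ← wk_eq_subst, ← wk_eq_subst]

/-- This induction has to be external, as the universe level grows with `n`. The internal
`truncStep` is uniform in its number at a fixed level and is used at level `n` and numeral `n`. -/
theorem inhab_not_truncAt (n : ℕ) :
    Inhab (neg (hLevelAt (n + 1) (numeral (n + 2)) (truncAt n (numeral (n + 2))))) := by
  induction n with
  | zero => exact Src.truncSet 0
  | succ n ih =>
    refine inhab_arrow ?_ ih
    rw [arrow, neg_hLevelAt_wk, truncAt_wk]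
    exact inhab_numeral n (Src.truncStep n)

theorem inhab_not_loopAt (n : ℕ) :
    Inhab (neg (hLevelAt (n + 1) (numeral (n + 2)) (loopAt n (numeral n)))) := by
  refine inhab_arrow ?_ (inhab_not_truncAt n)
  rw [arrow, neg_hLevelAt_wk, loopAt_wk]
  exact inhab_numeral n (Src.loopTyNot n)

/-! ### The subuniverses and the types of loops -/

theorem truncAt_eq {Γ : Ctx} (hΓ : Deriv (.ctx Γ)) (i k : ℕ) :
    Deriv (.eq Γ (truncAt i (numeral k)) (sig (univ i) (hLevel k (var 0))) (univ (i + 1))) := by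
  have h := Deriv.univ_intro (i := i) hΓ
  rw [truncAt, numeral_wk]
  exact .sig_form_eq h (.eq_refl h)
    (.univ_cumul_eq (hLevelAt_numeral k (.eq_refl (.var_zero (.ctx_cons hΓ h)))))

theorem truncAt_eq_subUniv {Γ : Ctx} (hΓ : Deriv (.ctx Γ)) (n : ℕ) :
    Deriv (.eq Γ (truncAt n (numeral (n + 2))) (subUniv n n) (univ (n + 1))) :=
  truncAt_eq hΓ n (n + 2)

theorem loopAt_eq_loopTy (n : ℕ) :
    Deriv (.eq [] (loopAt n (numeral n)) (loopTy n) (univ (n + 1))) := by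
  have h := truncAt_eq_subUniv .ctx_nil n
  have hc := Deriv.ctx_cons .ctx_nil h.typ_left
  refine .sig_form_eq h.typ_left h ?_
  rw [numeral_wk]
  refine loopsAt_numeral (n + 1) (truncAt_eq_subUniv hc n) (.eq_refl ?_)
  have := Deriv.var_zero hc
  rwa [truncAt_wk, numeral_wk] at this

theorem inhab_conv {A B : Tm} {i : ℕ} (h : Deriv (.eq [] A B (univ i))) (hA : Inhab A) : Inhab B :=
  let ⟨_, ht⟩ := hA
  ⟨_, ht.conv h⟩

theorem neg_eq {A B : Tm} {i : ℕ} (h : Deriv (.eq [] A B (univ i))) :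
    Deriv (.eq [] (neg A) (neg B) (univ i)) :=
  .pi_form_eq h.typ_left h (.eq_refl (.empty_form (.ctx_cons .ctx_nil h.typ_left)))

theorem isStrictSucc_of_eq {i k : ℕ} {n : ℤ} {A B : Tm} (hn : (n + 2).toNat = k)
    (hn' : (n + 1 + 2).toNat = k + 1) (h : Deriv (.eq [] A B (univ i)))
    (ht : Inhab (hLevelAt i (numeral (k + 1)) A)) (hnt : Inhab (neg (hLevelAt i (numeral k) A))) :
    IsStrictSucc i n B where
  isType := h.typ_right
  trunc := by
    rw [isNType, hn']
    exact inhab_conv (hLevelAt_numeral _ h) ht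
  notTrunc := by
    rw [isNType, hn]
    exact inhab_conv (neg_eq (hLevelAt_numeral _ h)) hnt

theorem isStrictSucc_subUniv (n : ℕ) : IsStrictSucc (n + 1) n (subUniv n n) :=
  isStrictSucc_of_eq (k := n + 2) (by omega) (by omega) (truncAt_eq_subUniv .ctx_nil n)
    (inhab_hlTruncAt n (n + 1)) (inhab_not_truncAt n)

theorem isStrictSucc_loopTy (n : ℕ) : IsStrictSucc (n + 1) n (loopTy n) :=
  isStrictSucc_of_eq (k := n + 2) (by omega) (by omega) (loopAt_eq_loopTy n)
    (inhab_hlLoopAt n n) (inhab_not_loopAt n)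

/-! ### The two lowest cases: the two-element type and the empty type. -/

theorem isStrictSucc_two : IsStrictSucc 0 (-1) two :=
  isStrictSucc_of_eq (k := 1) rfl rfl
    (.eq_refl (.sum_form (.unit_form .ctx_nil) (.unit_form .ctx_nil))) (Src.twoSet 0)
    (Src.twoNotProp 0)

theorem inhab_hLevelAt_empty : Inhab (hLevelAt 0 (numeral 1) empty) :=
  Src.Holds.of₀ (T := Src.HL 0 (Src.S Src.Z) Src.Empty) (Src.cast (Src.lam (A := Src.Empty) fun x =>
    Src.absurd (Src.Pi Src.Empty fun y => Src.HL 0 Src.Z (Src.Id x y)) x)) (by decide +kernel)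

theorem inhab_not_hLevelAt_empty : Inhab (neg (hLevelAt 0 (numeral 0) empty)) :=
  Src.Holds.of₀ (T := Src.Not (Src.HL 0 Src.Z Src.Empty)) (Src.lam fun h =>
    Src.fst (B := fun a => Src.Pi Src.Empty fun x => Src.Id a x) (Src.cast h)) (by decide +kernel)

theorem isStrictSucc_empty : IsStrictSucc 0 (-2) empty :=
  isStrictSucc_of_eq (k := 0) rfl rfl (.eq_refl (.empty_form .ctx_nil)) inhab_hLevelAt_empty
    inhab_not_hLevelAt_empty

end MLTT

theorem theorem2 :
    (∀ n : ℤ, -2 ≤ n → ∃ (i : ℕ) (A : MLTT.Tm), MLTT.IsStrictSucc i n A) ∧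
    (∀ n : ℤ, -1 ≤ n → MLTT.IsStrictSucc (n + 1).toNat n (MLTT.Tm.loopTy n)) ∧
    (∀ n : ℕ, MLTT.IsStrictSucc (n + 1) n (MLTT.Tm.subUniv n n)) := by
  have h : ∀ n : ℤ, -1 ≤ n → MLTT.IsStrictSucc (n + 1).toNat n (MLTT.Tm.loopTy n) := by
    intro n hn
    rcases n with n | n
    · exact MLTT.isStrictSucc_loopTy n
    -- A negative integer that is at least `-1` is `-1`, represented by `Int.negSucc 0`.
    · obtain rfl : n = 0 := by omega
      exact MLTT.isStrictSucc_two
  refine ⟨fun n hn => ?_, h, MLTT.isStrictSucc_subUniv⟩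
  rcases hn.eq_or_lt with rfl | hn
  -- Only `-2` lies outside the range of `loopTy`. The empty type is a proposition that is not
  -- contractible.
  · exact ⟨0, _, MLTT.isStrictSucc_empty⟩
  · exact ⟨_, _, h n (by omega)⟩
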